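/- Let $X$ be a compact connected complex manifold of dimension $n$, let $\phi_j : X_j \to X$ be a tower of coverings, i.e. holomorphic Galois coverings by connected complex manifolds with $\pi_1(X) \supset \pi_1(X_1) \supset \pi_1(X_2) \supset \cdots$ and every $\pi_1(X_j)$ normal of finite index in $\pi_1(X)$, and suppose that the tower converges to an infinite holomorphic Galois covering $\phi : \widetilde X \to X$ with $\widetilde X$ connected, i.e. $\bigcap_j \pi_1(X_j) = \pi_1(\widetilde X)$ (all as subgroups of $\pi_1(X)$). Let $\widetilde\phi_j : \widetilde X \to X_j$ be holomorphic coverings with $\phi = \phi_j \circ \widetilde\phi_j$. For a complex manifold $M$ of dimension $n$ let $\Omega^{n,0}_{(2)}(M)$ be the Hilbert space of square integrable holomorphic $(n,0)$-forms on $M$ with inner product $\langle f, g\rangle = i^{n^2} 2^{-n} \int_M f \wedge \overline g$, and let $\mathcal B_M(z,w) = \sum_\alpha s_\alpha(z) \wedge \overline{s_\alpha(w)}$ be its Bergman kernel, where $\{s_\alpha\}$ is any orthonormal basis of $\Omega^{n,0}_{(2)}(M)$. Since the $(n,n)$-forms $\mathcal B_{X_j}(w,w)$ and $\mathcal B_{\widetilde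 X}(w,w)$ are invariant under deck transformations, they descend to $(n,n)$-forms $\phi_{j*}\mathcal B_{X_j}(w,w)$ and $\phi_*\mathcal B_{\widetilde X}(w,w)$ on $X$ (the forms on $X$ whose pull-backs under $\phi_j$ and $\phi$ are the given ones). Assume that $$\int_X \phi_{j*}\mathcal B_{X_j}(w,w) \longrightarrow \int_X \phi_*\mathcal B_{\widetilde X}(w,w) \qquad (j \to \infty).$$ Then $\widetilde\phi_j^*\mathcal B_{X_j}(z,w) \to \mathcal B_{\widetilde X}(z,w)$ locally in the $C^\infty$-topology on $\widetilde X \times \widetilde X$; that is, for all holomorphic charts $z$ on $U \subset \widetilde X$ and $w$ on $V \subset \widetilde X$, the coefficients of $dz \wedge d\overline w$ in these (smooth) forms converge, together with all their partial derivatives, uniformly on compact subsets of $U \times V$. -/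

import Mathlib

open scoped Manifold ContDiff Topology
open MeasureTheory Filter

noncomputable section

namespace BergmanTower

/-! ### Forms on complex manifolds

A complex manifold of dimension `n` is a manifold modelled on `Fin n → ℂ` with holomorphic
transition maps, that is `IsManifold 𝓘(ℂ, Fin n → ℂ) ω X`. -/

/-- Forms of bidegree `(n,0)`: a `ℂ`-multilinear alternating `n`-form on every holomorphic tangent
space. No regularity is imposed. -/
abbrev TopForm (n : ℕ) (X : Type*) [TopologicalSpace X] [ChartedSpace (Fin n → ℂ) X] : Type _ :=
  ∀ x : X, TangentSpace 𝓘(ℂ, Fin n → ℂ) x [⋀^Fin n]→ₗ[ℂ] ℂ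

/-- Forms of bidegree `(n,n)`. Such a form `η` is recorded through its values
`η x v = η_x(v₁, …, vₙ, v̄₁, …, v̄ₙ)` on frames `v` of holomorphic tangent vectors; these values
determine it, and on a coordinate frame the value is the coefficient of `dz ∧ dz̄`. -/
abbrev VolForm (n : ℕ) (X : Type*) [TopologicalSpace X] [ChartedSpace (Fin n → ℂ) X] : Type _ :=
  ∀ x : X, (Fin n → TangentSpace 𝓘(ℂ, Fin n → ℂ) x) → ℂ

/-- Double forms on `X × X`, of bidegree `(n,0)` in the first variable `z` and `(0,n)` in the second
variable `w`. `K z w v u` is the value on the frame `(v₁, …, vₙ, ū₁, …, ūₙ)` at `(z, w)`, where the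
`vᵢ` (the `uᵢ`) are holomorphic tangent vectors at `z` (at `w`); on coordinate frames it is the
coefficient of `dz ∧ dw̄`. -/
abbrev DoubleForm (n : ℕ) (X : Type*) [TopologicalSpace X] [ChartedSpace (Fin n → ℂ) X] : Type _ :=
  ∀ z w : X, (Fin n → TangentSpace 𝓘(ℂ, Fin n → ℂ) z) →
    (Fin n → TangentSpace 𝓘(ℂ, Fin n → ℂ) w) → ℂ

section Forms

variable {n : ℕ} {X : Type*} [TopologicalSpace X] [ChartedSpace (Fin n → ℂ) X]

/-- The coordinate frame `∂/∂z₁, …, ∂/∂zₙ` of the chart `e`, at the point with coordinate `a`. -/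
def coordFrame (e : OpenPartialHomeomorph X (Fin n → ℂ)) (a : Fin n → ℂ) :
    Fin n → TangentSpace 𝓘(ℂ, Fin n → ℂ) (e.symm a) :=
  fun i => mfderiv 𝓘(ℂ, Fin n → ℂ) 𝓘(ℂ, Fin n → ℂ) e.symm a (Pi.single i (1 : ℂ) : Fin n → ℂ)

/-- The coefficient `f*` in `f = f* dz₁ ∧ ⋯ ∧ dzₙ`, as a function of the coordinates. -/
def TopForm.coeff (f : TopForm n X) (e : OpenPartialHomeomorph X (Fin n → ℂ)) (a : Fin n → ℂ) : ℂ :=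
  f (e.symm a) (coordFrame e a)

/-- The coefficient `η*` in `η = η* dz ∧ dz̄`. -/
def VolForm.coeff (η : VolForm n X) (e : OpenPartialHomeomorph X (Fin n → ℂ)) (a : Fin n → ℂ) : ℂ :=
  η (e.symm a) (coordFrame e a)

/-- The coefficient `K*` in `K = K* dz ∧ dw̄`, for a chart `z = e` in the first and a chart `w = e'`
in the second variable. -/
def DoubleForm.coeff (K : DoubleForm n X) (e e' : OpenPartialHomeomorph X (Fin n → ℂ))
    (p : (Fin n → ℂ) × (Fin n → ℂ)) : ℂ :=
  K (e.symm p.1) (e'.symm p.2) (coordFrame e p.1) (coordFrame e' p.2)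

/-- The restriction of a double form to the diagonal, an `(n,n)`-form. -/
def DoubleForm.diag (K : DoubleForm n X) : VolForm n X :=
  fun x v => K x x v v

/-- `f` is holomorphic: its coefficient in every holomorphic chart is a holomorphic function. -/
def TopForm.IsHolomorphic (f : TopForm n X) : Prop :=
  ∀ e ∈ IsManifold.maximalAtlas 𝓘(ℂ, Fin n → ℂ) ω X, DifferentiableOn ℂ (f.coeff e) e.target

/-- The `(n,n)`-form `f ∧ ḡ`. -/
def wedgeConj (f g : TopForm n X) : VolForm n X :=
  fun x v => f x v * (starRingEnd ℂ) (g x v)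

/-! ### Integration of `(n,n)`-forms -/

section Integration

variable [MeasurableSpace X]

/-- The measure `|η|` of an `(n,n)`-form `η`: the measure on `X` which in every holomorphic chart is
`|η*| dλ`, with `λ` the Lebesgue measure of `ℂⁿ`. The measures defined by the single charts agree on
overlaps (a change of coordinates multiplies `η*` by `|det|²`, the real Jacobian determinant), so
they are the restrictions of one measure to the domains of the charts, and that measure is their
supremum. -/
def VolForm.absMeasure (η : VolForm n X) : Measure X :=
  ⨆ e : IsManifold.maximalAtlas 𝓘(ℂ, Fin n → ℂ) ω X,
    ((volume.restrict e.1.target).withDensity (fun a => ‖η.coeff e.1 a‖ₑ)).map e.1.symm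

/-- The phase of an `(n,n)`-form: the complex number of modulus one (or zero, where `η` vanishes)
by which `η` differs from `|η|`. The basis of the tangent space used to evaluate `η` is immaterial,
since another basis multiplies the value by `|det|² > 0`. -/
def VolForm.phase (η : VolForm n X) (x : X) : ℂ :=
  let c : ℂ := η x (fun i => (Pi.single i (1 : ℂ) : Fin n → ℂ))
  c / (‖c‖ : ℂ)

/-- The integral `∫_X η` of an `(n,n)`-form over the canonically oriented complex manifold `X`.
In coordinates `dz ∧ dz̄ = 2ⁿ i^(-n²) dλ`. -/
def VolForm.integral (η : VolForm n X) : ℂ :=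
  (2 : ℂ) ^ n * (Complex.I⁻¹) ^ (n ^ 2) * ∫ x, η.phase x ∂η.absMeasure

/-- The space of square integrable holomorphic `(n,0)`-forms. -/
def bergmanSpace (n : ℕ) (X : Type*) [TopologicalSpace X] [ChartedSpace (Fin n → ℂ) X]
    [MeasurableSpace X] : Set (TopForm n X) :=
  {f | f.IsHolomorphic ∧ (wedgeConj f f).absMeasure Set.univ < ⊤}

/-- The inner product `⟨f, g⟩ = i^(n²) 2^(-n) ∫_X f ∧ ḡ`. -/
def formInner (f g : TopForm n X) : ℂ :=
  Complex.I ^ (n ^ 2) * ((2 : ℂ) ^ n)⁻¹ * (wedgeConj f g).integral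

/-- `S` is an orthonormal basis of the Hilbert space of square integrable holomorphic
`(n,0)`-forms: a complete orthonormal system. -/
structure IsOrthonormalBasis (S : Set (TopForm n X)) : Prop where
  subset : S ⊆ bergmanSpace n X
  norm_one : ∀ s ∈ S, formInner s s = 1
  orthogonal : ∀ s ∈ S, ∀ t ∈ S, s ≠ t → formInner s t = 0
  complete : ∀ f ∈ bergmanSpace n X, (∀ s ∈ S, formInner f s = 0) → f = 0

open Classical in
/-- The Bergman kernel `B_X(z, w) = ∑ s(z) ∧ conj s(w)`, the sum over an orthonormal basis of the
square integrable holomorphic `(n,0)`-forms. It does not depend on the basis. -/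
def bergmanKernel (n : ℕ) (X : Type*) [TopologicalSpace X] [ChartedSpace (Fin n → ℂ) X]
    [MeasurableSpace X] : DoubleForm n X :=
  fun z w v u =>
    ∑' s : (Classical.epsilon (fun S : Set (TopForm n X) => IsOrthonormalBasis S) :
      Set (TopForm n X)), s.1 z v * (starRingEnd ℂ) (s.1 w u)

end Integration

/-! ### Pull-back and push-forward -/

variable {Y : Type*} [TopologicalSpace Y] [ChartedSpace (Fin n → ℂ) Y]

/-- The pull-back `φ^* K` of a double form (by `φ × φ`). -/
def DoubleForm.pullback (φ : Y → X) (K : DoubleForm n X) : DoubleForm n Y :=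
  fun z w v u => K (φ z) (φ w)
    (fun i => mfderiv 𝓘(ℂ, Fin n → ℂ) 𝓘(ℂ, Fin n → ℂ) φ z (v i))
    (fun i => mfderiv 𝓘(ℂ, Fin n → ℂ) 𝓘(ℂ, Fin n → ℂ) φ w (u i))

/-- The pull-back `φ^* η` of an `(n,n)`-form. -/
def VolForm.pullback (φ : Y → X) (η : VolForm n X) : VolForm n Y :=
  fun y v => η (φ y) (fun i => mfderiv 𝓘(ℂ, Fin n → ℂ) 𝓘(ℂ, Fin n → ℂ) φ y (v i))

open Classical in
/-- The push-forward `φ_* η` under a Galois covering `φ : Y → X = Y / G` of an `(n,n)`-form `η` on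
`Y` which is invariant under the group `G` of deck transformations: the form on the quotient `Y / G`
to which `η` descends, i.e. the unique form on `X` whose pull-back to `Y` is `η`. (It is not the sum
over the fibres.) -/
def VolForm.pushforward (φ : Y → X) (η : VolForm n Y) : VolForm n X :=
  Classical.epsilon (fun ξ : VolForm n X => ξ.pullback φ = η)

/-! ### Convergence -/

/-- `K_j → K` locally in the `C^∞`-topology on `X × X`: the forms are smooth and, in all pairs of
holomorphic charts, all (real) partial derivatives of the coefficients converge locally
uniformly. -/
def TendstoLocallySmoothly (K : ℕ → DoubleForm n X) (L : DoubleForm n X) : Prop :=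
  ∀ e ∈ IsManifold.maximalAtlas 𝓘(ℂ, Fin n → ℂ) ω X,
  ∀ e' ∈ IsManifold.maximalAtlas 𝓘(ℂ, Fin n → ℂ) ω X,
    (∀ j, ContDiffOn ℝ ∞ ((K j).coeff e e') (e.target ×ˢ e'.target)) ∧
    ContDiffOn ℝ ∞ (L.coeff e e') (e.target ×ˢ e'.target) ∧
    ∀ m : ℕ, TendstoLocallyUniformlyOn
      (fun j => iteratedFDeriv ℝ m ((K j).coeff e e'))
      (iteratedFDeriv ℝ m (L.coeff e e')) atTop (e.target ×ˢ e'.target)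

end Forms

/-! ### Towers of coverings -/

section Towers

variable {n : ℕ} {X Y : Type*} [TopologicalSpace X] [ChartedSpace (Fin n → ℂ) X]
  [TopologicalSpace Y] [ChartedSpace (Fin n → ℂ) Y]

/-- The deck transformations of `φ : Y → X`: the biholomorphic maps `f` of `Y` with `φ ∘ f = φ`. -/
def DeckTransformation (n : ℕ) {X Y : Type*} [TopologicalSpace X] [TopologicalSpace Y]
    [ChartedSpace (Fin n → ℂ) Y] (φ : Y → X) : Type _ :=
  {f : Y ≃ₘ^ω⟮𝓘(ℂ, Fin n → ℂ), 𝓘(ℂ, Fin n → ℂ)⟯ Y // ∀ y, φ (f y) = φ y}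

/-- Holomorphic covering maps: covering maps which are locally biholomorphic. -/
structure IsHolomorphicCovering (n : ℕ) {X Y : Type*} [TopologicalSpace X]
    [ChartedSpace (Fin n → ℂ) X] [TopologicalSpace Y] [ChartedSpace (Fin n → ℂ) Y]
    (φ : Y → X) : Prop where
  isCoveringMap : IsCoveringMap φ
  isLocalBiholomorphism : IsLocalDiffeomorph 𝓘(ℂ, Fin n → ℂ) 𝓘(ℂ, Fin n → ℂ) ω φ

/-- Holomorphic Galois coverings: the deck transformations act transitively on every fibre. -/
structure IsGaloisCovering (n : ℕ) {X Y : Type*} [TopologicalSpace X]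
    [ChartedSpace (Fin n → ℂ) X] [TopologicalSpace Y] [ChartedSpace (Fin n → ℂ) Y]
    (φ : Y → X) : Prop extends IsHolomorphicCovering n φ where
  transitive : ∀ y y' : Y, φ y = φ y' → ∃ f : DeckTransformation n φ, f.1 y = y'

/-- The image `φ_* π₁(Y, y) ⊆ π₁(X, x)`, where `φ y = x`. -/
def coveringSubgroup {X Y : Type*} [TopologicalSpace X] [TopologicalSpace Y] (φ : C(Y, X))
    {y : Y} {x : X} (h : φ y = x) : Subgroup (FundamentalGroup X x) :=
  (FundamentalGroup.mapOfEq (f := φ) h).range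

/-- A tower of coverings `φ_j : X_j → X`: holomorphic Galois coverings with
`π₁(X) ⊇ π₁(X_0) ⊇ π₁(X_1) ⊇ ⋯`, each `π₁(X_j)` normal of finite index in `π₁(X)`.
For a Galois covering the image of `π₁(X_j)` in `π₁(X, x)` is the same for all base points over
`x`. -/
structure IsTower (n : ℕ) {X : Type*} [TopologicalSpace X] [ChartedSpace (Fin n → ℂ) X]
    {Xs : ℕ → Type*} [∀ j, TopologicalSpace (Xs j)] [∀ j, ChartedSpace (Fin n → ℂ) (Xs j)]
    (φ : ∀ j, C(Xs j, X)) : Prop where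
  galois : ∀ j, IsGaloisCovering n (φ j)
  antitone : ∀ (x : X) (y : ∀ j, Xs j) (h : ∀ j, φ j (y j) = x),
    Antitone (fun j => coveringSubgroup (φ j) (h j))
  normal : ∀ (j : ℕ) (x : X) (y : Xs j) (h : φ j y = x), (coveringSubgroup (φ j) h).Normal
  finiteIndex : ∀ (j : ℕ) (x : X) (y : Xs j) (h : φ j y = x),
    (coveringSubgroup (φ j) h).FiniteIndex

/-- The tower `φ_j : X_j → X` converges to the infinite Galois covering `φ : X̃ → X`:
`⋂ π₁(X_j) = π₁(X̃)` as subgroups of `π₁(X)`. -/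
structure TowerConvergesTo (n : ℕ) {X : Type*} [TopologicalSpace X] [ChartedSpace (Fin n → ℂ) X]
    {Xs : ℕ → Type*} [∀ j, TopologicalSpace (Xs j)] [∀ j, ChartedSpace (Fin n → ℂ) (Xs j)]
    {Xt : Type*} [TopologicalSpace Xt] [ChartedSpace (Fin n → ℂ) Xt]
    (φ : ∀ j, C(Xs j, X)) (φt : C(Xt, X)) : Prop where
  galois : IsGaloisCovering n φt
  infinite : Infinite (DeckTransformation n φt)
  iInf_eq : ∀ (x : X) (y : ∀ j, Xs j) (h : ∀ j, φ j (y j) = x) (yt : Xt) (ht : φt yt = x),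
    ⨅ j, coveringSubgroup (φ j) (h j) = coveringSubgroup φt ht

end Towers

end BergmanTower

end

/-! Write `K_j` for the pull-back of the Bergman kernel of `X_j` to `X̃` and `K` for the kernel of
`X̃`. The proof is a normal families argument: the `K_j` are locally bounded, and every limit `L` of
them must equal `K`.

Bounds. On a coordinate ball on which `φ` is injective, each `φ̃_j` is injective too. The mean value
inequality applied to the section `B_{X_j}(·, w)`, whose square norm is `B_{X_j}(w, w)`, then bounds
the diagonal coefficient of `K_j` by a constant depending only on the radius
(`pullback_diag_coeff_re_le`). The inequality `|ab| ≤ (|a|² + |b|²) / 2` extends this off the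
diagonal. Since `K_j` is holomorphic in `(z, w̄)`, Cauchy estimates upgrade pointwise convergence to
locally uniform convergence of all derivatives.

Limits are at most `K` on the diagonal. By covering theory, `⋂ π₁(X_j) = π₁(X̃)` makes `φ̃_j`
injective on any given compact set for large `j` (`eventually_injOn_of_isCompact`). A Fatou argument
then gives `‖L(·, w)‖² ≤ L(w, w)` (`exists_section_of_tendsto`), and the reproducing property of `K`
with Cauchy–Schwarz gives `L(w, w)² ≤ L(w, w) K(w, w)`, so `L ≤ K` on the diagonal.

The hypothesis on integrals forces equality. All diagonal forms descend to the compact manifold `X`,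
where locally uniform convergence passes to masses. Thus the descended forms of `L` and `K` are
continuous, comparable and of equal finite mass, hence equal (`VolForm.eq_of_le_of_absMeasure_eq`).
Finally `L(·, w)` has norm at most that of `K(·, w)` and the same value at `w`, and `K(·, w)` is the
only such form (`eq_bergmanKernel_of_absMeasure_le`). So `L = K` (`eq_bergmanKernel_of_tendsto`);
running over ultrafilters turns this into convergence of the whole sequence.

The analytic groundwork realises the square integrable holomorphic forms as a closed subspace of an
`L²`-space over a countable partition of the manifold into pieces of charts. -/

namespace BergmanTower

/-! ### Holomorphic maps on finite-dimensional spaces -/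

section Holomorphic

variable {E F ι : Type*} [NormedAddCommGroup E] [NormedSpace ℂ E]
  [NormedAddCommGroup F] [NormedSpace ℂ F]

/-- Cauchy's estimate for the derivative of a bounded holomorphic map on a ball. -/
theorem norm_fderiv_le_of_bounded_on_ball {f : E → F} {x : E} {r C : ℝ} (hr : 0 < r)
    (hf : DifferentiableOn ℂ f (Metric.ball x r)) (hC : ∀ y ∈ Metric.ball x r, ‖f y‖ ≤ C) :
    ‖fderiv ℂ f x‖ ≤ C / (r / 2) := by
  have hC0 : 0 ≤ C := (norm_nonneg _).trans (hC x (Metric.mem_ball_self hr))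
  refine ContinuousLinearMap.opNorm_le_of_unit_norm (by positivity) fun v hv => ?_
  -- Restriction to the complex line through `x` in a unit direction `v` reduces to one variable.
  -- The circle has radius `r / 2` because `f` is controlled only on the open ball.
  have hmem : ∀ t : ℂ, ‖t‖ < r → x + t • v ∈ Metric.ball x r := by
    intro t ht
    simpa [Metric.mem_ball, dist_eq_norm, norm_smul, hv] using ht
  have hd : ∀ t : ℂ, ‖t‖ < r → DifferentiableAt ℂ (fun t : ℂ => f (x + t • v)) t := by
    intro t ht
    have h1 : DifferentiableAt ℂ f (x + t • v) :=
      (hf _ (hmem t ht)).differentiableAt (Metric.isOpen_ball.mem_nhds (hmem t ht))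
    exact h1.comp t (by fun_prop)
  have hderiv : deriv (fun t : ℂ => f (x + t • v)) 0 = fderiv ℂ f x v := by
    have h1 : HasFDerivAt f (fderiv ℂ f x) (x + (0 : ℂ) • v) := by
      simpa using ((hf x (Metric.mem_ball_self hr)).differentiableAt
        (Metric.ball_mem_nhds x hr)).hasFDerivAt
    have h2 : HasDerivAt (fun t : ℂ => x + t • v) v 0 := by
      simpa using ((hasDerivAt_id (0 : ℂ)).smul_const v).const_add x
    exact (h1.comp_hasDerivAt 0 h2).deriv
  rw [← hderiv]
  refine Complex.norm_deriv_le_of_forall_mem_sphere_norm_le (by positivity) ?_ ?_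
  · refine DifferentiableOn.diffContOnCl fun t ht => ?_
    rw [closure_ball _ (by positivity)] at ht
    exact (hd t (by simp at ht; linarith)).differentiableWithinAt
  · intro t ht
    exact hC _ (hmem t (by simp at ht; linarith))

/-- Every point of the smaller ball is the centre of a ball of radius `r` on which `f` is bounded,
so Cauchy's estimate bounds the derivative throughout a convex set. The Lipschitz constant does not
depend on `f`: this is the equicontinuity behind all compactness arguments below. -/
theorem norm_sub_le_of_bounded_on_ball {f : E → F} {x : E} {r C : ℝ} (hr : 0 < r)
    (hf : DifferentiableOn ℂ f (Metric.ball x (2 * r)))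
    (hC : ∀ y ∈ Metric.ball x (2 * r), ‖f y‖ ≤ C) {y z : E}
    (hy : y ∈ Metric.ball x r) (hz : z ∈ Metric.ball x r) :
    ‖f z - f y‖ ≤ C / (r / 2) * ‖z - y‖ := by
  have hsub : ∀ y ∈ Metric.ball x r, Metric.ball y r ⊆ Metric.ball x (2 * r) := by
    intro y hy
    refine Metric.ball_subset_ball' ?_
    rw [Metric.mem_ball] at hy
    linarith
  refine Convex.norm_image_sub_le_of_norm_fderiv_le (𝕜 := ℂ) (s := Metric.ball x r) ?_ ?_
    (convex_ball x r) hy hz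
  · intro w hw
    have : w ∈ Metric.ball x (2 * r) := hsub w hw (Metric.mem_ball_self hr)
    exact (hf w this).differentiableAt (Metric.isOpen_ball.mem_nhds this)
  · intro w hw
    exact norm_fderiv_le_of_bounded_on_ball hr (hf.mono (hsub w hw))
      fun u hu => hC u (hsub w hw hu)

/-- A pointwise convergent, uniformly bounded family of holomorphic maps converges uniformly on
smaller balls. -/
theorem tendstoUniformlyOn_ball_of_bounded [ProperSpace E] {l : Filter ι} [l.NeBot] {f : ι → E → F}
    {g : E → F} {x : E} {r C : ℝ} (hr : 0 < r)
    (hf : ∀ᶠ i in l, DifferentiableOn ℂ (f i) (Metric.ball x (4 * r)) ∧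
      ∀ y ∈ Metric.ball x (4 * r), ‖f i y‖ ≤ C)
    (hg : ∀ y ∈ Metric.ball x (4 * r), Tendsto (fun i => f i y) l (𝓝 (g y))) :
    TendstoUniformlyOn f g l (Metric.ball x r) := by
  set M : ℝ := C / (2 * r / 2) with hM
  have hLip : ∀ᶠ i in l, ∀ y ∈ Metric.ball x (2 * r), ∀ z ∈ Metric.ball x (2 * r),
      ‖f i z - f i y‖ ≤ M * ‖z - y‖ := by
    filter_upwards [hf] with i hi y hy z hz
    have h4 : 4 * r = 2 * (2 * r) := by ring
    rw [h4] at hi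
    exact norm_sub_le_of_bounded_on_ball (by positivity) hi.1 hi.2 hy hz
  have hsub : Metric.ball x (2 * r) ⊆ Metric.ball x (4 * r) := Metric.ball_subset_ball (by linarith)
  have hLipg : ∀ y ∈ Metric.ball x (2 * r), ∀ z ∈ Metric.ball x (2 * r),
      ‖g z - g y‖ ≤ M * ‖z - y‖ := by
    intro y hy z hz
    refine le_of_tendsto ((hg z (hsub hz)).sub (hg y (hsub hy))).norm ?_
    filter_upwards [hLip] with i hi using hi y hy z hz
  have hM0 : 0 ≤ M := by
    obtain ⟨i, hi⟩ := hf.exists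
    have : 0 ≤ C := (norm_nonneg _).trans (hi.2 x (Metric.mem_ball_self (by positivity)))
    positivity
  rw [Metric.tendstoUniformlyOn_iff]
  intro ε hε
  -- The summand `1` covers the case `M = 0`. On a finite `δ`-net pointwise convergence is uniform,
  -- and the common Lipschitz constant carries it to the ball.
  set δ : ℝ := ε / (3 * (M + 1)) with hδ
  have hδ0 : 0 < δ := by positivity
  have hMδ : M * δ < ε / 3 := by
    rw [hδ, mul_div_assoc', div_lt_div_iff₀ (by positivity) (by norm_num)]
    nlinarith
  obtain ⟨s, hsK, hsf, hsc⟩ := (isCompact_closedBall x r).finite_cover_balls hδ0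
  have hball : Metric.closedBall x r ⊆ Metric.ball x (2 * r) :=
    Metric.closedBall_subset_ball (by linarith)
  have hev : ∀ᶠ i in l, ∀ y ∈ s, dist (g y) (f i y) < ε / 3 := by
    rw [hsf.eventually_all]
    intro y hy
    have := Metric.tendsto_nhds.1 (hg y (hsub (hball (hsK hy)))) (ε / 3) (by positivity)
    filter_upwards [this] with i hi
    rwa [dist_comm]
  filter_upwards [hev, hLip] with i hi hL y hy
  obtain ⟨z, hz, hyz⟩ := Set.mem_iUnion₂.1 (hsc (Metric.ball_subset_closedBall hy))
  have hy2 := hball (Metric.ball_subset_closedBall hy)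
  have hz2 := hball (hsK hz)
  have hd : ‖y - z‖ < δ := by rwa [← dist_eq_norm]
  have h1 := hLipg z hz2 y hy2
  have h2 := hL z hz2 y hy2
  have h3 := hi z hz
  rw [dist_eq_norm] at h3 ⊢
  have h4 : M * ‖y - z‖ ≤ M * δ := by gcongr
  calc ‖g y - f i y‖ = ‖(g y - g z) + (g z - f i z) - (f i y - f i z)‖ := by congr 1; abel
    _ ≤ ‖(g y - g z) + (g z - f i z)‖ + ‖f i y - f i z‖ := norm_sub_le _ _
    _ ≤ ‖g y - g z‖ + ‖g z - f i z‖ + ‖f i y - f i z‖ := by gcongr; exact norm_add_le _ _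
    _ < ε := by linarith

/-- Holomorphy and the bound are required only eventually and near each point, because difference
quotients are defined near a point only for small increments. The filter is arbitrary: it will be a
punctured neighbourhood of `0`, finite sets of basis elements, or an ultrafilter. -/
theorem tendstoLocallyUniformlyOn_of_locallyBounded [ProperSpace E] {l : Filter ι} [l.NeBot]
    {f : ι → E → F} {g : E → F} {U : Set E}
    (hf : ∀ x ∈ U, ∃ C : ℝ, ∃ r > 0, ∀ᶠ i in l, DifferentiableOn ℂ (f i) (Metric.ball x r) ∧
      ∀ y ∈ Metric.ball x r, ‖f i y‖ ≤ C)
    (hU : IsOpen U) (hg : ∀ y ∈ U, Tendsto (fun i => f i y) l (𝓝 (g y))) :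
    TendstoLocallyUniformlyOn f g l U := by
  intro u hu x hx
  obtain ⟨C, r, hr, h⟩ := hf x hx
  obtain ⟨r', hr', hrU⟩ := Metric.isOpen_iff.1 hU x hx
  set ρ := min r r' / 4 with hρ
  have hρ0 : 0 < ρ := by positivity
  have h4 : 4 * ρ = min r r' := by rw [hρ]; ring
  have h1 : Metric.ball x (4 * ρ) ⊆ Metric.ball x r :=
    Metric.ball_subset_ball (h4 ▸ min_le_left _ _)
  have h2 : Metric.ball x (4 * ρ) ⊆ U :=
    (Metric.ball_subset_ball (h4 ▸ min_le_right _ _)).trans hrU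
  have := tendstoUniformlyOn_ball_of_bounded (f := f) (g := g) (C := C) hρ0
    (h.mono fun i hi => ⟨hi.1.mono h1, fun y hy => hi.2 y (h1 hy)⟩) (fun y hy => hg y (h2 hy)) u hu
  exact ⟨Metric.ball x ρ, mem_nhdsWithin_of_mem_nhds (Metric.ball_mem_nhds x hρ0), this⟩

/-- Locally uniform limits of holomorphic maps are holomorphic, and the derivatives converge locally
uniformly. -/
theorem differentiableOn_and_tendsto_fderiv [ProperSpace E] [CompleteSpace F] {l : Filter ι}
    [l.NeBot] {f : ι → E → F} {g : E → F} {U : Set E} (hU : IsOpen U)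
    (hf : ∀ x ∈ U, ∃ r > 0, ∀ᶠ i in l, DifferentiableOn ℂ (f i) (Metric.ball x r))
    (hg : TendstoLocallyUniformlyOn f g l U) :
    DifferentiableOn ℂ g U ∧
      TendstoLocallyUniformlyOn (fun i => fderiv ℂ (f i)) (fderiv ℂ g) l U := by
  have key : ∀ x ∈ U, ∃ r > 0, (∀ y ∈ Metric.ball x r, DifferentiableAt ℂ g y) ∧
      TendstoUniformlyOn (fun i => fderiv ℂ (f i)) (fderiv ℂ g) l (Metric.ball x r) := by
    intro x hx
    obtain ⟨r₁, hr₁, hd⟩ := hf x hx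
    obtain ⟨r₂, hr₂, hrU⟩ := Metric.isOpen_iff.1 hU x hx
    set r := min r₁ r₂ / 4 with hr
    have hr0 : 0 < r := by positivity
    have h4 : 4 * r = min r₁ r₂ := by rw [hr]; ring
    have hK : Metric.closedBall x (2 * r) ⊆ U :=
      (Metric.closedBall_subset_ball (by linarith [min_le_right r₁ r₂])).trans hrU
    have hd2 : ∀ᶠ i in l, DifferentiableOn ℂ (f i) (Metric.ball x (2 * r)) :=
      hd.mono fun i hi => hi.mono (Metric.ball_subset_ball (by linarith [min_le_left r₁ r₂]))
    have hun : TendstoUniformlyOn f g l (Metric.closedBall x (2 * r)) :=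
      (tendstoLocallyUniformlyOn_iff_forall_isCompact hU).1 hg _ hK (isCompact_closedBall _ _)
    have hsub : ∀ y ∈ Metric.ball x r, Metric.ball y r ⊆ Metric.ball x (2 * r) := by
      intro y hy
      refine Metric.ball_subset_ball' ?_
      rw [Metric.mem_ball] at hy
      linarith
    -- Cauchy's estimate is applied to differences `f i - f j`: a bound `ε r / 4` on the larger ball
    -- gives `ε / 2` for the derivatives.
    have hCau : UniformCauchySeqOn (fun i => fderiv ℂ (f i)) l (Metric.ball x r) := by
      intro u hu
      obtain ⟨ε, hε, hεu⟩ := Metric.mem_uniformity_dist.1 hu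
      have hc := hun.uniformCauchySeqOn {p | dist p.1 p.2 < ε * r / 4}
        (Metric.dist_mem_uniformity (by positivity))
      filter_upwards [hc, hd2.prod_mk hd2] with p hp hdp y hy
      apply hεu
      have hyd : ∀ i, DifferentiableOn ℂ (f i) (Metric.ball x (2 * r)) →
          DifferentiableAt ℂ (f i) y := fun i hi =>
        (hi y (hsub y hy (Metric.mem_ball_self hr0))).differentiableAt
          (Metric.isOpen_ball.mem_nhds (hsub y hy (Metric.mem_ball_self hr0)))
      rw [dist_eq_norm, ← fderiv_sub (hyd _ hdp.1) (hyd _ hdp.2)]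
      have := norm_fderiv_le_of_bounded_on_ball (f := f p.1 - f p.2) (x := y) (C := ε * r / 4) hr0
        ((hdp.1.sub hdp.2).mono (hsub y hy)) (fun z hz => by
          have := hp z (Metric.ball_subset_closedBall (hsub y hy hz))
          simp only [dist_eq_norm] at this
          exact this.le)
      refine this.trans_lt ?_
      rw [div_lt_iff₀ (by positivity)]
      nlinarith
    have hlim : ∀ y, ∃ L : E →L[ℂ] F, y ∈ Metric.ball x r →
        Tendsto (fun i => fderiv ℂ (f i) y) l (𝓝 L) := by
      intro y
      by_cases hy : y ∈ Metric.ball x r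
      · obtain ⟨L, hL⟩ := CompleteSpace.complete (hCau.cauchy_map hy)
        exact ⟨L, fun _ => hL⟩
      · exact ⟨0, fun h => absurd h hy⟩
    choose g' hg' using hlim
    have hun' := hCau.tendstoUniformlyOn_of_tendsto (f := g') fun y hy => hg' y hy
    have hder : ∀ y ∈ Metric.ball x r, HasFDerivAt g (g' y) y := by
      intro y hy
      refine hasFDerivAt_of_tendstoUniformlyOnFilter (l := l) (f := f)
        (f' := fun i => fderiv ℂ (f i)) ?_ ?_ ?_
      · exact hun'.tendstoUniformlyOnFilter.mono_right
          (le_principal_iff.2 (Metric.isOpen_ball.mem_nhds hy))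
      · have h1 : ∀ᶠ z in 𝓝 y, z ∈ Metric.ball x (2 * r) :=
          Metric.isOpen_ball.mem_nhds (hsub y hy (Metric.mem_ball_self hr0))
        filter_upwards [hd2.prod_mk h1] with p hp
        exact ((hp.1 _ hp.2).differentiableAt (Metric.isOpen_ball.mem_nhds hp.2)).hasFDerivAt
      · filter_upwards [Metric.isOpen_ball.mem_nhds hy] with z hz
        exact hun.tendsto_at (Metric.ball_subset_closedBall
          (hsub z hz (Metric.mem_ball_self hr0)))
    refine ⟨r, hr0, fun y hy => (hder y hy).differentiableAt, hun'.congr_right ?_⟩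
    intro y hy
    exact (hder y hy).fderiv.symm
  refine ⟨fun x hx => ?_, fun u hu x hx => ?_⟩
  · obtain ⟨r, hr, h, -⟩ := key x hx
    exact (h x (Metric.mem_ball_self hr)).differentiableWithinAt
  · obtain ⟨r, hr, -, h⟩ := key x hx
    exact ⟨_, mem_nhdsWithin_of_mem_nhds (Metric.ball_mem_nhds x hr), h u hu⟩

/-- The difference quotients in direction `v` are holomorphic near each point, locally bounded by
the Lipschitz estimate, and converge pointwise to the directional derivative. Their limit is
therefore holomorphic. -/
theorem differentiableOn_fderiv_apply [ProperSpace E] [CompleteSpace F] {f : E → F} {U : Set E}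
    (hU : IsOpen U) (hf : DifferentiableOn ℂ f U) (v : E) :
    DifferentiableOn ℂ (fun x => fderiv ℂ f x v) U := by
  set q : ℂ → E → F := fun t x => t⁻¹ • (f (x + t • v) - f x) with hq
  have hpt : ∀ y ∈ U, Tendsto (fun t => q t y) (𝓝[≠] 0) (𝓝 (fderiv ℂ f y v)) := by
    intro y hy
    have h1 : HasFDerivAt f (fderiv ℂ f y) (y + (0 : ℂ) • v) := by
      simpa using ((hf y hy).differentiableAt (hU.mem_nhds hy)).hasFDerivAt
    have h2 : HasDerivAt (fun t : ℂ => y + t • v) v 0 := by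
      simpa using ((hasDerivAt_id (0 : ℂ)).smul_const v).const_add y
    have := (h1.comp_hasDerivAt 0 h2).tendsto_slope_zero
    simpa [hq] using this
  have hb : ∀ x ∈ U, ∃ C : ℝ, ∃ r > 0, ∀ᶠ t in 𝓝[≠] (0 : ℂ),
      DifferentiableOn ℂ (q t) (Metric.ball x r) ∧ ∀ y ∈ Metric.ball x r, ‖q t y‖ ≤ C := by
    intro x hx
    have hc : ContinuousAt f x := ((hf x hx).differentiableAt (hU.mem_nhds hx)).continuousAt
    have : ∀ᶠ y in 𝓝 x, y ∈ U ∧ ‖f y‖ < ‖f x‖ + 1 :=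
      Filter.Eventually.and (hU.mem_nhds hx)
        (hc.norm.eventually (gt_mem_nhds (by linarith : ‖f x‖ < ‖f x‖ + 1)))
    obtain ⟨ρ, hρ, hball⟩ := Metric.eventually_nhds_iff_ball.1 this
    set r := ρ / 4 with hr
    have hr0 : 0 < r := by positivity
    have hρr : 2 * (2 * r) = ρ := by rw [hr]; ring
    set M : ℝ := (‖f x‖ + 1) / (2 * r / 2) with hM
    have hLip : ∀ y ∈ Metric.ball x (2 * r), ∀ z ∈ Metric.ball x (2 * r),
        ‖f z - f y‖ ≤ M * ‖z - y‖ := fun y hy z hz =>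
      norm_sub_le_of_bounded_on_ball (by positivity)
        (hρr ▸ fun y hy => (hf y (hball y hy).1).mono fun z hz => (hball z hz).1)
        (hρr ▸ fun y hy => (hball y hy).2.le) hy hz
    have hsmall : ∀ᶠ t in 𝓝[≠] (0 : ℂ), t ≠ 0 ∧ ‖t • v‖ < r := by
      refine (eventually_mem_nhdsWithin : ∀ᶠ t in 𝓝[≠] (0 : ℂ), t ∈ ({0}ᶜ : Set ℂ)).and ?_
      refine eventually_nhdsWithin_of_eventually_nhds ?_
      have : ContinuousAt (fun t : ℂ => ‖t • v‖) 0 := by fun_prop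
      exact this.eventually (gt_mem_nhds (by simpa using hr0))
    refine ⟨M * ‖v‖, r, hr0, hsmall.mono fun t ht => ?_⟩
    have hmem : ∀ y ∈ Metric.ball x r, y ∈ Metric.ball x (2 * r) ∧
        y + t • v ∈ Metric.ball x (2 * r) := by
      intro y hy
      rw [Metric.mem_ball] at hy
      refine ⟨by rw [Metric.mem_ball]; linarith, ?_⟩
      rw [Metric.mem_ball]
      calc dist (y + t • v) x ≤ dist (y + t • v) y + dist y x := dist_triangle _ _ _
        _ < 2 * r := by
          rw [dist_self_add_left]
          linarith [ht.2]
    have h2U : Metric.ball x (2 * r) ⊆ U := fun y hy =>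
      (hball y (Metric.ball_subset_ball (by linarith) hy)).1
    have hdat : ∀ y ∈ Metric.ball x (2 * r), DifferentiableAt ℂ f y := fun y hy =>
      (hf y (h2U hy)).differentiableAt (hU.mem_nhds (h2U hy))
    refine ⟨fun y hy => ?_, fun y hy => ?_⟩
    · have h1 := hdat _ (hmem y hy).1
      have h2 : DifferentiableAt ℂ (fun y => f (y + t • v)) y :=
        (hdat _ (hmem y hy).2).comp y (by fun_prop)
      exact ((h2.sub h1).const_smul t⁻¹).differentiableWithinAt
    · have := hLip y (hmem y hy).1 _ (hmem y hy).2
      rw [add_sub_cancel_left, norm_smul] at this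
      rw [hq]
      simp only [norm_smul, norm_inv]
      rw [inv_mul_le_iff₀ (norm_pos_iff.2 ht.1)]
      linarith
  exact (differentiableOn_and_tendsto_fderiv hU
    (fun x hx => (hb x hx).choose_spec.imp fun r hr => ⟨hr.1, hr.2.mono fun i hi => hi.1⟩)
    (tendstoLocallyUniformlyOn_of_locallyBounded hb hU hpt)).1

theorem differentiableOn_clm_of_apply [FiniteDimensional ℂ E] {G : Type*} [NormedAddCommGroup G]
    [NormedSpace ℂ G] {f : G → E →L[ℂ] F} {U : Set G}
    (h : ∀ v, DifferentiableOn ℂ (fun x => f x v) U) : DifferentiableOn ℂ f U := by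
  let d := Module.finrank ℂ E
  have hd : d = Module.finrank ℂ (Fin d → ℂ) := (Module.finrank_fin_fun ℂ).symm
  let e₁ := ContinuousLinearEquiv.ofFinrankEq hd
  let e₂ := (e₁.arrowCongr (1 : F ≃L[ℂ] F)).trans (ContinuousLinearEquiv.piRing (Fin d))
  rw [← Function.id_comp f, ← e₂.symm_comp_self]
  exact e₂.symm.differentiable.comp_differentiableOn (differentiableOn_pi.mpr fun i => h _)

theorem fderiv_real_eq {f : E → F} {x : E} (hf : DifferentiableAt ℂ f x) :
    fderiv ℝ f x = ContinuousLinearMap.restrictScalarsL ℂ E F ℝ ℂ (fderiv ℂ f x) :=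
  (hf.hasFDerivAt.restrictScalars ℝ).fderiv

variable [FiniteDimensional ℂ E] [CompleteSpace F]

theorem differentiableOn_fderiv_complex {f : E → F} {U : Set E} (hU : IsOpen U)
    (hf : DifferentiableOn ℂ f U) : DifferentiableOn ℂ (fderiv ℂ f) U :=
  have : ProperSpace E := FiniteDimensional.proper ℂ E
  differentiableOn_clm_of_apply fun v => differentiableOn_fderiv_apply hU hf v

/-- The real derivative is the complex one followed by a fixed complex linear map, where `ℂ` acts on
`E →L[ℝ] F` through `F`. Inductions over real derivatives can thus stay within holomorphic maps. -/
theorem differentiableOn_fderiv_real {f : E → F} {U : Set E} (hU : IsOpen U)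
    (hf : DifferentiableOn ℂ f U) : DifferentiableOn ℂ (fderiv ℝ f) U := by
  refine ((ContinuousLinearMap.differentiable (ContinuousLinearMap.restrictScalarsL ℂ E F ℝ ℂ)
    ).comp_differentiableOn (differentiableOn_fderiv_complex hU hf)).congr fun x hx => ?_
  exact fderiv_real_eq ((hf x hx).differentiableAt (hU.mem_nhds hx))

theorem tendstoLocallyUniformlyOn_fderiv_real {l : Filter ι} [l.NeBot] {f : ι → E → F} {g : E → F}
    {U : Set E} (hU : IsOpen U) (hf : ∀ i, DifferentiableOn ℂ (f i) U)
    (hg : TendstoLocallyUniformlyOn f g l U) :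
    TendstoLocallyUniformlyOn (fun i => fderiv ℝ (f i)) (fderiv ℝ g) l U := by
  have : ProperSpace E := FiniteDimensional.proper ℂ E
  obtain ⟨h1, h2⟩ := differentiableOn_and_tendsto_fderiv hU
    (fun x hx => (Metric.isOpen_iff.1 hU x hx).imp fun r hr =>
      ⟨hr.1, Eventually.of_forall fun i => (hf i).mono hr.2⟩) hg
  have h3 := (ContinuousLinearMap.uniformContinuous
    (ContinuousLinearMap.restrictScalarsL ℂ E F ℝ ℂ)).comp_tendstoLocallyUniformlyOn h2
  refine (h3.congr fun i x hx => ?_).congr_right fun x hx => ?_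
  · exact (fderiv_real_eq ((hf i x hx).differentiableAt (hU.mem_nhds hx))).symm
  · exact (fderiv_real_eq ((h1 x hx).differentiableAt (hU.mem_nhds hx))).symm

end Holomorphic

/-! ### Real derivatives of all orders -/

section HigherDerivatives

variable {ι : Type*} {E F : Type} [NormedAddCommGroup E] [NormedSpace ℂ E] [FiniteDimensional ℂ E]
  [NormedAddCommGroup F] [NormedSpace ℂ F] [CompleteSpace F]

theorem contDiffOn_of_differentiableOn {f : E → F} {U : Set E} (hU : IsOpen U)
    (hf : DifferentiableOn ℂ f U) : ContDiffOn ℝ ∞ f U := by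
  rw [contDiffOn_infty]
  intro m
  induction m generalizing F with
  | zero => exact contDiffOn_zero.2 hf.continuousOn
  | succ m ih =>
    push_cast
    rw [contDiffOn_succ_iff_fderiv_of_isOpen hU]
    refine ⟨fun x hx => ?_, by simp, ih (differentiableOn_fderiv_real hU hf)⟩
    exact (((hf x hx).differentiableAt (hU.mem_nhds hx)).restrictScalars ℝ).differentiableWithinAt

/-- All real derivatives of a locally uniformly convergent family of holomorphic maps converge
locally uniformly. -/
theorem tendstoLocallyUniformlyOn_iteratedFDeriv {l : Filter ι} [l.NeBot] {f : ι → E → F}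
    {g : E → F} {U : Set E} (hU : IsOpen U) (hf : ∀ i, DifferentiableOn ℂ (f i) U)
    (hg : TendstoLocallyUniformlyOn f g l U) (m : ℕ) :
    TendstoLocallyUniformlyOn (fun i => iteratedFDeriv ℝ m (f i)) (iteratedFDeriv ℝ m g) l U := by
  induction m generalizing F with
  | zero =>
    simp only [iteratedFDeriv_zero_eq_comp]
    exact (LinearIsometryEquiv.isometry _).uniformContinuous.comp_tendstoLocallyUniformlyOn hg
  | succ m ih =>
    have h := ih (fun i => differentiableOn_fderiv_real hU (hf i))
      (tendstoLocallyUniformlyOn_fderiv_real hU hf hg)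
    have h2 := (LinearIsometryEquiv.isometry
      (continuousMultilinearCurryRightEquiv' ℝ m E F).symm
      ).uniformContinuous.comp_tendstoLocallyUniformlyOn h
    refine (h2.congr fun i x hx => ?_).congr_right fun x hx => ?_
    · exact iteratedFDeriv_succ_eq_comp_right.symm
    · exact iteratedFDeriv_succ_eq_comp_right.symm

end HigherDerivatives

/-! ### The mean value inequality -/

section MeanValue

variable {n : ℕ}

theorem measurePreserving_smul_circle (c : ℂ) (hc : ‖c‖ = 1) :
    MeasurePreserving (fun x : Fin n → ℂ => c • x) volume volume := by
  have h : MeasurePreserving (fun z : ℂ => c • z) volume volume :=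
    (rotation ⟨c, by simpa [Submonoid.unitSphere] using hc⟩).measurePreserving
  exact volume_preserving_pi (fun _ : Fin n => h)

theorem integral_ball_rotate (f : (Fin n → ℂ) → ℂ) (a : Fin n → ℂ) (r : ℝ) (c : ℂ) (hc : ‖c‖ = 1) :
    ∫ x in Metric.ball 0 r, f (a + c • x) = ∫ x in Metric.ball 0 r, f (a + x) := by
  have hc0 : c ≠ 0 := by
    rintro rfl
    simp at hc
  have hemb : MeasurableEmbedding (fun x : Fin n → ℂ => c • x) :=
    (Homeomorph.smulOfNeZero c hc0).measurableEmbedding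
  rw [← (measurePreserving_smul_circle c hc).setIntegral_preimage_emb hemb
    (fun x => f (a + x)) (Metric.ball 0 r)]
  congr 2
  ext x
  simp [norm_smul, hc]

/-- The mean value property of holomorphic functions on a ball (for the sup norm). -/
theorem integral_ball_eq_of_differentiableOn {f : (Fin n → ℂ) → ℂ} {a : Fin n → ℂ} {r R : ℝ}
    (hrR : r < R) (hf : DifferentiableOn ℂ f (Metric.ball a R)) :
    ∫ x in Metric.ball 0 r, f (a + x) = (volume (Metric.ball (0 : Fin n → ℂ) r)).toReal • f a := by
  set B := Metric.ball (0 : Fin n → ℂ) r with hB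
  have hmem : ∀ t : ℝ, ∀ x ∈ Metric.closedBall (0 : Fin n → ℂ) r,
      a + circleMap 0 1 t • x ∈ Metric.ball a R := by
    intro t x hx
    have : ‖x‖ ≤ r := by simpa using hx
    simp only [Metric.mem_ball, dist_eq_norm, add_sub_cancel_left, norm_smul]
    simp
    linarith
  -- On each complex line through `a` this is the one-variable mean value property over the unit
  -- circle.
  have hmean : ∀ x ∈ B, ∫ t in (0 : ℝ)..2 * Real.pi, f (a + circleMap 0 1 t • x)
      = (2 * Real.pi : ℝ) • f a := by
    intro x hx
    have hx' : ‖x‖ ≤ r := by simpa using (Metric.ball_subset_closedBall hx)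
    have h := DiffContOnCl.circleAverage (f := fun t : ℂ => f (a + t • x)) (c := 0) (R := 1) ?_
    · rw [Real.circleAverage_def] at h
      simp only [zero_smul, add_zero] at h
      rw [← h, smul_smul, mul_inv_cancel₀ (by positivity), one_smul]
    · refine DifferentiableOn.diffContOnCl fun t ht => ?_
      have ht' : ‖t‖ ≤ 1 := by simpa using Metric.closure_ball_subset_closedBall ht
      have h1 : a + t • x ∈ Metric.ball a R := by
        simp only [Metric.mem_ball, dist_eq_norm, add_sub_cancel_left, norm_smul]
        nlinarith [norm_nonneg x]
      have h2 := (hf _ h1).differentiableAt (Metric.isOpen_ball.mem_nhds h1)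
      exact (h2.comp t (by fun_prop)).differentiableWithinAt
  have hint : Integrable (Function.uncurry fun (t : ℝ) x => f (a + circleMap 0 1 t • x))
      ((volume.restrict (Set.uIoc 0 (2 * Real.pi))).prod (volume.restrict B)) := by
    rw [Measure.prod_restrict]
    refine (ContinuousOn.integrableOn_compact (K := Set.uIcc 0 (2 * Real.pi) ×ˢ
      Metric.closedBall (0 : Fin n → ℂ) r) ?_ ?_).mono_set ?_
    · exact isCompact_uIcc.prod (isCompact_closedBall _ _)
    · refine hf.continuousOn.comp (Continuous.continuousOn ?_) fun p hp => hmem _ _ hp.2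
      exact continuous_const.add (((continuous_circleMap 0 1).comp continuous_fst).smul
        continuous_snd)
    · exact Set.prod_mono Set.uIoc_subset_uIcc Metric.ball_subset_closedBall
  -- In one order the inner integral is `2π f(a)`; in the other it is independent of `t` by rotation
  -- invariance of the ball. Averaging over rotations takes the place of polar coordinates.
  have hswap : ∫ t in (0 : ℝ)..2 * Real.pi, ∫ x in B, f (a + circleMap 0 1 t • x)
      = ∫ x in B, ∫ t in (0 : ℝ)..2 * Real.pi, f (a + circleMap 0 1 t • x) := by
    rw [intervalIntegral_integral_swap hint]
  have h1 : ∀ t : ℝ, ∫ x in B, f (a + circleMap 0 1 t • x) = ∫ x in B, f (a + x) := fun t =>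
    integral_ball_rotate f a r _ (by simp)
  simp only [h1] at hswap
  rw [setIntegral_congr_fun measurableSet_ball hmean] at hswap
  simp only [intervalIntegral.integral_const, sub_zero, integral_const, smul_smul] at hswap
  have h2 : (2 * Real.pi : ℝ) ≠ 0 := by positivity
  have := congrArg (fun z => (2 * Real.pi : ℝ)⁻¹ • z) hswap
  simp only [smul_smul, inv_mul_cancel₀ h2, one_smul] at this
  rw [this]
  congr 1
  simp only [Measure.real, Measure.restrict_apply_univ, hB]
  field_simp

/-- The mean value inequality for the square of a holomorphic function. -/
theorem volume_mul_enorm_sq_le_lintegral {f : (Fin n → ℂ) → ℂ} {a : Fin n → ℂ} {r R : ℝ}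
    (hrR : r < R) (hf : DifferentiableOn ℂ f (Metric.ball a R)) :
    volume (Metric.ball (0 : Fin n → ℂ) r) * ‖f a‖ₑ ^ 2
      ≤ ∫⁻ x in Metric.ball a r, ‖f x‖ₑ ^ 2 := by
  -- The mean value property of `f ^ 2` gives the `L²` estimate directly, without Cauchy–Schwarz.
  have h := integral_ball_eq_of_differentiableOn hrR (hf.pow 2)
  have h1 : ‖(volume (Metric.ball (0 : Fin n → ℂ) r)).toReal • f a ^ 2‖ₑ
      = volume (Metric.ball (0 : Fin n → ℂ) r) * ‖f a‖ₑ ^ 2 := by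
    rw [enorm_smul, Real.enorm_eq_ofReal ENNReal.toReal_nonneg,
      ENNReal.ofReal_toReal Metric.isBounded_ball.measure_lt_top.ne, enorm_pow]
  have h2 : ∫⁻ x in Metric.ball a r, ‖f x‖ₑ ^ 2
      = ∫⁻ x in Metric.ball 0 r, ‖f (a + x)‖ₑ ^ 2 := by
    rw [← (measurePreserving_add_left volume a).setLIntegral_comp_preimage_emb
      (Homeomorph.addLeft a).measurableEmbedding]
    congr 2
    ext x
    simp
  rw [← h1, h2]
  have h3 : ∫ x in Metric.ball 0 r, (f ^ 2) (a + x)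
      = (volume (Metric.ball (0 : Fin n → ℂ) r)).toReal • f a ^ 2 := h
  rw [← h3]
  refine (enorm_integral_le_lintegral_enorm _).trans (le_of_eq ?_)
  simp

end MeanValue

/-! ### Changes of coordinates -/

/-- The holomorphic charts of a complex manifold. -/
abbrev holCharts (n : ℕ) (X : Type*) [TopologicalSpace X] [ChartedSpace (Fin n → ℂ) X] :
    Set (OpenPartialHomeomorph X (Fin n → ℂ)) :=
  IsManifold.maximalAtlas 𝓘(ℂ, Fin n → ℂ) ω X

section Coordinates

variable {n : ℕ} {X : Type*} [TopologicalSpace X] [ChartedSpace (Fin n → ℂ) X]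

/-- Pulled back to `ℂⁿ` along `v`, the form becomes a multiple of the determinant. The vectors `v`
need not be independent. -/
theorem AlternatingMap_apply_sum {M : Type*} [AddCommGroup M] [Module ℂ M]
    (f : M [⋀^Fin n]→ₗ[ℂ] ℂ) (A : Matrix (Fin n) (Fin n) ℂ) (v : Fin n → M) :
    f (fun i => ∑ j, A i j • v j) = A.det * f v := by
  have h := AlternatingMap.eq_smul_basis_det (Pi.basisFun ℂ (Fin n))
    (f.compLinearMap (Fintype.linearCombination ℂ v))
  have h1 := DFunLike.congr_fun h A.row
  have h2 : (f.compLinearMap (Fintype.linearCombination ℂ v)) (Pi.basisFun ℂ (Fin n)) = f v := by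
    simp [AlternatingMap.compLinearMap_apply, Fintype.linearCombination_apply_single]
  rw [h2] at h1
  rw [mul_comm]
  refine Eq.trans ?_ (h1.trans ?_)
  · rfl
  · rw [AlternatingMap.smul_apply, Pi.basisFun_det_apply]
    rfl

/-- An `(n,n)`-form given by its values on frames transforms by `|det|²`. -/
def VolForm.IsCovariant (η : VolForm n X) : Prop :=
  ∀ (x : X) (A : Matrix (Fin n) (Fin n) ℂ) (v : Fin n → TangentSpace 𝓘(ℂ, Fin n → ℂ) x),
    η x (fun i => ∑ j, A i j • v j) = (‖A.det‖ ^ 2 : ℝ) * η x v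

theorem wedgeConj_isCovariant (f g : TopForm n X) : (wedgeConj f g).IsCovariant := by
  intro x A v
  simp only [wedgeConj, AlternatingMap_apply_sum, map_mul]
  have : ((‖A.det‖ ^ 2 : ℝ) : ℂ) = A.det * (starRingEnd ℂ) A.det := by
    rw [Complex.mul_conj, Complex.normSq_eq_norm_sq]
  rw [this]
  ring

/-- All tangent spaces unfold to `ℂⁿ`, so frames at base points that are only propositionally equal
can be compared as elements of `ℂⁿ`. -/
theorem TopForm.apply_congr (f : TopForm n X) {x y : X} (h : x = y) (v w : Fin n → Fin n → ℂ)
    (hvw : v = w) : f x v = f y w := by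
  subst h hvw
  rfl

theorem VolForm.apply_congr (η : VolForm n X) {x y : X} (h : x = y) (v w : Fin n → Fin n → ℂ)
    (hvw : v = w) : η x v = η y w := by
  subst h hvw
  rfl

theorem mdifferentiableAt_chart {e : OpenPartialHomeomorph X (Fin n → ℂ)} (he : e ∈ holCharts n X)
    {x : X} (hx : x ∈ e.source) :
    MDifferentiableAt 𝓘(ℂ, Fin n → ℂ) 𝓘(ℂ, Fin n → ℂ) e x :=
  (contMDiffAt_of_mem_maximalAtlas he hx).mdifferentiableAt (by simp)

theorem mdifferentiableAt_chart_symm {e : OpenPartialHomeomorph X (Fin n → ℂ)}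
    (he : e ∈ holCharts n X) {a : Fin n → ℂ} (ha : a ∈ e.target) :
    MDifferentiableAt 𝓘(ℂ, Fin n → ℂ) 𝓘(ℂ, Fin n → ℂ) e.symm a :=
  (contMDiffAt_symm_of_mem_maximalAtlas he ha).mdifferentiableAt (by simp)

/-- The derivative of a parametrised map, computed in a chart of the target. -/
theorem mfderiv_eq_of_chart {e : OpenPartialHomeomorph X (Fin n → ℂ)} (he : e ∈ holCharts n X)
    {γ : (Fin n → ℂ) → X} {a : Fin n → ℂ}
    (hγ : MDifferentiableAt 𝓘(ℂ, Fin n → ℂ) 𝓘(ℂ, Fin n → ℂ) γ a) (ha : γ a ∈ e.source)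
    (v : Fin n → ℂ) :
    (mfderiv 𝓘(ℂ, Fin n → ℂ) 𝓘(ℂ, Fin n → ℂ) γ a v : Fin n → ℂ)
      = mfderiv 𝓘(ℂ, Fin n → ℂ) 𝓘(ℂ, Fin n → ℂ) e.symm (e (γ a))
        (fderiv ℂ (e ∘ γ) a v : Fin n → ℂ) := by
  have hev : γ =ᶠ[𝓝 a] e.symm ∘ (e ∘ γ) := by
    filter_upwards [hγ.continuousAt.preimage_mem_nhds (e.open_source.mem_nhds ha)] with b hb
    exact (e.left_inv hb).symm
  have h1 := hev.mfderiv_eq (I := 𝓘(ℂ, Fin n → ℂ)) (I' := 𝓘(ℂ, Fin n → ℂ))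
  have h2 : MDifferentiableAt 𝓘(ℂ, Fin n → ℂ) 𝓘(ℂ, Fin n → ℂ) (e ∘ γ) a :=
    (mdifferentiableAt_chart he ha).comp a hγ
  have h3 : MDifferentiableAt 𝓘(ℂ, Fin n → ℂ) 𝓘(ℂ, Fin n → ℂ) e.symm ((e ∘ γ) a) :=
    mdifferentiableAt_chart_symm he (e.map_source ha)
  have h4 := mfderiv_comp a h3 h2
  have h5 : mfderiv 𝓘(ℂ, Fin n → ℂ) 𝓘(ℂ, Fin n → ℂ) γ a v
     = mfderiv 𝓘(ℂ, Fin n → ℂ) 𝓘(ℂ, Fin n → ℂ) (e.symm ∘ (e ∘ γ)) a v :=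
    congrArg (fun L => L v) h1
  rw [h4] at h5
  rw [mfderiv_eq_fderiv] at h5
  exact h5

/-- The derivative of a map `ℂⁿ → ℂⁿ` as a matrix, acting on rows. -/
noncomputable def jacobian (τ : (Fin n → ℂ) → (Fin n → ℂ)) (a : Fin n → ℂ) :
    Matrix (Fin n) (Fin n) ℂ :=
  fun i j => fderiv ℂ τ a (Pi.single i 1) j

theorem frame_eq_sum_of_chart {e : OpenPartialHomeomorph X (Fin n → ℂ)} (he : e ∈ holCharts n X)
    {γ : (Fin n → ℂ) → X} {a : Fin n → ℂ}
    (hγ : MDifferentiableAt 𝓘(ℂ, Fin n → ℂ) 𝓘(ℂ, Fin n → ℂ) γ a) (ha : γ a ∈ e.source) :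
    (fun i => mfderiv 𝓘(ℂ, Fin n → ℂ) 𝓘(ℂ, Fin n → ℂ) γ a (Pi.single i (1 : ℂ) : Fin n → ℂ) :
      Fin n → Fin n → ℂ) = fun i => ∑ j, jacobian (e ∘ γ) a i j • coordFrame e (e (γ a)) j := by
  funext i
  have h1 := mfderiv_eq_of_chart he hγ ha (Pi.single i 1)
  refine h1.trans ?_
  have h2 : fderiv ℂ (e ∘ γ) a (Pi.single i 1)
      = ∑ j, jacobian (e ∘ γ) a i j • (Pi.single j 1 : Fin n → ℂ) := by
    conv_lhs => rw [pi_eq_sum_univ' (fderiv ℂ (e ∘ γ) a (Pi.single i 1))]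
    rfl
  rw [h2]
  refine (map_sum (mfderiv 𝓘(ℂ, Fin n → ℂ) 𝓘(ℂ, Fin n → ℂ) e.symm (e (γ a))) _ _).trans ?_
  refine Finset.sum_congr rfl fun j _ => ?_
  exact map_smul (mfderiv 𝓘(ℂ, Fin n → ℂ) 𝓘(ℂ, Fin n → ℂ) e.symm (e (γ a))) _ _

theorem TopForm.apply_frame (f : TopForm n X) {e : OpenPartialHomeomorph X (Fin n → ℂ)}
    (he : e ∈ holCharts n X) {γ : (Fin n → ℂ) → X} {a : Fin n → ℂ}
    (hγ : MDifferentiableAt 𝓘(ℂ, Fin n → ℂ) 𝓘(ℂ, Fin n → ℂ) γ a) (ha : γ a ∈ e.source) :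
    f (γ a) (fun i => mfderiv 𝓘(ℂ, Fin n → ℂ) 𝓘(ℂ, Fin n → ℂ) γ a (Pi.single i (1 : ℂ) : Fin n → ℂ))
      = (jacobian (e ∘ γ) a).det * f.coeff e (e (γ a)) := by
  rw [TopForm.coeff, ← AlternatingMap_apply_sum]
  exact f.apply_congr (e.left_inv ha).symm _ _ (frame_eq_sum_of_chart he hγ ha)

theorem VolForm.IsCovariant.apply_frame {η : VolForm n X} (hη : η.IsCovariant)
    {e : OpenPartialHomeomorph X (Fin n → ℂ)}
    (he : e ∈ holCharts n X) {γ : (Fin n → ℂ) → X} {a : Fin n → ℂ}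
    (hγ : MDifferentiableAt 𝓘(ℂ, Fin n → ℂ) 𝓘(ℂ, Fin n → ℂ) γ a) (ha : γ a ∈ e.source) :
    η (γ a) (fun i => mfderiv 𝓘(ℂ, Fin n → ℂ) 𝓘(ℂ, Fin n → ℂ) γ a (Pi.single i (1 : ℂ) : Fin n → ℂ))
      = (‖(jacobian (e ∘ γ) a).det‖ ^ 2 : ℝ) * η.coeff e (e (γ a)) := by
  rw [VolForm.coeff, ← hη]
  exact η.apply_congr (e.left_inv ha).symm _ _ (frame_eq_sum_of_chart he hγ ha)

theorem differentiableAt_transition {e e' : OpenPartialHomeomorph X (Fin n → ℂ)}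
    (he : e ∈ holCharts n X) (he' : e' ∈ holCharts n X) {a : Fin n → ℂ} (ha : a ∈ e.target)
    (ha' : e.symm a ∈ e'.source) : DifferentiableAt ℂ (e' ∘ e.symm) a :=
  ((mdifferentiableAt_chart he' ha').comp a (mdifferentiableAt_chart_symm he ha)).differentiableAt

theorem VolForm.IsCovariant.coeff_transition {η : VolForm n X} (hη : η.IsCovariant)
    {e e' : OpenPartialHomeomorph X (Fin n → ℂ)}
    (he : e ∈ holCharts n X) (he' : e' ∈ holCharts n X) {a : Fin n → ℂ} (ha : a ∈ e.target)
    (ha' : e.symm a ∈ e'.source) :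
    η.coeff e a = (‖(jacobian (e' ∘ e.symm) a).det‖ ^ 2 : ℝ) * η.coeff e' (e' (e.symm a)) :=
  hη.apply_frame he' (mdifferentiableAt_chart_symm he ha) ha'

/-- The real determinant of a complex linear map is the norm from `ℂ` to `ℝ` of its complex
determinant. This identifies the real Jacobian in the change of variables with the factor by which
covariant forms transform. `jacobian` acts on rows, which accounts for the transpose. -/
theorem det_restrictScalars_fderiv (τ : (Fin n → ℂ) → (Fin n → ℂ)) (a : Fin n → ℂ) :
    |((fderiv ℂ τ a).restrictScalars ℝ).det| = ‖(jacobian τ a).det‖ ^ 2 := by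
  have h1 : ((fderiv ℂ τ a).restrictScalars ℝ).det
      = Algebra.norm ℝ (LinearMap.det (fderiv ℂ τ a : (Fin n → ℂ) →ₗ[ℂ] (Fin n → ℂ))) := by
    rw [← LinearMap.det_restrictScalars]
    rfl
  have h2 : LinearMap.det (fderiv ℂ τ a : (Fin n → ℂ) →ₗ[ℂ] (Fin n → ℂ)) = (jacobian τ a).det := by
    rw [← LinearMap.det_toMatrix', ← Matrix.det_transpose]
    congr 1
  rw [h1, h2, Algebra.norm_complex_apply, Complex.normSq_eq_norm_sq, abs_of_nonneg (by positivity)]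

end Coordinates

/-! ### The measure of an `(n,n)`-form -/

section Measure

variable {n : ℕ} {X : Type*} [TopologicalSpace X] [ChartedSpace (Fin n → ℂ) X]
  [MeasurableSpace X] [BorelSpace X]

/-- The measure of an `(n,n)`-form in a chart. -/
noncomputable def VolForm.chartMeasure (η : VolForm n X)
    (e : OpenPartialHomeomorph X (Fin n → ℂ)) : Measure X :=
  ((volume.restrict e.target).withDensity (fun a => ‖η.coeff e a‖ₑ)).map e.symm

omit [ChartedSpace (Fin n → ℂ) X] in
theorem measurableSet_target_inter_preimage (e : OpenPartialHomeomorph X (Fin n → ℂ)) {A : Set X}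
    (hA : MeasurableSet A) : MeasurableSet (e.target ∩ e.symm ⁻¹' A) := by
  classical
  -- `e.symm` is continuous only on the target; the constant `e.symm 0` is an arbitrary filler that
  -- makes it globally measurable.
  have h := (e.continuousOn_symm.measurable_piecewise (g := fun _ => e.symm 0)
    continuousOn_const e.open_target.measurableSet) hA
  have h2 := e.open_target.measurableSet.inter h
  convert h2 using 1
  ext a
  simp only [Set.mem_inter_iff, Set.mem_preimage]
  refine and_congr_right fun ha => ?_
  rw [Set.piecewise_eq_of_mem _ _ _ ha]

omit [ChartedSpace (Fin n → ℂ) X] in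
theorem measurableSet_inter_preimage_source (e : OpenPartialHomeomorph X (Fin n → ℂ))
    {A : Set (Fin n → ℂ)} (hA : MeasurableSet A) : MeasurableSet (e.source ∩ e ⁻¹' A) := by
  classical
  have h := (e.continuousOn.measurable_piecewise (g := fun _ => 0)
    continuousOn_const e.open_source.measurableSet) hA
  have h2 := e.open_source.measurableSet.inter h
  convert h2 using 1
  ext a
  simp only [Set.mem_inter_iff, Set.mem_preimage]
  refine and_congr_right fun ha => ?_
  rw [Set.piecewise_eq_of_mem _ _ _ ha]

omit [ChartedSpace (Fin n → ℂ) X] in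
theorem aemeasurable_chart_symm (e : OpenPartialHomeomorph X (Fin n → ℂ)) :
    AEMeasurable e.symm (volume.restrict e.target) :=
  e.continuousOn_symm.aemeasurable e.open_target.measurableSet

theorem VolForm.chartMeasure_apply (η : VolForm n X) (e : OpenPartialHomeomorph X (Fin n → ℂ))
    {A : Set X} (hA : MeasurableSet A) :
    η.chartMeasure e A = ∫⁻ a in e.target ∩ e.symm ⁻¹' A, ‖η.coeff e a‖ₑ := by
  have h1 : AEMeasurable e.symm
      ((volume.restrict e.target).withDensity (fun a => ‖η.coeff e a‖ₑ)) :=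
    (aemeasurable_chart_symm e).mono_ac (withDensity_absolutelyContinuous _ _)
  have h2 : e.symm ⁻¹' A =ᵐ[(volume.restrict e.target).withDensity (fun a => ‖η.coeff e a‖ₑ)]
      (e.target ∩ e.symm ⁻¹' A : Set (Fin n → ℂ)) := by
    refine (withDensity_absolutelyContinuous _ _).ae_le ?_
    filter_upwards [ae_restrict_mem e.open_target.measurableSet] with a ha
    exact propext ⟨fun h => ⟨ha, h⟩, fun h => h.2⟩
  rw [VolForm.chartMeasure, Measure.map_apply_of_aemeasurable h1 hA, measure_congr h2,
    withDensity_apply _ (measurableSet_target_inter_preimage e hA),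
    Measure.restrict_restrict (measurableSet_target_inter_preimage e hA),
    Set.inter_eq_left.2 Set.inter_subset_left]

theorem VolForm.chartMeasure_eq_zero (η : VolForm n X) (e : OpenPartialHomeomorph X (Fin n → ℂ)) :
    η.chartMeasure e e.sourceᶜ = 0 := by
  rw [η.chartMeasure_apply e e.open_source.measurableSet.compl]
  have : e.target ∩ e.symm ⁻¹' e.sourceᶜ = ∅ := by
    ext a
    simp only [Set.mem_inter_iff, Set.mem_preimage, Set.mem_compl_iff, Set.mem_empty_iff_false,
      iff_false, not_and, not_not]
    exact fun ha => e.map_target ha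
  rw [this, Measure.restrict_empty, lintegral_zero_measure]

/-- By the change of variables formula: the factor `|det|²` in the transition of coefficients is
exactly the real Jacobian. -/
theorem VolForm.IsCovariant.chartMeasure_eq {η : VolForm n X} (hη : η.IsCovariant)
    {e e' : OpenPartialHomeomorph X (Fin n → ℂ)} (he : e ∈ holCharts n X) (he' : e' ∈ holCharts n X)
    {A : Set X} (hA : MeasurableSet A) (hAe : A ⊆ e.source) (hAe' : A ⊆ e'.source) :
    η.chartMeasure e A = η.chartMeasure e' A := by
  rw [η.chartMeasure_apply e hA, η.chartMeasure_apply e' hA]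
  set s := e.target ∩ e.symm ⁻¹' A with hs
  have himg : (e' ∘ e.symm) '' s = e'.target ∩ e'.symm ⁻¹' A := by
    ext b
    constructor
    · rintro ⟨a, ⟨ha, haA⟩, rfl⟩
      refine ⟨e'.map_source (hAe' haA), ?_⟩
      simpa [e'.left_inv (hAe' haA)] using haA
    · rintro ⟨hb, hbA⟩
      refine ⟨e (e'.symm b), ⟨e.map_source (hAe hbA), ?_⟩, ?_⟩
      · simpa [e.left_inv (hAe hbA)] using hbA
      · simp [e.left_inv (hAe hbA), e'.right_inv hb]
  have hinj : Set.InjOn (e' ∘ e.symm) s := by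
    intro a ha b hb hab
    exact e.symm.injOn ha.1 hb.1 (e'.injOn (hAe' ha.2) (hAe' hb.2) hab)
  rw [← himg, lintegral_image_eq_lintegral_abs_det_fderiv_mul volume
    (measurableSet_target_inter_preimage e hA)
    (f' := fun a => (fderiv ℂ (e' ∘ e.symm) a).restrictScalars ℝ) ?_ hinj]
  · refine setLIntegral_congr_fun (measurableSet_target_inter_preimage e hA) fun a ha => ?_
    rw [hη.coeff_transition he he' ha.1 (hAe' ha.2), det_restrictScalars_fderiv, enorm_mul]
    congr 1
    rw [← ofReal_norm, Complex.norm_real, Real.norm_of_nonneg (by positivity)]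
  · intro a ha
    exact ((differentiableAt_transition he he' ha.1 (hAe' ha.2)).hasFDerivAt.restrictScalars
      ℝ).hasFDerivWithinAt

end Measure

/-! ### Countable partitions into pieces of charts -/

section Pieces

variable {n : ℕ} {X : Type*} [TopologicalSpace X] [ChartedSpace (Fin n → ℂ) X]
  [MeasurableSpace X]

/-- A countable measurable partition of a complex manifold into subsets of charts. -/
structure ChartPartition (n : ℕ) (X : Type*) [TopologicalSpace X] [ChartedSpace (Fin n → ℂ) X]
    [MeasurableSpace X] where
  chart : ℕ → OpenPartialHomeomorph X (Fin n → ℂ)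
  piece : ℕ → Set X
  chart_mem : ∀ k, chart k ∈ holCharts n X
  measurableSet_piece : ∀ k, MeasurableSet (piece k)
  disjoint : Pairwise (Function.onFun Disjoint piece)
  iUnion_piece : ⋃ k, piece k = Set.univ
  piece_subset : ∀ k, piece k ⊆ (chart k).source

/-- A countable subcover by open sets is made disjoint. The charts come from a prescribed family
`e`, so that later continuity need be known only in those charts, and `N` controls the size of the
pieces. Initial unions of pieces are initial unions of the open cover, which is what compactness
needs. -/
theorem exists_chartPartition [BorelSpace X] [SecondCountableTopology X] [Nonempty X]
    (e : X → OpenPartialHomeomorph X (Fin n → ℂ)) (he : ∀ x, e x ∈ holCharts n X)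
    (hxe : ∀ x, x ∈ (e x).source) (N : X → Set X) (hN : ∀ x, N x ∈ 𝓝 x) :
    ∃ D : ChartPartition n X, (∀ k, IsOpen (⋃ i ∈ Finset.range (k + 1), D.piece i)) ∧
      ∀ k, ∃ x, D.chart k = e x ∧ D.piece k ⊆ N x := by
  set W : X → Set X := fun x => interior (N x) ∩ (e x).source with hW
  have hWn : ∀ x, W x ∈ 𝓝 x := fun x =>
    Filter.inter_mem (interior_mem_nhds.2 (hN x)) ((e x).open_source.mem_nhds (hxe x))
  obtain ⟨s, hs, hsU⟩ := TopologicalSpace.countable_cover_nhds hWn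
  have hsne : s.Nonempty := by
    by_contra h
    rw [Set.not_nonempty_iff_eq_empty] at h
    subst h
    simp at hsU
    exact (Set.univ_nonempty (α := X)).ne_empty hsU.symm
  obtain ⟨x, rfl⟩ := hs.exists_eq_range hsne
  refine ⟨⟨fun k => e (x k), disjointed fun k => W (x k), fun k => he _, ?_,
    disjoint_disjointed _, ?_, ?_⟩, fun k => ?_, fun k => ⟨x k, rfl, ?_⟩⟩
  · exact fun k => MeasurableSet.disjointed
      (fun j => (isOpen_interior.inter (e (x j)).open_source).measurableSet) k
  · rw [iUnion_disjointed, ← hsU, Set.biUnion_range]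
  · exact fun k => (disjointed_subset _ _).trans Set.inter_subset_right
  · simp only [biUnion_range_succ_disjointed, partialSups_eq_biSup]
    exact isOpen_biUnion fun j _ => isOpen_interior.inter (e (x j)).open_source
  · exact (disjointed_subset (fun k => W (x k)) k).trans
      (Set.inter_subset_left.trans interior_subset)

theorem ChartPartition.exists_biUnion_range_eq_univ [CompactSpace X] (D : ChartPartition n X)
    (hD : ∀ k, IsOpen (⋃ i ∈ Finset.range (k + 1), D.piece i)) :
    ∃ N, ⋃ i ∈ Finset.range N, D.piece i = Set.univ := by
  obtain ⟨k, hk⟩ := isCompact_univ.elim_directed_cover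
    (fun k => ⋃ i ∈ Finset.range (k + 1), D.piece i) hD
    (fun x _ => by
      obtain ⟨k, hk⟩ := Set.mem_iUnion.1 (D.iUnion_piece ▸ Set.mem_univ x)
      exact Set.mem_iUnion.2 ⟨k, Set.mem_biUnion (Finset.self_mem_range_succ k) hk⟩)
    (directed_of_isDirected_le fun i j hij => Set.biUnion_subset_biUnion_left
      fun a ha => Finset.mem_range.2 (by have := Finset.mem_range.1 ha; omega))
  exact ⟨k + 1, Set.univ_subset_iff.1 hk⟩

theorem nonempty_chartPartition [BorelSpace X] [SecondCountableTopology X] [Nonempty X]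
    [IsManifold 𝓘(ℂ, Fin n → ℂ) ω X] : Nonempty (ChartPartition n X) := by
  obtain ⟨D, -, -⟩ := exists_chartPartition (n := n) (X := X) (fun x => chartAt (Fin n → ℂ) x)
    (fun x => IsManifold.chart_mem_maximalAtlas x) (fun x => mem_chart_source _ x)
    (fun _ => Set.univ) (fun _ => univ_mem)
  exact ⟨D⟩

namespace ChartPartition

variable (D : ChartPartition n X)

theorem exists_mem_piece (x : X) : ∃ k, x ∈ D.piece k :=
  Set.mem_iUnion.1 (D.iUnion_piece ▸ Set.mem_univ x)

/-- The index of the piece which contains `x`. -/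
noncomputable def index (x : X) : ℕ := (D.exists_mem_piece x).choose

theorem mem_piece_index (x : X) : x ∈ D.piece (D.index x) := (D.exists_mem_piece x).choose_spec

theorem index_eq {k : ℕ} {x : X} (hx : x ∈ D.piece k) : D.index x = k := by
  by_contra h
  exact Set.disjoint_left.1 (D.disjoint h) (D.mem_piece_index x) hx

/-- The coordinate frame of the chart of the piece which contains `x`. -/
noncomputable def frame (x : X) : Fin n → TangentSpace 𝓘(ℂ, Fin n → ℂ) x :=
  (coordFrame (D.chart (D.index x)) (D.chart (D.index x) x) : Fin n → Fin n → ℂ)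

theorem volForm_frame (η : VolForm n X) {k : ℕ} {x : X} (hx : x ∈ D.piece k) :
    η x (D.frame x) = η.coeff (D.chart k) (D.chart k x) := by
  have h := D.index_eq hx
  subst h
  exact η.apply_congr ((D.chart _).left_inv (D.piece_subset _ hx)).symm _ _ rfl

theorem topForm_frame (f : TopForm n X) {k : ℕ} {x : X} (hx : x ∈ D.piece k) :
    f x (D.frame x) = f.coeff (D.chart k) (D.chart k x) := by
  have h := D.index_eq hx
  subst h
  exact f.apply_congr ((D.chart _).left_inv (D.piece_subset _ hx)).symm _ _ rfl

theorem measurable_of_eqOn_piece {β : Type*} [MeasurableSpace β] {f : X → β} {g : ℕ → X → β}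
    (hg : ∀ k, Measurable (g k)) (hfg : ∀ k, Set.EqOn f (g k) (D.piece k)) : Measurable f := by
  intro s hs
  have : f ⁻¹' s = ⋃ k, D.piece k ∩ g k ⁻¹' s := by
    ext x
    simp only [Set.mem_preimage, Set.mem_iUnion, Set.mem_inter_iff]
    constructor
    · intro h
      exact ⟨_, D.mem_piece_index x, (hfg _ (D.mem_piece_index x)) ▸ h⟩
    · rintro ⟨k, hk, h⟩
      rwa [hfg k hk]
  rw [this]
  exact MeasurableSet.iUnion fun k => (D.measurableSet_piece k).inter (hg k hs)

variable [BorelSpace X]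

theorem measurable_of_eqOn_coeff {f : X → ℂ} {c : ℕ → (Fin n → ℂ) → ℂ}
    (hc : ∀ k, ContinuousOn (c k) (D.chart k).target)
    (hf : ∀ k, ∀ x ∈ D.piece k, f x = c k (D.chart k x)) : Measurable f := by
  classical
  refine D.measurable_of_eqOn_piece (g := fun k => (D.chart k).source.piecewise
    (fun x => c k (D.chart k x)) (fun _ => 0)) (fun k => ?_) fun k x hx => ?_
  · refine ContinuousOn.measurable_piecewise ?_ continuousOn_const
      (D.chart k).open_source.measurableSet
    exact (hc k).comp (D.chart k).continuousOn (D.chart k).mapsTo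
  · rw [Set.piecewise_eq_of_mem _ _ _ (D.piece_subset k hx)]
    exact hf k x hx

theorem measurable_topForm_frame {f : TopForm n X} (hf : f.IsHolomorphic) :
    Measurable fun x => f x (D.frame x) :=
  D.measurable_of_eqOn_coeff (c := fun k => f.coeff (D.chart k))
    (fun k => (hf _ (D.chart_mem k)).continuousOn) fun _ _ hx => D.topForm_frame f hx

theorem measurable_volForm_frame {η : VolForm n X}
    (hη : ∀ k, ContinuousOn (η.coeff (D.chart k)) (D.chart k).target) :
    Measurable fun x => η x (D.frame x) :=
  D.measurable_of_eqOn_coeff (c := fun k => η.coeff (D.chart k)) hη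
    fun _ _ hx => D.volForm_frame η hx

/-- The measure on the manifold which on every piece is the Lebesgue measure of its chart. -/
noncomputable def measure : Measure X :=
  Measure.sum fun k => (volume.restrict
    ((D.chart k).target ∩ (D.chart k).symm ⁻¹' D.piece k)).map (D.chart k).symm

theorem lintegral_measure {g : X → ENNReal} (hg : Measurable g) :
    ∫⁻ x, g x ∂D.measure = ∑' k, ∫⁻ a in (D.chart k).target ∩ (D.chart k).symm ⁻¹' D.piece k,
      g ((D.chart k).symm a) := by
  rw [measure, lintegral_sum_measure]
  refine tsum_congr fun k => ?_
  rw [lintegral_map' hg.aemeasurable]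
  exact (aemeasurable_chart_symm _).mono_measure
    (Measure.restrict_mono_set _ Set.inter_subset_left)

/-- On one piece no chart gives more than the chart of the piece, since the two measures agree on
the overlap and the former vanishes off its own domain. Hence the supremum of all chart measures is
the sum over the pieces. -/
theorem absMeasure_apply {η : VolForm n X} (hη : η.IsCovariant) {A : Set X}
    (hA : MeasurableSet A) :
    η.absMeasure A = ∑' k, η.chartMeasure (D.chart k) (A ∩ D.piece k) := by
  have h1 : η.absMeasure
      = Measure.sum fun k => (η.chartMeasure (D.chart k)).restrict (D.piece k) := by
    refine le_antisymm (iSup_le fun e => ?_) ?_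
    · refine Measure.le_iff.2 fun B hB => ?_
      have hBk : B = ⋃ k, B ∩ D.piece k := by
        rw [← Set.inter_iUnion, D.iUnion_piece, Set.inter_univ]
      rw [Measure.sum_apply _ hB]
      change η.chartMeasure e.1 B ≤ _
      conv_lhs => rw [hBk]
      rw [measure_iUnion (fun i j hij => (D.disjoint hij).mono Set.inter_subset_right
        Set.inter_subset_right) (fun k => hB.inter (D.measurableSet_piece k))]
      refine ENNReal.tsum_le_tsum fun k => ?_
      rw [Measure.restrict_apply hB]
      have h2 : η.chartMeasure e.1 (B ∩ D.piece k)
          = η.chartMeasure e.1 (B ∩ D.piece k ∩ e.1.source) := by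
        rw [measure_inter_conull (η.chartMeasure_eq_zero e.1)]
      rw [h2, hη.chartMeasure_eq e.2 (D.chart_mem k)
        ((hB.inter (D.measurableSet_piece k)).inter e.1.open_source.measurableSet)
        Set.inter_subset_right
        (Set.inter_subset_left.trans (Set.inter_subset_right.trans (D.piece_subset k)))]
      exact measure_mono Set.inter_subset_left
    · refine Measure.le_iff.2 fun B hB => ?_
      have hBk : B = ⋃ k, B ∩ D.piece k := by
        rw [← Set.inter_iUnion, D.iUnion_piece, Set.inter_univ]
      rw [Measure.sum_apply _ hB]
      conv_rhs => rw [hBk]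
      rw [measure_iUnion (fun i j hij => (D.disjoint hij).mono Set.inter_subset_right
        Set.inter_subset_right) (fun k => hB.inter (D.measurableSet_piece k))]
      refine ENNReal.tsum_le_tsum fun k => ?_
      rw [Measure.restrict_apply hB]
      exact le_iSup (fun e : holCharts n X => η.chartMeasure e.1) ⟨D.chart k, D.chart_mem k⟩ _
  rw [h1, Measure.sum_apply _ hA]
  exact tsum_congr fun k => Measure.restrict_apply hA

/-- The reference measure `D.measure` does not depend on the form, so questions about different
forms become questions about functions in one measure space. -/
theorem absMeasure_eq_withDensity {η : VolForm n X} (hη : η.IsCovariant)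
    (hm : Measurable fun x => η x (D.frame x)) :
    η.absMeasure = D.measure.withDensity fun x => ‖η x (D.frame x)‖ₑ := by
  refine Measure.ext fun A hA => ?_
  rw [D.absMeasure_apply hη hA, withDensity_apply _ hA, ← lintegral_indicator hA,
    D.lintegral_measure (hm.enorm.indicator hA)]
  refine tsum_congr fun k => ?_
  have hT := measurableSet_target_inter_preimage (D.chart k) (D.measurableSet_piece k)
  have hT' := measurableSet_target_inter_preimage (D.chart k) (hA.inter (D.measurableSet_piece k))
  rw [η.chartMeasure_apply _ (hA.inter (D.measurableSet_piece k)), ← lintegral_indicator hT',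
    ← lintegral_indicator hT]
  congr 1
  funext a
  by_cases ha : a ∈ (D.chart k).target ∩ (D.chart k).symm ⁻¹' D.piece k
  · rw [Set.indicator_of_mem ha]
    by_cases haA : (D.chart k).symm a ∈ A
    · have haT : a ∈ (D.chart k).target ∩ (D.chart k).symm ⁻¹' (A ∩ D.piece k) :=
        ⟨ha.1, haA, ha.2⟩
      rw [Set.indicator_of_mem (s := A) haA, Set.indicator_of_mem haT,
        D.volForm_frame η ha.2, (D.chart k).right_inv ha.1]
    · rw [Set.indicator_of_notMem (s := A) haA, Set.indicator_of_notMem fun h => haA h.2.1]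
  · rw [Set.indicator_of_notMem ha, Set.indicator_of_notMem fun h => ha ⟨h.1, h.2.2⟩]

end ChartPartition

variable [BorelSpace X] [IsManifold 𝓘(ℂ, Fin n → ℂ) ω X] [SecondCountableTopology X]

/-- The measure of a subset of a chart. -/
theorem VolForm.IsCovariant.absMeasure_eq_lintegral {η : VolForm n X} (hη : η.IsCovariant)
    {e : OpenPartialHomeomorph X (Fin n → ℂ)} (he : e ∈ holCharts n X) {A : Set X}
    (hA : MeasurableSet A) (hAe : A ⊆ e.source) :
    η.absMeasure A = ∫⁻ a in e.target ∩ e.symm ⁻¹' A, ‖η.coeff e a‖ₑ := by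
  rw [← η.chartMeasure_apply e hA]
  rcases isEmpty_or_nonempty X with hX | hX
  · simp [Set.eq_empty_of_isEmpty A]
  obtain ⟨D⟩ := nonempty_chartPartition (n := n) (X := X)
  rw [D.absMeasure_apply hη hA]
  have hAk : A = ⋃ k, A ∩ D.piece k := by
    rw [← Set.inter_iUnion, D.iUnion_piece, Set.inter_univ]
  conv_rhs => rw [hAk]
  rw [measure_iUnion (fun i j hij => (D.disjoint hij).mono Set.inter_subset_right
    Set.inter_subset_right) (fun k => hA.inter (D.measurableSet_piece k))]
  exact tsum_congr fun k => hη.chartMeasure_eq (D.chart_mem k) he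
    (hA.inter (D.measurableSet_piece k)) (Set.inter_subset_right.trans (D.piece_subset k))
    (Set.inter_subset_left.trans hAe)

end Pieces

/-! ### Phases, integrals and inner products -/

section Phase

variable {n : ℕ} {X : Type*} [TopologicalSpace X] [ChartedSpace (Fin n → ℂ) X]

/-- The derivative of `e` inverts that of `e.symm`, hence the nonzero determinant. -/
theorem coordFrame_eq_sum_single {e : OpenPartialHomeomorph X (Fin n → ℂ)} (he : e ∈ holCharts n X)
    {x : X} (hx : x ∈ e.source) : ∃ A : Matrix (Fin n) (Fin n) ℂ, A.det ≠ 0 ∧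
      (coordFrame e (e x) : Fin n → Fin n → ℂ)
        = fun i => ∑ j, A i j • (Pi.single j (1 : ℂ) : Fin n → ℂ) := by
  let L : (Fin n → ℂ) →L[ℂ] (Fin n → ℂ) :=
    mfderiv 𝓘(ℂ, Fin n → ℂ) 𝓘(ℂ, Fin n → ℂ) e.symm (e x)
  let R : (Fin n → ℂ) →L[ℂ] (Fin n → ℂ) :=
    mfderiv 𝓘(ℂ, Fin n → ℂ) 𝓘(ℂ, Fin n → ℂ) e (e.symm (e x))
  have hRL : R.comp L = ContinuousLinearMap.id ℂ _ := by
    have h3 : MDifferentiableAt 𝓘(ℂ, Fin n → ℂ) 𝓘(ℂ, Fin n → ℂ) e (e.symm (e x)) :=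
      mdifferentiableAt_chart he (by rwa [e.left_inv hx])
    have h4 := mfderiv_comp (e x) h3 (mdifferentiableAt_chart_symm he (e.map_source hx))
    have hev : e ∘ e.symm =ᶠ[𝓝 (e x)] id := by
      filter_upwards [e.open_target.mem_nhds (e.map_source hx)] with b hb
      exact e.right_inv hb
    rw [mfderiv_eq_fderiv, hev.fderiv_eq, fderiv_id] at h4
    exact h4.symm
  refine ⟨fun i j => L (Pi.single i 1) j, ?_, ?_⟩
  · have h2 : LinearMap.det (L : (Fin n → ℂ) →ₗ[ℂ] (Fin n → ℂ))
        = Matrix.det (fun i j => L (Pi.single i 1) j) := by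
      rw [← LinearMap.det_toMatrix', ← Matrix.det_transpose]
      congr 1
    rw [← h2]
    intro h0
    have h5 := congrArg (fun T : (Fin n → ℂ) →L[ℂ] (Fin n → ℂ) =>
      LinearMap.det (T : (Fin n → ℂ) →ₗ[ℂ] (Fin n → ℂ))) hRL
    simp [h0] at h5
  · funext i
    exact pi_eq_sum_univ' (L (Pi.single i 1))

/-- The phase is computed on the standard frame, but passing to the frame of `D` only multiplies the
value by a positive number. -/
theorem ChartPartition.phase_mul_norm [MeasurableSpace X] (D : ChartPartition n X) {η : VolForm n X}
    (hη : η.IsCovariant) (x : X) :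
    (‖η x (D.frame x)‖ : ℂ) * η.phase x = η x (D.frame x) := by
  obtain ⟨A, hA, hfr⟩ := coordFrame_eq_sum_single (D.chart_mem (D.index x))
    (D.piece_subset _ (D.mem_piece_index x))
  have h : η x (D.frame x) = (‖A.det‖ ^ 2 : ℝ) *
      η x (fun i => (Pi.single i (1 : ℂ) : Fin n → ℂ)) :=
    (η.apply_congr rfl _ _ hfr).trans (hη x A _)
  rw [h, VolForm.phase]
  set c := η x (fun i => (Pi.single i (1 : ℂ) : Fin n → ℂ)) with hc
  rw [norm_mul, Complex.norm_real, Real.norm_of_nonneg (by positivity)]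
  by_cases h0 : c = 0
  · simp [h0]
  · have : (‖c‖ : ℂ) ≠ 0 := by simpa using h0
    push_cast
    field_simp

variable [MeasurableSpace X] [BorelSpace X]

theorem ChartPartition.integral_phase (D : ChartPartition n X) {η : VolForm n X}
    (hη : η.IsCovariant) (hm : Measurable fun x => η x (D.frame x)) :
    ∫ x, η.phase x ∂η.absMeasure = ∫ x, η x (D.frame x) ∂D.measure := by
  rw [D.absMeasure_eq_withDensity hη hm]
  have h := integral_withDensity_eq_integral_smul (μ := D.measure)
    (f := fun x => ‖η x (D.frame x)‖₊) hm.nnnorm η.phase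
  refine Eq.trans ?_ (h.trans ?_)
  · rfl
  · refine integral_congr_ae (Eventually.of_forall fun x => ?_)
    simp only [NNReal.smul_def, coe_nnnorm, Complex.real_smul]
    exact D.phase_mul_norm hη x

/-- The factor `i^(n²) 2^(-n)` of the inner product cancels the factor `2ⁿ i^(-n²)` of the integral,
leaving an `L²` inner product. -/
theorem ChartPartition.formInner_eq_integral (D : ChartPartition n X) {f g : TopForm n X}
    (hf : f.IsHolomorphic) (hg : g.IsHolomorphic) :
    formInner f g = ∫ x, f x (D.frame x) * (starRingEnd ℂ) (g x (D.frame x)) ∂D.measure := by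
  have hm : Measurable fun x => wedgeConj f g x (D.frame x) :=
    (D.measurable_topForm_frame hf).mul
      (Complex.continuous_conj.measurable.comp (D.measurable_topForm_frame hg))
  rw [formInner, VolForm.integral, D.integral_phase (wedgeConj_isCovariant f g) hm, ← mul_assoc]
  have : Complex.I ^ n ^ 2 * (2 ^ n)⁻¹ * (2 ^ n * Complex.I⁻¹ ^ n ^ 2) = 1 := by
    rw [inv_pow]
    have h1 : Complex.I ^ n ^ 2 ≠ 0 := pow_ne_zero _ Complex.I_ne_zero
    field_simp
  rw [this, one_mul]
  rfl

theorem ChartPartition.absMeasure_wedgeConj_self (D : ChartPartition n X) {f : TopForm n X}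
    (hf : f.IsHolomorphic) :
    (wedgeConj f f).absMeasure Set.univ = ∫⁻ x, ‖f x (D.frame x)‖ₑ ^ 2 ∂D.measure := by
  have hm : Measurable fun x => wedgeConj f f x (D.frame x) :=
    (D.measurable_topForm_frame hf).mul
      (Complex.continuous_conj.measurable.comp (D.measurable_topForm_frame hf))
  rw [D.absMeasure_eq_withDensity (wedgeConj_isCovariant f f) hm,
    withDensity_apply _ MeasurableSet.univ, Measure.restrict_univ]
  refine lintegral_congr fun x => ?_
  simp only [wedgeConj, enorm_mul, sq]
  congr 1
  simp [enorm_eq_nnnorm]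

end Phase

theorem tendsto_setLIntegral_of_tendstoUniformlyOn {α ι : Type*} [MeasurableSpace α] {μ : Measure α}
    {l : Filter ι} {f : ι → α → ℂ} {g : α → ℂ} {s : Set α} (hs : MeasurableSet s) (hμ : μ s ≠ ⊤)
    (hg : ∫⁻ x in s, ‖g x‖ₑ ∂μ ≠ ⊤) (h : TendstoUniformlyOn f g l s) :
    Tendsto (fun i => ∫⁻ x in s, ‖f i x‖ₑ ∂μ) l (𝓝 (∫⁻ x in s, ‖g x‖ₑ ∂μ)) := by
  rw [ENNReal.tendsto_nhds hg]
  intro ε hε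
  -- A pointwise error `δ` costs at most `δ μ(s)`. Here `ε` may be infinite and `μ(s)` may vanish,
  -- hence the case split and the `+ 1`.
  obtain ⟨δ, hδ, hδε⟩ : ∃ δ : ℝ, 0 < δ ∧ ENNReal.ofReal δ * μ s ≤ ε := by
    by_cases hε' : ε = ⊤
    · exact ⟨1, one_pos, hε' ▸ le_top⟩
    · refine ⟨ε.toReal / ((μ s).toReal + 1), ?_, ?_⟩
      · have := ENNReal.toReal_pos hε.ne' hε'
        positivity
      · rw [← ENNReal.ofReal_toReal hμ, ← ENNReal.ofReal_mul (by positivity)]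
        conv_rhs => rw [← ENNReal.ofReal_toReal hε']
        refine ENNReal.ofReal_le_ofReal ?_
        rw [ENNReal.toReal_ofReal ENNReal.toReal_nonneg, div_mul_eq_mul_div,
          div_le_iff₀ (by positivity)]
        nlinarith [ENNReal.toReal_nonneg (a := ε)]
  have hadd : ∀ u v : α → ℂ, (∀ x ∈ s, dist (u x) (v x) ≤ δ) →
      ∫⁻ x in s, ‖u x‖ₑ ∂μ ≤ ∫⁻ x in s, ‖v x‖ₑ ∂μ + ε := by
    intro u v huv
    calc ∫⁻ x in s, ‖u x‖ₑ ∂μ ≤ ∫⁻ x in s, (‖v x‖ₑ + ENNReal.ofReal δ) ∂μ := by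
          refine setLIntegral_mono' hs fun x hx => ?_
          have h1 : ‖u x‖ ≤ ‖v x‖ + δ := by
            have := huv x hx
            rw [dist_eq_norm] at this
            linarith [norm_le_norm_add_norm_sub (v x) (u x), norm_sub_rev (u x) (v x)]
          rw [← ofReal_norm, ← ofReal_norm, ← ENNReal.ofReal_add (norm_nonneg _) hδ.le]
          exact ENNReal.ofReal_le_ofReal h1
      _ = ∫⁻ x in s, ‖v x‖ₑ ∂μ + ENNReal.ofReal δ * μ s := by
          rw [lintegral_add_right _ measurable_const, setLIntegral_const]
      _ ≤ _ := by gcongr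
  filter_upwards [Metric.tendstoUniformlyOn_iff.1 h δ hδ] with i hi
  refine ⟨tsub_le_iff_right.2 (hadd _ _ fun x hx => (hi x hx).le), hadd _ _ fun x hx => ?_⟩
  rw [dist_comm]
  exact (hi x hx).le

/-! ### Limits of holomorphic forms -/

section Limits

variable {n : ℕ} {X : Type*} [TopologicalSpace X] [ChartedSpace (Fin n → ℂ) X]

theorem wedgeConj_coeff (f g : TopForm n X) (e : OpenPartialHomeomorph X (Fin n → ℂ))
    (a : Fin n → ℂ) : (wedgeConj f g).coeff e a = f.coeff e a * (starRingEnd ℂ) (g.coeff e a) := rfl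

theorem enorm_wedgeConj_coeff_self (f : TopForm n X) (e : OpenPartialHomeomorph X (Fin n → ℂ))
    (a : Fin n → ℂ) : ‖(wedgeConj f f).coeff e a‖ₑ = ‖f.coeff e a‖ₑ ^ 2 := by
  rw [wedgeConj_coeff, enorm_mul, sq]
  congr 1
  simp [enorm_eq_nnnorm]

theorem TopForm.apply_eq_det_mul (f : TopForm n X) (x : X) (v : Fin n → Fin n → ℂ) :
    f x v = Matrix.det (Matrix.of v) * f x (fun i => (Pi.single i (1 : ℂ) : Fin n → ℂ)) := by
  refine Eq.trans ?_ (AlternatingMap_apply_sum (f x) (Matrix.of v)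
    (fun i => (Pi.single i (1 : ℂ) : Fin n → ℂ)))
  refine f.apply_congr rfl _ _ ?_
  funext i
  exact pi_eq_sum_univ' (v i)

/-- The value of a form on a frame is a multiple of its coefficient in a chart. -/
theorem exists_apply_eq_mul_coeff {e : OpenPartialHomeomorph X (Fin n → ℂ)}
    (he : e ∈ holCharts n X) {x : X} (hx : x ∈ e.source) (v : Fin n → Fin n → ℂ) :
    ∃ c : ℂ, ∀ f : TopForm n X, f x v = c * f.coeff e (e x) := by
  obtain ⟨A, hA, hfr⟩ := coordFrame_eq_sum_single he hx
  refine ⟨Matrix.det (Matrix.of v) * (A.det)⁻¹, fun f => ?_⟩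
  have h : f.coeff e (e x) = A.det * f x (fun i => (Pi.single i (1 : ℂ) : Fin n → ℂ)) :=
    (f.apply_congr (e.left_inv hx) _ _ hfr).trans (AlternatingMap_apply_sum (f x) A _)
  rw [h, f.apply_eq_det_mul, mul_assoc, inv_mul_cancel_left₀ hA]

/-- A form is determined by its value on the standard frame; the limit is defined as that limiting
value times the determinant, so it is alternating by construction. -/
theorem exists_tendsto_topForm {ι : Type*} {l : Filter ι} {f : ι → TopForm n X}
    (hf : ∀ x (v : Fin n → TangentSpace 𝓘(ℂ, Fin n → ℂ) x), ∃ c : ℂ,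
      Tendsto (fun i => f i x v) l (𝓝 c)) :
    ∃ g : TopForm n X, ∀ x v, Tendsto (fun i => f i x v) l (𝓝 (g x v)) := by
  choose c hc using hf
  refine ⟨fun x => c x (fun i => (Pi.single i (1 : ℂ) : Fin n → ℂ)) •
    ((Pi.basisFun ℂ (Fin n)).det : (Fin n → ℂ) [⋀^Fin n]→ₗ[ℂ] ℂ), fun x v => ?_⟩
  have h1 : ∀ i, f i x v = f i x (fun i => (Pi.single i (1 : ℂ) : Fin n → ℂ)) *
      Matrix.det (Matrix.of v) := fun i => ((f i).apply_eq_det_mul x v).trans (mul_comm _ _)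
  have h2 : ∀ (z : ℂ) (w : Fin n → Fin n → ℂ), (z •
      ((Pi.basisFun ℂ (Fin n)).det : (Fin n → ℂ) [⋀^Fin n]→ₗ[ℂ] ℂ)) w
      = z * Matrix.det (Matrix.of w) := fun z w => by
    rw [AlternatingMap.smul_apply]
    exact congrArg _ (Pi.basisFun_det_apply (R := ℂ) (v := Matrix.of w))
  refine Tendsto.congr (fun i => (h1 i).symm) ?_
  refine Eq.mpr (congrArg (fun z => Tendsto _ l (𝓝 z)) (h2 _ v)) ?_
  exact (hc x _).mul_const _

variable [MeasurableSpace X] [BorelSpace X] [IsManifold 𝓘(ℂ, Fin n → ℂ) ω X]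
  [SecondCountableTopology X]

/-- The mean value inequality for a holomorphic form in a chart. -/
theorem volume_mul_enorm_coeff_sq_le {f : TopForm n X} (hf : f.IsHolomorphic)
    {e : OpenPartialHomeomorph X (Fin n → ℂ)} (he : e ∈ holCharts n X) {a : Fin n → ℂ} {r : ℝ}
    (hr : 0 < r) (ha : Metric.ball a (2 * r) ⊆ e.target) {y : Fin n → ℂ} (hy : y ∈ Metric.ball a r) :
    volume (Metric.ball (0 : Fin n → ℂ) (r / 2)) * ‖f.coeff e y‖ₑ ^ 2
      ≤ (wedgeConj f f).absMeasure (e.symm '' Metric.ball a (2 * r)) := by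
  have hopen : IsOpen (e.symm '' Metric.ball a (2 * r)) :=
    e.symm.isOpen_image_of_subset_source Metric.isOpen_ball ha
  have hsub : e.symm '' Metric.ball a (2 * r) ⊆ e.source := by
    rintro _ ⟨b, hb, rfl⟩
    exact e.map_target (ha hb)
  have hball : Metric.ball y r ⊆ Metric.ball a (2 * r) := by
    refine Metric.ball_subset_ball' ?_
    rw [Metric.mem_ball] at hy
    linarith
  rw [(wedgeConj_isCovariant f f).absMeasure_eq_lintegral he hopen.measurableSet hsub]
  refine (volume_mul_enorm_sq_le_lintegral (R := r) (by linarith)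
    ((hf e he).mono (hball.trans ha))).trans ?_
  simp only [enorm_wedgeConj_coeff_self]
  refine lintegral_mono_set ?_
  intro b hb
  have hb2 : b ∈ Metric.ball a (2 * r) := hball (Metric.ball_subset_ball (by linarith) hb)
  exact ⟨ha hb2, b, hb2, rfl⟩

theorem volForm_absMeasure_tendsto {ι : Type*} {l : Filter ι} {η : ι → VolForm n X}
    {ξ : VolForm n X} (hη : ∀ i, (η i).IsCovariant) (hξ : ξ.IsCovariant)
    {e : OpenPartialHomeomorph X (Fin n → ℂ)} (he : e ∈ holCharts n X)
    (h : TendstoLocallyUniformlyOn (fun i => (η i).coeff e) (ξ.coeff e) l e.target)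
    (hc : ContinuousOn (ξ.coeff e) e.target)
    {A : Set X} (hA : MeasurableSet A) {K : Set (Fin n → ℂ)} (hK : IsCompact K)
    (hKe : K ⊆ e.target) (hAK : A ⊆ e.source ∩ e ⁻¹' K) :
    Tendsto (fun i => (η i).absMeasure A) l (𝓝 (ξ.absMeasure A)) ∧ ξ.absMeasure A ≠ ⊤ := by
  have hAe : A ⊆ e.source := hAK.trans Set.inter_subset_left
  have hs : e.target ∩ e.symm ⁻¹' A ⊆ K := by
    rintro a ⟨ha, haA⟩
    have := (hAK haA).2
    rwa [Set.mem_preimage, e.right_inv ha] at this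
  have hm := measurableSet_target_inter_preimage e hA
  have hfin : ∫⁻ a in e.target ∩ e.symm ⁻¹' A, ‖ξ.coeff e a‖ₑ ≠ ⊤ := by
    have h1 : IntegrableOn (ξ.coeff e) K := (hc.mono hKe).integrableOn_compact hK
    exact ((lintegral_mono_set hs).trans_lt h1.2).ne
  have h1 := tendsto_setLIntegral_of_tendstoUniformlyOn (μ := volume) hm
    ((measure_mono hs).trans_lt hK.measure_lt_top).ne hfin
    (((tendstoLocallyUniformlyOn_iff_forall_isCompact e.open_target).1 h K hKe hK).mono hs)
  simp only [hξ.absMeasure_eq_lintegral he hA hAe]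
  refine ⟨?_, hfin⟩
  refine h1.congr fun i => ?_
  rw [(hη i).absMeasure_eq_lintegral he hA hAe]

omit [IsManifold 𝓘(ℂ, Fin n → ℂ) ω X] in
/-- A partition of a complex manifold into relatively compact pieces of given charts. -/
theorem exists_chartPartition_isCompact [Nonempty X] (e : X → OpenPartialHomeomorph X (Fin n → ℂ))
    (he : ∀ x, e x ∈ holCharts n X) (hxe : ∀ x, x ∈ (e x).source) :
    ∃ D : ChartPartition n X, (∀ k, IsOpen (⋃ i ∈ Finset.range (k + 1), D.piece i)) ∧
      ∀ k, ∃ x, D.chart k = e x ∧ ∃ K, IsCompact K ∧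
      K ⊆ (D.chart k).target ∧ D.piece k ⊆ (D.chart k).source ∩ D.chart k ⁻¹' K := by
  have h1 : ∀ x, ∃ r > 0, Metric.closedBall (e x x) r ⊆ (e x).target := fun x =>
    Metric.nhds_basis_closedBall.mem_iff.1
      ((e x).open_target.mem_nhds ((e x).map_source (hxe x)))
  choose r hr hrt using h1
  obtain ⟨D, hDo, hD⟩ := exists_chartPartition e he hxe
    (fun x => (e x).source ∩ e x ⁻¹' Metric.closedBall (e x x) (r x)) (fun x =>
      inter_mem ((e x).open_source.mem_nhds (hxe x))
        (((e x).continuousAt (hxe x)).preimage_mem_nhds (Metric.closedBall_mem_nhds _ (hr x))))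
  refine ⟨D, hDo, fun k => ?_⟩
  obtain ⟨x, hx, hxN⟩ := hD k
  exact ⟨x, hx, _, isCompact_closedBall _ _, hx ▸ hrt x, by rw [hx]; exact hxN⟩

/-- A pointwise limit of holomorphic forms which are bounded in `L²` on compact subsets is a
square integrable holomorphic form. -/
theorem isHolomorphic_and_absMeasure_le_of_tendsto {ι : Type*} {l : Filter ι} [l.NeBot]
    {f : ι → TopForm n X} {g : TopForm n X} {C : ENNReal} (hC : C ≠ ⊤)
    (hf : ∀ i, (f i).IsHolomorphic)
    (hb : ∀ Q : Set X, IsCompact Q → ∀ᶠ i in l, (wedgeConj (f i) (f i)).absMeasure Q ≤ C)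
    (hg : ∀ x v, Tendsto (fun i => f i x v) l (𝓝 (g x v))) :
    g.IsHolomorphic ∧ (wedgeConj g g).absMeasure Set.univ ≤ C := by
  have hun : ∀ e ∈ holCharts n X, DifferentiableOn ℂ (g.coeff e) e.target ∧
      TendstoLocallyUniformlyOn (fun i => (f i).coeff e) (g.coeff e) l e.target := by
    intro e he
    have hlb : ∀ a ∈ e.target, ∃ M : ℝ, ∃ r > 0, ∀ᶠ i in l,
        DifferentiableOn ℂ ((f i).coeff e) (Metric.ball a r) ∧
        ∀ y ∈ Metric.ball a r, ‖(f i).coeff e y‖ ≤ M := by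
      intro a ha
      obtain ⟨ρ, hρ, hρe⟩ := Metric.nhds_basis_closedBall.mem_iff.1 (e.open_target.mem_nhds ha)
      set r := ρ / 2 with hr
      have hr0 : 0 < r := by positivity
      have h2r : 2 * r = ρ := by rw [hr]; ring
      have hsub : Metric.ball a (2 * r) ⊆ e.target := by
        rw [h2r]; exact Metric.ball_subset_closedBall.trans hρe
      have hQ : IsCompact (e.symm '' Metric.closedBall a ρ) :=
        (isCompact_closedBall a ρ).image_of_continuousOn (e.continuousOn_symm.mono hρe)
      set V := volume (Metric.ball (0 : Fin n → ℂ) (r / 2)) with hV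
      have hV0 : V ≠ 0 := (Metric.measure_ball_pos _ _ (by positivity)).ne'
      -- The mean value inequality gives `V |f(y)|² ≤ C`, with `V` the volume of a ball of radius `r
      -- / 2`.
      refine ⟨((C / V) ^ (1 / 2 : ℝ)).toReal, r, hr0, ?_⟩
      filter_upwards [hb _ hQ] with i hi
      refine ⟨(hf i e he).mono ((Metric.ball_subset_ball (by linarith)).trans hsub),
        fun y hy => ?_⟩
      have h1 := (volume_mul_enorm_coeff_sq_le (hf i) he hr0 hsub hy).trans
        ((measure_mono (Set.image_mono (h2r ▸ Metric.ball_subset_closedBall))).trans hi)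
      have hVt : V ≠ ⊤ := Metric.isBounded_ball.measure_lt_top.ne
      have h2 : ‖(f i).coeff e y‖ₑ ^ 2 ≤ C / V := by
        rw [ENNReal.le_div_iff_mul_le (Or.inl hV0) (Or.inl hVt), mul_comm]
        exact h1
      have h3 : ‖(f i).coeff e y‖ₑ ≤ (C / V) ^ (1 / 2 : ℝ) := by
        rw [one_div, ENNReal.le_rpow_inv_iff (by norm_num)]
        exact_mod_cast h2
      have h4 := ENNReal.toReal_mono
        (ENNReal.rpow_ne_top_of_nonneg (by norm_num) (ENNReal.div_ne_top hC hV0)) h3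
      rwa [toReal_enorm] at h4
    have h1 := tendstoLocallyUniformlyOn_of_locallyBounded hlb e.open_target
      (fun a _ => hg (e.symm a) (coordFrame e a))
    exact ⟨(differentiableOn_and_tendsto_fderiv e.open_target (fun a ha =>
      (Metric.isOpen_iff.1 e.open_target a ha).imp fun r hr =>
        ⟨hr.1, Eventually.of_forall fun i => (hf i e he).mono hr.2⟩) h1).1, h1⟩
  refine ⟨fun e he => (hun e he).1, ?_⟩
  rcases isEmpty_or_nonempty X with hX | hX
  · simp [Set.eq_empty_of_isEmpty (Set.univ : Set X)]
  obtain ⟨D, -, hD⟩ := exists_chartPartition_isCompact (n := n) (X := X)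
    (fun x => chartAt (Fin n → ℂ) x) (fun x => IsManifold.chart_mem_maximalAtlas x)
    (fun x => mem_chart_source _ x)
  choose x hx K hK hKt hKp using hD
  have hlim : ∀ k, Tendsto (fun i => (wedgeConj (f i) (f i)).absMeasure (D.piece k)) l
      (𝓝 ((wedgeConj g g).absMeasure (D.piece k))) := by
    intro k
    obtain ⟨hd, hu⟩ := hun _ (D.chart_mem k)
    have hcc := Complex.isometry_conj.uniformContinuous.comp_tendstoLocallyUniformlyOn hu
    have hcont : ContinuousOn ((starRingEnd ℂ) ∘ g.coeff (D.chart k)) (D.chart k).target :=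
      Complex.continuous_conj.comp_continuousOn hd.continuousOn
    refine (volForm_absMeasure_tendsto (fun i => wedgeConj_isCovariant (f i) (f i))
      (wedgeConj_isCovariant g g) (D.chart_mem k) ?_ ?_ (D.measurableSet_piece k) (hK k) (hKt k)
      (hKp k)).1
    · exact hu.mul₀ hcc hd.continuousOn hcont
    · exact hd.continuousOn.mul hcont
  have huniv : (wedgeConj g g).absMeasure Set.univ
      = ∑' k, (wedgeConj g g).absMeasure (D.piece k) := by
    rw [← D.iUnion_piece, measure_iUnion D.disjoint D.measurableSet_piece]
  rw [huniv]
  -- Finitely many pieces lie in one compact set, where the bound `C` holds eventually and passes to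
  -- the limit. Only then are all pieces summed, as in Fatou's lemma.
  refine ENNReal.tsum_le_of_sum_range_le fun N => ?_
  refine le_of_tendsto (tendsto_finsetSum _ fun k _ => hlim k) ?_
  have hQ : IsCompact (⋃ k ∈ Finset.range N, (D.chart k).symm '' K k) :=
    (Finset.range N).isCompact_biUnion fun k _ =>
      (hK k).image_of_continuousOn ((D.chart k).continuousOn_symm.mono (hKt k))
  filter_upwards [hb _ hQ] with i hi
  rw [← measure_biUnion_finset (fun j _ k _ hjk => D.disjoint hjk)
    fun k _ => D.measurableSet_piece k]
  refine (measure_mono (Set.iUnion₂_mono fun k _ => ?_)).trans hi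
  intro y hy
  exact ⟨_, (hKp k hy).2, (D.chart k).left_inv (hKp k hy).1⟩

end Limits

/-! ### The Hilbert space of square integrable holomorphic forms -/

section Hilbert

variable {n : ℕ} {X : Type*} [TopologicalSpace X] [ChartedSpace (Fin n → ℂ) X]

theorem TopForm.IsHolomorphic.add {f g : TopForm n X} (hf : f.IsHolomorphic)
    (hg : g.IsHolomorphic) : (f + g).IsHolomorphic :=
  fun e he => (hf e he).add (hg e he)

theorem TopForm.IsHolomorphic.const_smul {f : TopForm n X} (c : ℂ) (hf : f.IsHolomorphic) :
    (c • f).IsHolomorphic :=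
  fun e he => (hf e he).const_smul c

theorem TopForm.isHolomorphic_zero : (0 : TopForm n X).IsHolomorphic :=
  fun _ _ => differentiableOn_const 0

variable [MeasurableSpace X] [BorelSpace X]

namespace ChartPartition

variable (D : ChartPartition n X)

theorem mem_bergmanSpace_iff {f : TopForm n X} : f ∈ bergmanSpace n X ↔
    f.IsHolomorphic ∧ MemLp (fun x => f x (D.frame x)) 2 D.measure := by
  refine and_congr_right fun hf => ?_
  rw [D.absMeasure_wedgeConj_self hf]
  have h := eLpNorm_lt_top_iff_lintegral_rpow_enorm_lt_top (p := 2) (μ := D.measure)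
    (f := fun x => f x (D.frame x)) (by norm_num) (by norm_num)
  have h2 : ∀ x, ‖f x (D.frame x)‖ₑ ^ (2 : ENNReal).toReal = ‖f x (D.frame x)‖ₑ ^ 2 := by
    intro x
    rw [ENNReal.toReal_ofNat]
    exact_mod_cast rfl
  simp only [h2] at h
  rw [← h]
  exact ⟨fun h => ⟨(D.measurable_topForm_frame hf).aestronglyMeasurable, h⟩, fun h => h.2⟩

/-- The square integrable holomorphic forms as a linear space. -/
def bergmanSubmodule : Submodule ℂ (TopForm n X) where
  carrier := bergmanSpace n X
  add_mem' := by
    intro f g hf hg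
    rw [D.mem_bergmanSpace_iff] at hf hg ⊢
    exact ⟨hf.1.add hg.1, hf.2.add hg.2⟩
  zero_mem' := by
    rw [D.mem_bergmanSpace_iff]
    exact ⟨TopForm.isHolomorphic_zero, MemLp.zero' ..⟩
  smul_mem' := by
    intro c f hf
    rw [D.mem_bergmanSpace_iff] at hf ⊢
    exact ⟨hf.1.const_smul c, hf.2.const_smul c⟩

theorem memLp (f : D.bergmanSubmodule) : MemLp (fun x => f.1 x (D.frame x)) 2 D.measure :=
  (D.mem_bergmanSpace_iff.1 f.2).2

/-- The isometric embedding of the square integrable holomorphic forms into an `L²`-space. -/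
noncomputable def toL2 : D.bergmanSubmodule →ₗ[ℂ] Lp ℂ 2 D.measure where
  toFun f := (D.memLp f).toLp _
  map_add' f g := MemLp.toLp_add (D.memLp f) (D.memLp g)
  map_smul' c f := MemLp.toLp_const_smul c (D.memLp f)

theorem coeFn_toL2 (f : D.bergmanSubmodule) :
    D.toL2 f =ᵐ[D.measure] fun x => f.1 x (D.frame x) := MemLp.coeFn_toLp (D.memLp f)

/-- The arguments are exchanged because `inner` is conjugate linear in its first argument and
`formInner` in its second. -/
theorem inner_toL2 (f g : D.bergmanSubmodule) :
    inner ℂ (D.toL2 g) (D.toL2 f) = formInner f.1 g.1 := by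
  rw [D.formInner_eq_integral f.2.1 g.2.1, L2.inner_def]
  refine integral_congr_ae ?_
  filter_upwards [D.coeFn_toL2 f, D.coeFn_toL2 g] with x hf hg
  rw [hf, hg]
  rfl

theorem enorm_toL2_sq (f : D.bergmanSubmodule) :
    ‖D.toL2 f‖ₑ ^ 2 = (wedgeConj f.1 f.1).absMeasure Set.univ := by
  rw [D.absMeasure_wedgeConj_self f.2.1, Lp.enorm_def, eLpNorm_congr_ae (D.coeFn_toL2 f)]
  have h := eLpNorm_nnreal_pow_eq_lintegral (μ := D.measure) (p := 2)
    (f := fun x => f.1 x (D.frame x)) two_ne_zero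
  simpa only [NNReal.coe_ofNat, ENNReal.rpow_two, ENNReal.coe_ofNat] using h

variable [IsManifold 𝓘(ℂ, Fin n → ℂ) ω X] [SecondCountableTopology X]

/-- The mean value inequality on a coordinate ball around `x` makes evaluation a bounded functional.
Injectivity of the embedding in `L²`, closedness of its range and the existence of the kernel all
rest on this. -/
theorem exists_norm_apply_le (x : X) (v : Fin n → TangentSpace 𝓘(ℂ, Fin n → ℂ) x) :
    ∃ M : ℝ, ∀ f : D.bergmanSubmodule, ‖f.1 x v‖ ≤ M * ‖D.toL2 f‖ := by
  set e := chartAt (Fin n → ℂ) x with he'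
  have he : e ∈ holCharts n X := IsManifold.chart_mem_maximalAtlas x
  have hx : x ∈ e.source := mem_chart_source _ x
  obtain ⟨c, hc⟩ := exists_apply_eq_mul_coeff he hx v
  obtain ⟨ρ, hρ, hρe⟩ := Metric.isOpen_iff.1 e.open_target (e x) (e.map_source hx)
  set r := ρ / 2 with hr
  have hr0 : 0 < r := by positivity
  have h2r : 2 * r = ρ := by rw [hr]; ring
  set V := volume (Metric.ball (0 : Fin n → ℂ) (r / 2)) with hV
  have hVt : V ≠ ⊤ := Metric.isBounded_ball.measure_lt_top.ne
  have hV0 : 0 < V.toReal :=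
    ENNReal.toReal_pos (Metric.measure_ball_pos _ _ (by positivity)).ne' hVt
  refine ⟨‖c‖ * Real.sqrt (V.toReal)⁻¹, fun f => ?_⟩
  have h1 := (volume_mul_enorm_coeff_sq_le f.2.1 he hr0 (h2r ▸ hρe)
    (Metric.mem_ball_self hr0)).trans (measure_mono (Set.subset_univ _))
  rw [← D.enorm_toL2_sq] at h1
  have h2 := ENNReal.toReal_mono (by finiteness) h1
  rw [ENNReal.toReal_mul, ENNReal.toReal_pow, ENNReal.toReal_pow, toReal_enorm, toReal_enorm] at h2
  have h3 : ‖f.1.coeff e (e x)‖ ≤ Real.sqrt (V.toReal)⁻¹ * ‖D.toL2 f‖ := by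
    rw [← Real.sqrt_sq (norm_nonneg (D.toL2 f)), ← Real.sqrt_mul (by positivity)]
    refine Real.le_sqrt_of_sq_le ?_
    rw [inv_mul_eq_div, le_div_iff₀ hV0]
    linarith
  rw [hc, norm_mul, mul_assoc]
  gcongr

theorem toL2_injective : Function.Injective D.toL2 := by
  rw [injective_iff_map_eq_zero]
  intro f hf
  refine Subtype.ext ?_
  funext x
  ext v
  obtain ⟨M, hM⟩ := D.exists_norm_apply_le x v
  have := hM f
  rw [hf, norm_zero, mul_zero] at this
  exact norm_le_zero_iff.1 this

/-- Bounded evaluations turn `L²`-convergence into pointwise convergence to a form, which is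
holomorphic and square integrable by the uniform norm bound. An almost everywhere convergent
subsequence identifies it with the `L²`-limit. -/
theorem isClosed_range_toL2 : IsClosed (LinearMap.range D.toL2 : Set (Lp ℂ 2 D.measure)) := by
  refine isClosed_of_closure_subset fun u hu => ?_
  obtain ⟨y, hy, hyu⟩ := mem_closure_iff_seq_limit.1 hu
  choose f hf using hy
  have hlim : Tendsto (fun k => D.toL2 (f k)) atTop (𝓝 u) := hyu.congr fun k => (hf k).symm
  obtain ⟨g, hg⟩ := exists_tendsto_topForm (l := atTop) (f := fun k => (f k).1) (by
    intro x v
    obtain ⟨M, hM⟩ := D.exists_norm_apply_le x v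
    have hC : CauchySeq fun k => (f k).1 x v := by
      have h1 := hlim.cauchySeq
      rw [Metric.cauchySeq_iff] at h1 ⊢
      intro ε hε
      obtain ⟨N, hN⟩ := h1 (ε / (|M| + 1)) (by positivity)
      refine ⟨N, fun i hi j hj => ?_⟩
      have h2 := hN i hi j hj
      rw [dist_eq_norm, ← map_sub, lt_div_iff₀ (by positivity)] at h2
      have h3 : ‖(f i).1 x v - (f j).1 x v‖ ≤ M * ‖D.toL2 (f i - f j)‖ := hM (f i - f j)
      rw [dist_eq_norm]
      nlinarith [norm_nonneg (D.toL2 (f i - f j)), le_abs_self M]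
    exact cauchySeq_tendsto_of_complete hC)
  obtain ⟨B, hB⟩ := hlim.norm.bddAbove_range
  have hgh := (isHolomorphic_and_absMeasure_le_of_tendsto (l := atTop) (f := fun k => (f k).1)
    (C := ENNReal.ofReal B ^ 2) (by finiteness) (fun k => (f k).2.1) (fun Q _ =>
      Eventually.of_forall fun k => by
        refine (measure_mono (Set.subset_univ _)).trans ?_
        rw [← D.enorm_toL2_sq, ← ofReal_norm]
        gcongr
        exact hB ⟨k, rfl⟩) hg)
  have hmem : g ∈ D.bergmanSubmodule := ⟨hgh.1, hgh.2.trans_lt (by finiteness)⟩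
  refine ⟨⟨g, hmem⟩, ?_⟩
  obtain ⟨ns, hns, hae⟩ := (tendstoInMeasure_of_tendsto_Lp hlim).exists_seq_tendsto_ae
  have hall : ∀ᵐ x ∂D.measure, ∀ k, D.toL2 (f k) x = (f k).1 x (D.frame x) :=
    ae_all_iff.2 fun k => D.coeFn_toL2 (f k)
  refine Lp.ext ?_
  filter_upwards [hae, hall, D.coeFn_toL2 ⟨g, hmem⟩] with x h1 h2 h3
  rw [h3]
  refine tendsto_nhds_unique ((hg x (D.frame x)).comp hns.tendsto_atTop) ?_
  exact h1.congr fun i => h2 _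

instance : CompleteSpace (LinearMap.range D.toL2) :=
  D.isClosed_range_toL2.completeSpace_coe

/-- `r` is the Riesz representer of evaluation at `(w, u)`. Its Fourier coefficients are the
conjugates of `s w u`, and the continuous evaluation at `(z, v)` may be applied to its Fourier
series term by term. -/
theorem hasSum_of_isOrthonormalBasis {S : Set (TopForm n X)} (hS : IsOrthonormalBasis S) (w : X)
    (u : Fin n → TangentSpace 𝓘(ℂ, Fin n → ℂ) w) : ∃ r : D.bergmanSubmodule,
      (∀ z v, HasSum (fun s : S => s.1 z v * (starRingEnd ℂ) (s.1 w u)) (r.1 z v)) ∧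
      ∀ f : D.bergmanSubmodule, inner ℂ (D.toL2 r) (D.toL2 f) = f.1 w u := by
  let T := LinearEquiv.ofInjective D.toL2 D.toL2_injective
  have hTi : ∀ a b : LinearMap.range D.toL2, inner ℂ a b
      = inner ℂ (D.toL2 (T.symm a)) (D.toL2 (T.symm b)) := by
    intro a b
    have h1 : ∀ a, D.toL2 (T.symm a) = a.1 := fun a => congrArg Subtype.val (T.apply_symm_apply a)
    rw [h1, h1]
    rfl
  let ev : ∀ (z : X) (v : Fin n → TangentSpace 𝓘(ℂ, Fin n → ℂ) z),
      D.bergmanSubmodule →ₗ[ℂ] ℂ := fun z v =>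
    { toFun := fun f => f.1 z v
      map_add' := fun f g => rfl
      map_smul' := fun c f => rfl }
  have hcont : ∀ z v, ∃ L : StrongDual ℂ (LinearMap.range D.toL2),
      ∀ f, L (T f) = f.1 z v := by
    intro z v
    obtain ⟨M, hM⟩ := D.exists_norm_apply_le z v
    refine ⟨((ev z v).comp T.symm.toLinearMap).mkContinuous M fun a => ?_, fun f => ?_⟩
    · have h1 : D.toL2 (T.symm a) = a.1 := congrArg Subtype.val (T.apply_symm_apply a)
      have := hM (T.symm a)
      rw [h1] at this
      exact this
    · change (T.symm (T f)).1 z v = f.1 z v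
      rw [T.symm_apply_apply]
  choose L hL using hcont
  let v : S → LinearMap.range D.toL2 := fun s => T ⟨s.1, hS.subset s.2⟩
  have hv : Orthonormal ℂ v := by
    classical
    rw [orthonormal_iff_ite]
    intro s t
    have h1 : inner ℂ (v s) (v t) = formInner t.1 s.1 :=
      D.inner_toL2 ⟨t.1, hS.subset t.2⟩ ⟨s.1, hS.subset s.2⟩
    rw [h1]
    split_ifs with h
    · subst h
      exact hS.norm_one _ s.2
    · exact hS.orthogonal _ t.2 _ s.2 fun h' => h (Subtype.ext h'.symm)
  have hbot : (Submodule.span ℂ (Set.range v))ᗮ = ⊥ := by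
    rw [Submodule.eq_bot_iff]
    intro a ha
    have h1 : ∀ s ∈ S, formInner (T.symm a).1 s = 0 := by
      intro s hs
      rw [← D.inner_toL2 (T.symm a) ⟨s, hS.subset hs⟩]
      have h2 := (Submodule.mem_orthogonal _ _).1 ha (v ⟨s, hs⟩)
        (Submodule.subset_span ⟨⟨s, hs⟩, rfl⟩)
      have h3 : D.toL2 (T.symm a) = a.1 := congrArg Subtype.val (T.apply_symm_apply a)
      rw [h3]
      exact h2
    have h2 := hS.complete _ (T.symm a).2 h1
    have h3 : T.symm a = 0 := Subtype.ext h2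
    simpa using congrArg T h3
  let b := HilbertBasis.mkOfOrthogonalEqBot hv hbot
  have hb : ∀ s, b s = v s := fun s => by simp [b]
  let ρ := (InnerProductSpace.toDual ℂ (LinearMap.range D.toL2)).symm (L w u)
  have hρ : ∀ f, inner ℂ ρ (T f) = f.1 w u := fun f => by
    rw [InnerProductSpace.toDual_symm_apply, hL]
  refine ⟨T.symm ρ, fun z v' => ?_, fun f => ?_⟩
  · have h1 := (b.hasSum_repr ρ).mapL (L z v')
    have h2 : L z v' ρ = (T.symm ρ).1 z v' := by
      rw [← hL, T.apply_symm_apply]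
    rw [h2] at h1
    refine Eq.mp (congrArg (fun F => HasSum F _) (funext fun s => ?_)) h1
    rw [map_smul, hb, hL, b.repr_apply_apply, hb, smul_eq_mul, mul_comm, ← inner_conj_symm, hρ]
  · rw [← hρ f]
    have h3 : D.toL2 (T.symm ρ) = ρ.1 := congrArg Subtype.val (T.apply_symm_apply ρ)
    rw [h3]
    rfl

end ChartPartition

variable [IsManifold 𝓘(ℂ, Fin n → ℂ) ω X] [SecondCountableTopology X]

/-- A Hilbert basis of the closed subspace of `L²`, read as forms. It justifies the choice by
`Classical.epsilon` in `bergmanKernel`. -/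
theorem exists_isOrthonormalBasis [Nonempty X] : ∃ S : Set (TopForm n X), IsOrthonormalBasis S := by
  classical
  obtain ⟨D⟩ := nonempty_chartPartition (n := n) (X := X)
  obtain ⟨w, b, hb⟩ := exists_hilbertBasis ℂ (LinearMap.range D.toL2)
  have hort : ∀ i j : w, inner ℂ (i.1.1 : Lp ℂ 2 D.measure) j.1.1 = if i = j then 1 else 0 := by
    intro i j
    have := (orthonormal_iff_ite.1 b.orthonormal) i j
    rw [hb] at this
    exact this
  refine ⟨{f | ∃ (hf : f ∈ D.bergmanSubmodule) (i : w), i.1.1 = D.toL2 ⟨f, hf⟩}, ?_, ?_, ?_, ?_⟩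
  · exact fun f hf => hf.1
  · rintro f ⟨hf, i, hi⟩
    rw [← D.inner_toL2 ⟨f, hf⟩ ⟨f, hf⟩, ← hi, hort, if_pos rfl]
  · rintro f ⟨hf, i, hi⟩ g ⟨hg, j, hj⟩ hfg
    rw [← D.inner_toL2 ⟨f, hf⟩ ⟨g, hg⟩, ← hi, ← hj, hort, if_neg]
    rintro rfl
    refine hfg (congrArg Subtype.val (D.toL2_injective (a₁ := ⟨f, hf⟩) (a₂ := ⟨g, hg⟩) ?_))
    rw [← hi, hj]
  · intro f hf h0
    have h1 : (⟨D.toL2 ⟨f, hf⟩, ⟨_, rfl⟩⟩ : LinearMap.range D.toL2) = 0 := by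
      refine b.repr.injective (lp.ext ?_)
      funext i
      obtain ⟨g, hg⟩ := i.1.2
      have hgS : formInner f g.1 = 0 := h0 g.1 ⟨g.2, i, hg.symm⟩
      rw [← D.inner_toL2 ⟨f, hf⟩ g, hg] at hgS
      rw [b.repr_apply_apply, hb, map_zero]
      exact hgS
    have h2 : D.toL2 ⟨f, hf⟩ = 0 := congrArg Subtype.val h1
    exact congrArg Subtype.val (D.toL2_injective (h2.trans (map_zero _).symm))

open Classical in
/-- The orthonormal basis in terms of which the Bergman kernel is defined. -/
noncomputable def bergmanBasis (n : ℕ) (X : Type*) [TopologicalSpace X]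
    [ChartedSpace (Fin n → ℂ) X] [MeasurableSpace X] : Set (TopForm n X) :=
  Classical.epsilon fun S : Set (TopForm n X) => IsOrthonormalBasis S

theorem isOrthonormalBasis_bergmanBasis [Nonempty X] : IsOrthonormalBasis (bergmanBasis n X) :=
  Classical.epsilon_spec exists_isOrthonormalBasis

/-- The reproducing property of the Bergman kernel. -/
theorem exists_bergmanKernel_representer (D : ChartPartition n X) (w : X)
    (u : Fin n → TangentSpace 𝓘(ℂ, Fin n → ℂ) w) : ∃ r : D.bergmanSubmodule,
      (∀ z v, r.1 z v = bergmanKernel n X z w v u) ∧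
      ∀ f : D.bergmanSubmodule, inner ℂ (D.toL2 r) (D.toL2 f) = f.1 w u := by
  have : Nonempty X := ⟨w⟩
  obtain ⟨r, hr, hr'⟩ := D.hasSum_of_isOrthonormalBasis isOrthonormalBasis_bergmanBasis w u
  exact ⟨r, fun z v => (hr z v).tsum_eq.symm, hr'⟩

theorem hasSum_bergmanKernel (z w : X) (v : Fin n → TangentSpace 𝓘(ℂ, Fin n → ℂ) z)
    (u : Fin n → TangentSpace 𝓘(ℂ, Fin n → ℂ) w) :
    HasSum (fun s : bergmanBasis n X => s.1 z v * (starRingEnd ℂ) (s.1 w u))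
      (bergmanKernel n X z w v u) := by
  have : Nonempty X := ⟨w⟩
  obtain ⟨D⟩ := nonempty_chartPartition (n := n) (X := X)
  obtain ⟨r, hr, -⟩ := D.hasSum_of_isOrthonormalBasis isOrthonormalBasis_bergmanBasis w u
  have h := hr z v
  rwa [← h.tsum_eq] at h

/-- On the diagonal the Bergman kernel is real and nonnegative, and it bounds the partial sums of
its expansion. -/
theorem exists_bergmanKernel_self (w : X) (u : Fin n → TangentSpace 𝓘(ℂ, Fin n → ℂ) w) :
    ∃ κ : ℝ, 0 ≤ κ ∧ bergmanKernel n X w w u u = κ ∧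
      ∀ F : Finset (bergmanBasis n X), ∑ s ∈ F, ‖s.1 w u‖ ^ 2 ≤ κ := by
  have h := hasSum_bergmanKernel (n := n) w w u u
  have h1 : ∀ s : bergmanBasis n X, s.1 w u * (starRingEnd ℂ) (s.1 w u)
      = ((‖s.1 w u‖ ^ 2 : ℝ) : ℂ) := fun s => by
    rw [Complex.mul_conj, Complex.normSq_eq_norm_sq]
  simp only [h1] at h
  have h2 := Complex.hasSum_re h
  simp only [Complex.ofReal_re] at h2
  refine ⟨(bergmanKernel n X w w u u).re, h2.nonneg fun s => by positivity, ?_, fun F =>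
    sum_le_hasSum F (fun s _ => by positivity) h2⟩
  have h3 := Complex.hasSum_ofReal.2 h2
  exact h.unique h3

end Hilbert

/-! ### Pull-back by local biholomorphisms -/

section Pullback

variable {n : ℕ} {X Y : Type*} [TopologicalSpace X] [ChartedSpace (Fin n → ℂ) X]
  [TopologicalSpace Y] [ChartedSpace (Fin n → ℂ) Y]

/-- The pull-back of an `(n,0)`-form. -/
noncomputable def TopForm.pullback (ψ : Y → X) (f : TopForm n X) : TopForm n Y :=
  fun y => (f (ψ y)).compLinearMap
    (mfderiv 𝓘(ℂ, Fin n → ℂ) 𝓘(ℂ, Fin n → ℂ) ψ y :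
      TangentSpace 𝓘(ℂ, Fin n → ℂ) y →ₗ[ℂ] TangentSpace 𝓘(ℂ, Fin n → ℂ) (ψ y))

theorem wedgeConj_pullback (ψ : Y → X) (f g : TopForm n X) :
    (wedgeConj f g).pullback ψ = wedgeConj (f.pullback ψ) (g.pullback ψ) := rfl

theorem VolForm.IsCovariant.pullback {η : VolForm n X} (hη : η.IsCovariant) (ψ : Y → X) :
    (η.pullback ψ).IsCovariant := by
  intro y A v
  refine Eq.trans ?_ (hη (ψ y) A fun i => mfderiv 𝓘(ℂ, Fin n → ℂ) 𝓘(ℂ, Fin n → ℂ) ψ y (v i))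
  refine congrArg (η (ψ y)) (funext fun i => ?_)
  rw [map_sum]
  exact Finset.sum_congr rfl fun j _ => map_smul _ _ _

theorem mfderiv_coordFrame {ψ : Y → X} {e : OpenPartialHomeomorph Y (Fin n → ℂ)}
    (he : e ∈ holCharts n Y) {a : Fin n → ℂ} (ha : a ∈ e.target)
    (hψ : MDifferentiableAt 𝓘(ℂ, Fin n → ℂ) 𝓘(ℂ, Fin n → ℂ) ψ (e.symm a)) (i : Fin n) :
    mfderiv 𝓘(ℂ, Fin n → ℂ) 𝓘(ℂ, Fin n → ℂ) ψ (e.symm a) (coordFrame e a i)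
      = mfderiv 𝓘(ℂ, Fin n → ℂ) 𝓘(ℂ, Fin n → ℂ) (ψ ∘ e.symm) a
        (Pi.single i (1 : ℂ) : Fin n → ℂ) := by
  rw [mfderiv_comp a hψ (mdifferentiableAt_chart_symm he ha)]
  rfl

theorem TopForm.pullback_coeff (f : TopForm n X) {ψ : Y → X}
    {e : OpenPartialHomeomorph Y (Fin n → ℂ)}
    (he : e ∈ holCharts n Y) {a : Fin n → ℂ} (ha : a ∈ e.target)
    (hψ : MDifferentiableAt 𝓘(ℂ, Fin n → ℂ) 𝓘(ℂ, Fin n → ℂ) ψ (e.symm a)) :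
    (f.pullback ψ).coeff e a = f ((ψ ∘ e.symm) a) (fun i =>
      mfderiv 𝓘(ℂ, Fin n → ℂ) 𝓘(ℂ, Fin n → ℂ) (ψ ∘ e.symm) a
        (Pi.single i (1 : ℂ) : Fin n → ℂ)) :=
  congrArg (f (ψ (e.symm a))) (funext fun i => mfderiv_coordFrame he ha hψ i)

theorem VolForm.pullback_coeff (η : VolForm n X) {ψ : Y → X}
    {e : OpenPartialHomeomorph Y (Fin n → ℂ)}
    (he : e ∈ holCharts n Y) {a : Fin n → ℂ} (ha : a ∈ e.target)
    (hψ : MDifferentiableAt 𝓘(ℂ, Fin n → ℂ) 𝓘(ℂ, Fin n → ℂ) ψ (e.symm a)) :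
    (η.pullback ψ).coeff e a = η ((ψ ∘ e.symm) a) (fun i =>
      mfderiv 𝓘(ℂ, Fin n → ℂ) 𝓘(ℂ, Fin n → ℂ) (ψ ∘ e.symm) a
        (Pi.single i (1 : ℂ) : Fin n → ℂ)) :=
  congrArg (η (ψ (e.symm a))) (funext fun i => mfderiv_coordFrame he ha hψ i)

theorem differentiableOn_det_jacobian {τ : (Fin n → ℂ) → (Fin n → ℂ)} {U : Set (Fin n → ℂ)}
    (hU : IsOpen U) (hτ : DifferentiableOn ℂ τ U) :
    DifferentiableOn ℂ (fun a => (jacobian τ a).det) U := by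
  simp only [Matrix.det_apply']
  refine DifferentiableOn.fun_sum fun σ _ => ?_
  refine DifferentiableOn.const_mul (𝕜 := ℂ) ?_ _
  have h : ∀ i ∈ Finset.univ, DifferentiableOn ℂ (fun a => jacobian τ a (σ i) i) U := fun i _ =>
    differentiableOn_pi.1 (differentiableOn_fderiv_apply hU hτ (Pi.single (σ i) 1)) i
  exact fun a ha => (HasFDerivWithinAt.finsetProd fun i hi =>
    (h i hi a ha).hasFDerivWithinAt).differentiableWithinAt

theorem TopForm.IsHolomorphic.pullback [IsManifold 𝓘(ℂ, Fin n → ℂ) ω X] {f : TopForm n X}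
    (hf : f.IsHolomorphic) {ψ : Y → X}
    (hψ : MDifferentiable 𝓘(ℂ, Fin n → ℂ) 𝓘(ℂ, Fin n → ℂ) ψ) : (f.pullback ψ).IsHolomorphic := by
  intro e he a ha
  set c := chartAt (Fin n → ℂ) (ψ (e.symm a)) with hc
  have hcm : c ∈ holCharts n X := IsManifold.chart_mem_maximalAtlas _
  have hγc : ContinuousOn (ψ ∘ e.symm) e.target :=
    hψ.continuous.comp_continuousOn e.continuousOn_symm
  set U := e.target ∩ (ψ ∘ e.symm) ⁻¹' c.source with hU
  have hUo : IsOpen U := hγc.isOpen_inter_preimage e.open_target c.open_source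
  have hγ : ∀ b ∈ U, MDifferentiableAt 𝓘(ℂ, Fin n → ℂ) 𝓘(ℂ, Fin n → ℂ) (ψ ∘ e.symm) b :=
    fun b hb => (hψ _).comp b (mdifferentiableAt_chart_symm he hb.1)
  have hτ : DifferentiableOn ℂ (c ∘ (ψ ∘ e.symm)) U := fun b hb =>
    ((mdifferentiableAt_chart hcm hb.2).comp b
      (hγ b hb)).differentiableAt.differentiableWithinAt
  have haU : a ∈ U := ⟨ha, mem_chart_source _ _⟩
  have hd : DifferentiableOn ℂ (fun b => (jacobian (c ∘ (ψ ∘ e.symm)) b).det *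
      f.coeff c ((c ∘ (ψ ∘ e.symm)) b)) U :=
    (differentiableOn_det_jacobian hUo hτ).mul
      ((hf c hcm).comp hτ fun b hb => c.map_source hb.2)
  have heq : ∀ b ∈ U, (f.pullback ψ).coeff e b = (jacobian (c ∘ (ψ ∘ e.symm)) b).det *
      f.coeff c ((c ∘ (ψ ∘ e.symm)) b) := fun b hb => by
    rw [f.pullback_coeff he hb.1 (hψ _), f.apply_frame hcm (hγ b hb) hb.2]
    rfl
  exact ((hd.congr heq a haU).differentiableAt (hUo.mem_nhds haU)).differentiableWithinAt

/-- A chart of the source adapted to a chart of the target of a local biholomorphism. -/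
theorem exists_chart_comp [IsManifold 𝓘(ℂ, Fin n → ℂ) ω Y] {ψ : Y → X}
    (hψ : IsLocalDiffeomorph 𝓘(ℂ, Fin n → ℂ) 𝓘(ℂ, Fin n → ℂ) ω ψ)
    {e : OpenPartialHomeomorph X (Fin n → ℂ)} (he : e ∈ holCharts n X) {y : Y}
    (hy : ψ y ∈ e.source) : ∃ c ∈ holCharts n Y, y ∈ c.source ∧
      ∀ x ∈ c.source, ψ x ∈ e.source ∧ c x = e (ψ x) := by
  obtain ⟨Φ, hyΦ, hΦ⟩ := hψ y
  refine ⟨Φ.toOpenPartialHomeomorph.trans e, ?_, ?_, ?_⟩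
  · refine OpenPartialHomeomorph.mem_maximalAtlas_of_contMDiffOn
      (I := 𝓘(ℂ, Fin n → ℂ)) (n := ω) _ ?_ ?_
    · refine (contMDiffOn_of_mem_maximalAtlas he).comp (Φ.contMDiffOn.mono ?_) ?_
      · exact fun x hx => hx.1
      · exact fun x hx => hx.2
    · refine (Φ.symm.contMDiffOn).comp ((contMDiffOn_symm_of_mem_maximalAtlas he).mono ?_) ?_
      · exact fun x hx => hx.1
      · exact fun x hx => hx.2
  · exact ⟨hyΦ, (by rw [← hΦ hyΦ]; exact hy : Φ y ∈ e.source)⟩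
  · rintro x ⟨hx1, hx2⟩
    have h := hΦ hx1
    refine ⟨by rw [h]; exact hx2, ?_⟩
    rw [h]
    rfl

theorem VolForm.pullback_coeff_of_chart {η : VolForm n X} {ψ : Y → X}
    (hψ : MDifferentiable 𝓘(ℂ, Fin n → ℂ) 𝓘(ℂ, Fin n → ℂ) ψ)
    {e : OpenPartialHomeomorph X (Fin n → ℂ)} {c : OpenPartialHomeomorph Y (Fin n → ℂ)}
    (hc : c ∈ holCharts n Y) (hce : ∀ x ∈ c.source, ψ x ∈ e.source ∧ c x = e (ψ x))
    {a : Fin n → ℂ} (ha : a ∈ c.target) : (η.pullback ψ).coeff c a = η.coeff e a := by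
  have hev : ψ ∘ c.symm =ᶠ[𝓝 a] e.symm := by
    filter_upwards [c.open_target.mem_nhds ha] with b hb
    obtain ⟨h1, h2⟩ := hce _ (c.map_target hb)
    rw [c.right_inv hb] at h2
    change ψ (c.symm b) = e.symm b
    conv_rhs => rw [h2, e.left_inv h1]
  rw [η.pullback_coeff hc ha (hψ _)]
  refine η.apply_congr hev.eq_of_nhds _ _ (funext fun i => ?_)
  exact congrArg (fun L => L (Pi.single i (1 : ℂ) : Fin n → ℂ))
    (hev.mfderiv_eq (I := 𝓘(ℂ, Fin n → ℂ)) (I' := 𝓘(ℂ, Fin n → ℂ)))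

variable [MeasurableSpace X] [BorelSpace X] [MeasurableSpace Y] [BorelSpace Y]
  [IsManifold 𝓘(ℂ, Fin n → ℂ) ω X] [IsManifold 𝓘(ℂ, Fin n → ℂ) ω Y]
  [SecondCountableTopology X] [SecondCountableTopology Y]

/-- In charts of `Y` obtained by composing `ψ` with charts of `X`, both sides integrate the same
coefficient over the same set. Injectivity on `Q` serves only to keep the images of the pieces
disjoint. -/
theorem absMeasure_pullback {ψ : Y → X}
    (hψ : IsLocalDiffeomorph 𝓘(ℂ, Fin n → ℂ) 𝓘(ℂ, Fin n → ℂ) ω ψ) {η : VolForm n X}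
    (hη : η.IsCovariant) {Q : Set Y} (hQ : MeasurableSet Q) (hinj : Set.InjOn ψ Q) :
    (η.pullback ψ).absMeasure Q = η.absMeasure (ψ '' Q) := by
  rcases isEmpty_or_nonempty Y with hY | hY
  · simp [Set.eq_empty_of_isEmpty Q]
  have hc : ∀ y : Y, ∃ c ∈ holCharts n Y, y ∈ c.source ∧ ∀ x ∈ c.source,
      ψ x ∈ (chartAt (Fin n → ℂ) (ψ y)).source ∧ c x = chartAt (Fin n → ℂ) (ψ y) (ψ x) := fun y =>
    exists_chart_comp hψ (IsManifold.chart_mem_maximalAtlas (ψ y)) (mem_chart_source _ _)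
  choose c hcm hyc hce using hc
  obtain ⟨D, -, hD⟩ := exists_chartPartition c hcm hyc (fun _ => Set.univ) (fun _ => univ_mem)
  have hpiece : ∀ k, MeasurableSet (ψ '' (Q ∩ D.piece k)) ∧
      (η.pullback ψ).absMeasure (Q ∩ D.piece k) = η.absMeasure (ψ '' (Q ∩ D.piece k)) := by
    intro k
    obtain ⟨y, hy, -⟩ := hD k
    have hk := hce y
    rw [← hy] at hk
    set e := chartAt (Fin n → ℂ) (ψ y) with he
    have hem : e ∈ holCharts n X := IsManifold.chart_mem_maximalAtlas _
    set A := Q ∩ D.piece k with hA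
    have hAm : MeasurableSet A := hQ.inter (D.measurableSet_piece k)
    have hAs : A ⊆ (D.chart k).source := Set.inter_subset_right.trans (D.piece_subset k)
    have hT := measurableSet_target_inter_preimage (D.chart k) hAm
    have hset : e.target ∩ e.symm ⁻¹' (ψ '' A) = (D.chart k).target ∩ (D.chart k).symm ⁻¹' A := by
      ext a
      constructor
      · rintro ⟨ha, x, hx, hxa⟩
        obtain ⟨h1, h2⟩ := hk x (hAs hx)
        rw [hxa, e.right_inv ha] at h2
        refine ⟨h2 ▸ (D.chart k).map_source (hAs hx), ?_⟩
        rw [Set.mem_preimage, ← h2, (D.chart k).left_inv (hAs hx)]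
        exact hx
      · rintro ⟨ha, haA⟩
        obtain ⟨h1, h2⟩ := hk _ ((D.chart k).map_target ha)
        rw [(D.chart k).right_inv ha] at h2
        refine ⟨h2 ▸ e.map_source h1, _, haA, ?_⟩
        conv_rhs => rw [h2, e.left_inv h1]
    have hψA : ψ '' A ⊆ e.source := by
      rintro _ ⟨x, hx, rfl⟩
      exact (hk x (hAs hx)).1
    have himg : ψ '' A = e.source ∩ e ⁻¹' ((D.chart k).target ∩ (D.chart k).symm ⁻¹' A) := by
      rw [← hset]
      ext x
      constructor
      · intro hx
        exact ⟨hψA hx, e.map_source (hψA hx), by rwa [Set.mem_preimage, e.left_inv (hψA hx)]⟩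
      · rintro ⟨hx, -, hx2⟩
        rwa [Set.mem_preimage, e.left_inv hx] at hx2
    have hm : MeasurableSet (ψ '' A) := by
      rw [himg]
      exact measurableSet_inter_preimage_source e hT
    refine ⟨hm, ?_⟩
    rw [(hη.pullback ψ).absMeasure_eq_lintegral (D.chart_mem k) hAm hAs,
      hη.absMeasure_eq_lintegral hem hm hψA, hset]
    refine setLIntegral_congr_fun hT fun a ha => ?_
    rw [VolForm.pullback_coeff_of_chart (hψ.mdifferentiable (by simp)) (D.chart_mem k) hk ha.1]
  have hQk : Q = ⋃ k, Q ∩ D.piece k := by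
    rw [← Set.inter_iUnion, D.iUnion_piece, Set.inter_univ]
  conv_lhs => rw [hQk]
  conv_rhs => rw [hQk, Set.image_iUnion]
  rw [measure_iUnion (fun i j hij => (D.disjoint hij).mono Set.inter_subset_right
    Set.inter_subset_right) (fun k => hQ.inter (D.measurableSet_piece k)),
    measure_iUnion ?_ fun k => (hpiece k).1]
  · exact tsum_congr fun k => (hpiece k).2
  · intro i j hij
    refine Set.disjoint_left.2 ?_
    rintro _ ⟨x, hx, rfl⟩ ⟨x', hx', hxx⟩
    have := hinj hx'.1 hx.1 hxx
    subst this
    exact Set.disjoint_left.1 (D.disjoint hij) hx.2 hx'.2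

/-- Cauchy–Schwarz for the reproducing formula `f(w) = ⟨f, K(·, w)⟩`, with `‖K(·, w)‖² = K(w, w)`.
-/
theorem norm_apply_sq_le_absMeasure_mul {f : TopForm n X} (hf : f ∈ bergmanSpace n X) (w : X)
    (u : Fin n → TangentSpace 𝓘(ℂ, Fin n → ℂ) w) :
    ‖f w u‖ ^ 2 ≤ ((wedgeConj f f).absMeasure Set.univ).toReal * (bergmanKernel n X w w u u).re := by
  have : Nonempty X := ⟨w⟩
  obtain ⟨D⟩ := nonempty_chartPartition (n := n) (X := X)
  obtain ⟨r, hr, hr'⟩ := exists_bergmanKernel_representer D w u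
  have h1 := hr' r
  rw [hr] at h1
  have h2 := hr' ⟨f, hf⟩
  have h3 : ‖D.toL2 r‖ ^ 2 = (bergmanKernel n X w w u u).re := by
    rw [← h1, ← inner_self_eq_norm_sq (𝕜 := ℂ)]
    rfl
  have h4 : ‖D.toL2 ⟨f, hf⟩‖ ^ 2 = ((wedgeConj f f).absMeasure Set.univ).toReal := by
    rw [← D.enorm_toL2_sq ⟨f, hf⟩, ENNReal.toReal_pow, toReal_enorm]
  have h5 := norm_inner_le_norm (𝕜 := ℂ) (D.toL2 r) (D.toL2 ⟨f, hf⟩)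
  rw [h2] at h5
  calc ‖f w u‖ ^ 2 ≤ (‖D.toL2 r‖ * ‖D.toL2 ⟨f, hf⟩‖) ^ 2 := by gcongr
    _ = _ := by rw [mul_pow, h3, h4, mul_comm]

/-- The form `K(·, w)` is square integrable and its square norm is `K(w, w)`. -/
theorem exists_bergmanKernel_section (w : X) (u : Fin n → TangentSpace 𝓘(ℂ, Fin n → ℂ) w) :
    ∃ r ∈ bergmanSpace n X, (∀ z v, r z v = bergmanKernel n X z w v u) ∧
      (wedgeConj r r).absMeasure Set.univ
        = ENNReal.ofReal (bergmanKernel n X w w u u).re := by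
  have : Nonempty X := ⟨w⟩
  obtain ⟨D⟩ := nonempty_chartPartition (n := n) (X := X)
  obtain ⟨r, hr, hr'⟩ := exists_bergmanKernel_representer D w u
  refine ⟨r.1, r.2, hr, ?_⟩
  have h1 := hr' r
  rw [hr] at h1
  have h3 : ‖D.toL2 r‖ ^ 2 = (bergmanKernel n X w w u u).re := by
    rw [← h1, ← inner_self_eq_norm_sq (𝕜 := ℂ)]
    rfl
  rw [← D.enorm_toL2_sq, ← h3, ENNReal.ofReal_pow (norm_nonneg _), ofReal_norm]

/-- The Bergman kernel on the diagonal decreases under the extension of the manifold. -/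
theorem bergmanKernel_diag_le_of_injective {ψ : Y → X}
    (hψ : IsLocalDiffeomorph 𝓘(ℂ, Fin n → ℂ) 𝓘(ℂ, Fin n → ℂ) ω ψ) (hinj : Function.Injective ψ)
    (y : Y) (v : Fin n → TangentSpace 𝓘(ℂ, Fin n → ℂ) y) :
    (((bergmanKernel n X).diag.pullback ψ) y v).re ≤ ((bergmanKernel n Y).diag y v).re := by
  set u := fun i => mfderiv 𝓘(ℂ, Fin n → ℂ) 𝓘(ℂ, Fin n → ℂ) ψ y (v i) with hu
  obtain ⟨r, hr, hrK, hrn⟩ := exists_bergmanKernel_section (n := n) (ψ y) u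
  obtain ⟨κ, hκ0, hκ, -⟩ := exists_bergmanKernel_self (n := n) (ψ y) u
  have h1 : (wedgeConj (r.pullback ψ) (r.pullback ψ)).absMeasure Set.univ ≤ ENNReal.ofReal κ := by
    rw [← wedgeConj_pullback, absMeasure_pullback hψ (wedgeConj_isCovariant r r)
      MeasurableSet.univ hinj.injOn]
    refine (measure_mono (Set.subset_univ _)).trans ?_
    rw [hrn, hκ, Complex.ofReal_re]
  have hmem : r.pullback ψ ∈ bergmanSpace n Y :=
    ⟨hr.1.pullback (hψ.mdifferentiable (by simp)), h1.trans_lt ENNReal.ofReal_lt_top⟩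
  have h2 := norm_apply_sq_le_absMeasure_mul hmem y v
  have h3 : r.pullback ψ y v = κ := (hrK (ψ y) u).trans hκ
  have h4 := ENNReal.toReal_mono ENNReal.ofReal_ne_top h1
  rw [ENNReal.toReal_ofReal hκ0] at h4
  rw [h3, Complex.norm_real, Real.norm_of_nonneg hκ0] at h2
  obtain ⟨μ, hμ0, hμ, -⟩ := exists_bergmanKernel_self (n := n) y v
  change (bergmanKernel n X (ψ y) (ψ y) u u).re ≤ (bergmanKernel n Y y y v v).re
  rw [hκ, hμ, Complex.ofReal_re, Complex.ofReal_re]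
  rw [hμ, Complex.ofReal_re] at h2
  -- With `κ` and `μ` the kernel values of `X` and `Y`, the bounds amount to `κ² ≤ κ μ`, which
  -- excludes `0 ≤ μ < κ`.
  by_contra hlt
  push Not at hlt
  nlinarith

end Pullback

/-! ### Covering maps -/

section Coverings

theorem surjective_of_isCoveringMap {X Y : Type*} [TopologicalSpace X] [TopologicalSpace Y]
    [PreconnectedSpace X] [Nonempty Y] {φ : Y → X} (hφ : IsCoveringMap φ) :
    Function.Surjective φ := by
  have hopen : IsOpen (Set.range φ) := hφ.isOpenMap.isOpen_range
  have hclosed : IsClosed (Set.range φ) := by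
    rw [← isOpen_compl_iff, isOpen_iff_mem_nhds]
    intro x hx
    obtain ⟨-, U, hxU, hU, -, H, -⟩ := hφ x
    refine mem_of_superset (hU.mem_nhds hxU) fun z hz => ?_
    rintro ⟨y, rfl⟩
    obtain ⟨y', hy'⟩ := (H ⟨y, hz⟩).2
    exact hx ⟨y', hy'⟩
  rw [← Set.range_eq_univ]
  exact IsClopen.eq_univ ⟨hclosed, hopen⟩ (Set.range_nonempty φ)

/-- A loop comes from the covering exactly when its lift starting at `y` closes up. -/
theorem mem_coveringSubgroup_iff {X Y : Type*} [TopologicalSpace X] [TopologicalSpace Y]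
    {φ : C(Y, X)} (hφ : IsCoveringMap φ) {y : Y} {x : X} (h : φ y = x) (g : FundamentalGroup X x) :
    g ∈ coveringSubgroup φ h ↔ hφ.monodromy g ⟨y, h⟩ = ⟨y, h⟩ := by
  constructor
  · rintro ⟨p, rfl⟩
    rw [FundamentalGroup.mapOfEq_apply]
    refine hφ.monodromy_eq_of_map_eq (ex := ⟨y, h⟩) (ey := ⟨y, h⟩) p ?_
    subst h
    obtain ⟨p⟩ := p
    refine congrArg Path.Homotopic.Quotient.mk ?_
    ext
    rfl
  · intro hg
    have hg' : y = (hφ.monodromy g ⟨y, h⟩).1 := by rw [hg]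
    refine ⟨(hφ.liftPathQuotient g ⟨y, h⟩).cast rfl hg', ?_⟩
    rw [FundamentalGroup.mapOfEq_apply]
    have h1 := hφ.map_liftPathQuotient g ⟨y, h⟩
    subst h
    generalize hφ.liftPathQuotient g ⟨y, rfl⟩ = Γ at h1
    generalize hφ.monodromy g ⟨y, rfl⟩ = e at *
    subst hg
    obtain ⟨Γ⟩ := Γ
    obtain ⟨g⟩ := g
    exact h1

/-- The fibre product is closed because the base is Hausdorff, and local injectivity makes the
diagonal open in it. -/
theorem isClosed_setOf_eq_and_ne {X Y : Type*} [TopologicalSpace X] [TopologicalSpace Y] [T2Space X]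
    {φ : Y → X} (hφ : IsLocalHomeomorph φ) : IsClosed {p : Y × Y | φ p.1 = φ p.2 ∧ p.1 ≠ p.2} := by
  rw [← isOpen_compl_iff, isOpen_iff_mem_nhds]
  rintro ⟨p, q⟩ hpq
  by_cases h : φ p = φ q
  · have hpq' : p = q := by
      by_contra hne
      exact hpq ⟨h, hne⟩
    subst hpq'
    obtain ⟨U, hpU, hU, hinj⟩ := hφ.isLocallyInjective p
    filter_upwards [(hpU.prod hpU).mem_nhds (⟨hU, hU⟩ : (p, p) ∈ U ×ˢ U)] with r hr hr'
    exact hr'.2 (hinj hr.1 hr.2 hr'.1)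
  · have hc : IsOpen {p : Y × Y | φ p.1 ≠ φ p.2} :=
      isOpen_ne_fun (hφ.continuous.comp continuous_fst) (hφ.continuous.comp continuous_snd)
    filter_upwards [hc.mem_nhds (show (p, q) ∈ {p : Y × Y | φ p.1 ≠ φ p.2} from h)] with r hr hr'
    exact hr hr'.1

variable {n : ℕ} {X : Type*} [TopologicalSpace X] [ChartedSpace (Fin n → ℂ) X]
  {Xs : ℕ → Type*} [∀ j, TopologicalSpace (Xs j)] [∀ j, ChartedSpace (Fin n → ℂ) (Xs j)]
  {Xt : Type*} [TopologicalSpace Xt] [ChartedSpace (Fin n → ℂ) Xt]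

/-- Two points of a fibre of `X̃ → X` have the same image in a covering `Y` of `X` below `X̃` if and
only if the loop in `X` between them comes from `Y`. -/
theorem map_eq_iff_mem_coveringSubgroup {X Y Z : Type*} [TopologicalSpace X] [TopologicalSpace Y]
    [TopologicalSpace Z] {φ : C(Y, X)} {φt : C(Z, X)} {ψ : C(Z, Y)} (hφ : IsCoveringMap φ)
    (hcomp : φt = φ.comp ψ) {p q : Z} (γ : Path p q) {x : X} (hp : φt p = x) (hq : φt q = x)
    (hψp : φ (ψ p) = x) :
    ψ p = ψ q ↔ ((Path.Homotopic.Quotient.mk γ).map φt).cast hp.symm hq.symm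
      ∈ coveringSubgroup φ hψp := by
  subst hcomp
  rw [mem_coveringSubgroup_iff hφ]
  have h1 : hφ.monodromy (((Path.Homotopic.Quotient.mk γ).map (φ.comp ψ)).cast hp.symm hq.symm)
      ⟨ψ p, hψp⟩ = ⟨ψ q, hq⟩ := by
    refine hφ.monodromy_eq_of_map_eq (ex := ⟨ψ p, hψp⟩) (ey := ⟨ψ q, hq⟩)
      ((Path.Homotopic.Quotient.mk γ).map ψ) ?_
    refine congrArg Path.Homotopic.Quotient.mk ?_
    ext
    rfl
  rw [h1]
  exact ⟨fun h => Subtype.ext h.symm, fun h => (congrArg Subtype.val h).symm⟩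

/-- The maps `X̃ → X_j` of a convergent tower are eventually injective on compact sets. -/
theorem eventually_injOn_of_isCompact [∀ j, T2Space (Xs j)] [T2Space Xt]
    [PathConnectedSpace Xt]
    {φ : ∀ j, C(Xs j, X)} {φt : C(Xt, X)}
    (hφ : IsTower n φ) (hconv : TowerConvergesTo n φ φt)
    {ψ : ∀ j, C(Xt, Xs j)} (hψ : ∀ j, IsHolomorphicCovering n (ψ j))
    (hcomp : ∀ j, φt = (φ j).comp (ψ j)) {Q : Set Xt} (hQ : IsCompact Q) :
    ∀ᶠ j in atTop, Set.InjOn (ψ j) Q := by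
  have hfib : ∀ j p, φ j (ψ j p) = φt p := fun j p => by rw [hcomp j]; rfl
  have hiff : ∀ p q (γ : Path p q) (h : φt p = φt q) j, ψ j p = ψ j q ↔
      ((Path.Homotopic.Quotient.mk γ).map φt).cast rfl h ∈ coveringSubgroup (φ j) (hfib j p) :=
    fun p q γ h j => map_eq_iff_mem_coveringSubgroup (hφ.galois j).isCoveringMap (hcomp j) γ rfl
      h.symm (hfib j p)
  -- Points identified at level `j` are identified at every earlier level, as the subgroups
  -- decrease. Points identified at all levels coincide, by the condition on the intersection.
  have hmono : ∀ p q, φt p = φt q → ∀ i j, i ≤ j → ψ j p = ψ j q → ψ i p = ψ i q := by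
    intro p q h i j hij hj
    have γ := PathConnectedSpace.somePath p q
    rw [hiff p q γ h] at hj ⊢
    exact hφ.antitone (φt p) (fun j => ψ j p) (fun j => hfib j p) hij hj
  have hall : ∀ p q, (∀ j, ψ j p = ψ j q) → p = q := by
    intro p q hj
    have h : φt p = φt q := by rw [← hfib 0, ← hfib 0, hj]
    have γ := PathConnectedSpace.somePath p q
    have h1 : p = q ↔ ((Path.Homotopic.Quotient.mk γ).map φt).cast rfl h
        ∈ coveringSubgroup φt (rfl : φt p = φt p) := map_eq_iff_mem_coveringSubgroup (φ := φt) (φt := φt) (ψ := ContinuousMap.id _)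
      hconv.galois.isCoveringMap rfl γ rfl h.symm rfl
    refine h1.2 ?_
    rw [← hconv.iInf_eq (φt p) (fun j => ψ j p) (fun j => hfib j p) p rfl]
    exact (Subgroup.mem_iInf (G := FundamentalGroup X (φt p))).2
      fun j => (hiff p q γ h j).1 (hj j)
  -- The pairs violating injectivity form a decreasing sequence of compact sets with empty
  -- intersection, so one of them is already empty.
  set R : ℕ → Set (Xt × Xt) := fun j => (Q ×ˢ Q) ∩ {p | ψ j p.1 = ψ j p.2 ∧ p.1 ≠ p.2} with hR
  have hRc : ∀ j, IsCompact (R j) := fun j => (hQ.prod hQ).inter_right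
    (isClosed_setOf_eq_and_ne (hψ j).isCoveringMap.isLocalHomeomorph)
  have hRanti : ∀ i j, i ≤ j → R j ⊆ R i := by
    rintro i j hij ⟨p, q⟩ ⟨hpq, h1, h2⟩
    refine ⟨hpq, hmono p q ?_ i j hij h1, h2⟩
    rw [← hfib j, ← hfib j, h1]
  have hempty : ∃ j, R j = ∅ := by
    by_contra hne
    push Not at hne
    have := IsCompact.nonempty_iInter_of_sequence_nonempty_isCompact_isClosed R
      (fun i => hRanti i (i + 1) (Nat.le_succ i)) hne (hRc 0) fun i => (hRc i).isClosed
    obtain ⟨⟨p, q⟩, hpq⟩ := this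
    rw [Set.mem_iInter] at hpq
    exact (hpq 0).2.2 (hall p q fun j => (hpq j).2.1)
  obtain ⟨j, hj⟩ := hempty
  filter_upwards [eventually_ge_atTop j] with i hi p hp q hq hpq
  by_contra hne
  have : (p, q) ∈ R i := ⟨⟨hp, hq⟩, hpq, hne⟩
  have := hRanti j i hi this
  rw [hj] at this
  exact this

end Coverings

/-! ### Push-forward under Galois coverings -/

section Pushforward

variable {n : ℕ} {X Y : Type*} [TopologicalSpace X] [ChartedSpace (Fin n → ℂ) X]
  [TopologicalSpace Y] [ChartedSpace (Fin n → ℂ) Y]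

theorem VolForm.pullback_comp {Z : Type*} [TopologicalSpace Z] [ChartedSpace (Fin n → ℂ) Z]
    {φ : Y → X} {ψ : Z → Y}
    (hφ : MDifferentiable 𝓘(ℂ, Fin n → ℂ) 𝓘(ℂ, Fin n → ℂ) φ)
    (hψ : MDifferentiable 𝓘(ℂ, Fin n → ℂ) 𝓘(ℂ, Fin n → ℂ) ψ) (η : VolForm n X) :
    η.pullback (φ ∘ ψ) = (η.pullback φ).pullback ψ := by
  funext z v
  refine congrArg (η (φ (ψ z))) (funext fun i => ?_)
  rw [mfderiv_comp z (hφ _) (hψ _)]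
  rfl

theorem VolForm.isCovariant_of_pullback {φ : Y → X} (hs : Function.Surjective φ)
    (hφ : IsLocalDiffeomorph 𝓘(ℂ, Fin n → ℂ) 𝓘(ℂ, Fin n → ℂ) ω φ) {ξ : VolForm n X}
    (h : (ξ.pullback φ).IsCovariant) : ξ.IsCovariant := by
  intro x A v
  obtain ⟨y, rfl⟩ := hs x
  let L := hφ.mfderivToContinuousLinearEquiv (by simp) y
  have h1 := h y A fun i => L.symm (v i)
  have h2 : ∀ u, ξ (φ y) u = ξ.pullback φ y fun i => L.symm (u i) := fun u =>
    congrArg (ξ (φ y)) (funext fun i => (L.apply_symm_apply (u i)).symm)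
  rw [h2, h2, ← h1]
  refine congrArg (ξ.pullback φ y) (funext fun i => ?_)
  rw [map_sum]
  exact Finset.sum_congr rfl fun j _ => map_smul _ _ _

/-- A form which is invariant under deck transformations descends to the base. -/
theorem VolForm.pullback_pushforward {φ : Y → X} (hφ : IsGaloisCovering n φ) {η : VolForm n Y}
    (hη : ∀ f : DeckTransformation n φ, η.pullback f.1 = η) :
    (η.pushforward φ).pullback φ = η := by
  classical
  refine Classical.epsilon_spec (p := fun ξ : VolForm n X => ξ.pullback φ = η) ?_
  let L : ∀ y, (Fin n → ℂ) ≃L[ℂ] (Fin n → ℂ) := fun y =>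
    hφ.isLocalBiholomorphism.mfderivToContinuousLinearEquiv (by simp) y
  refine ⟨fun x (v : Fin n → Fin n → ℂ) => if h : ∃ y, φ y = x then
    η h.choose (fun i => (L h.choose).symm (v i) : Fin n → Fin n → ℂ) else 0, ?_⟩
  funext y (v : Fin n → Fin n → ℂ)
  have hex : ∃ y', φ y' = φ y := ⟨y, rfl⟩
  refine (dif_pos hex).trans ?_
  -- The chosen preimage differs from `y` by a deck transformation, under which `η` is invariant.
  obtain ⟨f, hf⟩ := hφ.transitive y hex.choose hex.choose_spec.symm
  have h1 : η y v = η.pullback f.1 y v := by rw [hη f]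
  rw [h1]
  refine η.apply_congr hf.symm _ _ (funext fun i => ?_)
  refine (ContinuousLinearEquiv.symm_apply_eq (L hex.choose)).2 ?_
  have hcomp : φ ∘ f.1 = φ := funext f.2
  have h2 := mfderiv_comp y (hφ.isLocalBiholomorphism.mdifferentiable (by simp) (f.1 y))
    (f.1.mdifferentiable (by simp) y)
  have h3 : (mfderiv 𝓘(ℂ, Fin n → ℂ) 𝓘(ℂ, Fin n → ℂ) φ y (v i) : Fin n → ℂ)
      = mfderiv 𝓘(ℂ, Fin n → ℂ) 𝓘(ℂ, Fin n → ℂ) (φ ∘ f.1) y (v i) :=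
    congrArg (fun g : Y → X =>
      (mfderiv 𝓘(ℂ, Fin n → ℂ) 𝓘(ℂ, Fin n → ℂ) g y (v i) : Fin n → ℂ)) hcomp.symm
  have h4 : L hex.choose = L (f.1 y) := by rw [hf]
  rw [h4]
  refine h3.trans ?_
  exact DFunLike.congr_fun h2 (v i)

variable [MeasurableSpace Y] [BorelSpace Y] [IsManifold 𝓘(ℂ, Fin n → ℂ) ω Y]
  [SecondCountableTopology Y]

/-- The Bergman kernel is invariant under biholomorphic maps. -/
theorem bergmanKernel_diag_pullback_diffeomorph
    (f : Y ≃ₘ^ω⟮𝓘(ℂ, Fin n → ℂ), 𝓘(ℂ, Fin n → ℂ)⟯ Y) :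
    (bergmanKernel n Y).diag.pullback f = (bergmanKernel n Y).diag := by
  funext y v
  set u := fun i => mfderiv 𝓘(ℂ, Fin n → ℂ) 𝓘(ℂ, Fin n → ℂ) f y (v i) with hu
  have h1 := bergmanKernel_diag_le_of_injective (n := n) f.isLocalDiffeomorph f.injective y v
  have h2 := bergmanKernel_diag_le_of_injective (n := n) f.symm.isLocalDiffeomorph
    f.symm.injective (f y) u
  have hinv : ∀ w, mfderiv 𝓘(ℂ, Fin n → ℂ) 𝓘(ℂ, Fin n → ℂ) f.symm (f y)
      (mfderiv 𝓘(ℂ, Fin n → ℂ) 𝓘(ℂ, Fin n → ℂ) f y w) = w := by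
    intro w
    have h4 := mfderiv_comp y (f.symm.mdifferentiable (by simp) (f y))
      (f.mdifferentiable (by simp) y)
    have h5 : f.symm ∘ f = id := funext f.symm_apply_apply
    rw [h5, mfderiv_id] at h4
    exact (DFunLike.congr_fun h4 w).symm
  have h3 : (bergmanKernel n Y).diag.pullback f.symm (f y) u = (bergmanKernel n Y).diag y v :=
    VolForm.apply_congr _ (f.symm_apply_apply y) _ _ (funext fun i => hinv (v i))
  rw [h3] at h2
  obtain ⟨κ, -, hκ, -⟩ := exists_bergmanKernel_self (n := n) (f y) u
  obtain ⟨μ, -, hμ, -⟩ := exists_bergmanKernel_self (n := n) y v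
  have h6 := le_antisymm h1 h2
  change bergmanKernel n Y (f y) (f y) u u = bergmanKernel n Y y y v v
  change (bergmanKernel n Y (f y) (f y) u u).re = (bergmanKernel n Y y y v v).re at h6
  rw [hκ, hμ, Complex.ofReal_re, Complex.ofReal_re] at h6
  rw [hκ, hμ, h6]

theorem pullback_pushforward_bergmanKernel {φ : Y → X} (hφ : IsGaloisCovering n φ) :
    ((bergmanKernel n Y).diag.pushforward φ).pullback φ = (bergmanKernel n Y).diag :=
  VolForm.pullback_pushforward hφ fun f => bergmanKernel_diag_pullback_diffeomorph f.1

end Pushforward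

/-! ### Bounds for the Bergman kernel -/

section KernelBounds

variable {n : ℕ} {X Y : Type*} [TopologicalSpace X] [ChartedSpace (Fin n → ℂ) X]
  [TopologicalSpace Y] [ChartedSpace (Fin n → ℂ) Y]

/-- The factor compares two frames only, so one `c` serves all forms and bounds on coefficients stay
uniform along the tower. -/
theorem VolForm.IsCovariant.exists_apply_eq_mul_coeff [IsManifold 𝓘(ℂ, Fin n → ℂ) ω X]
    {e : OpenPartialHomeomorph X (Fin n → ℂ)} (he : e ∈ holCharts n X) {x : X} (hx : x ∈ e.source)
    (v : Fin n → TangentSpace 𝓘(ℂ, Fin n → ℂ) x) :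
    ∃ c : ℝ, 0 ≤ c ∧ ∀ η : VolForm n X, η.IsCovariant → η x v = c * η.coeff e (e x) := by
  obtain ⟨A, hA, hAe⟩ := coordFrame_eq_sum_single he hx
  let B : Matrix (Fin n) (Fin n) ℂ := Matrix.of v
  have hv : v = fun i => ∑ j, B i j • (Pi.single j (1 : ℂ) : Fin n → ℂ) := by
    funext i
    exact pi_eq_sum_univ' (v i)
  refine ⟨‖B.det‖ ^ 2 / ‖A.det‖ ^ 2, by positivity, fun η hη => ?_⟩
  have h1 := hη x A fun j => (Pi.single j (1 : ℂ) : Fin n → ℂ)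
  have h2 := hη x B fun j => (Pi.single j (1 : ℂ) : Fin n → ℂ)
  have h3 : η.coeff e (e x) = η x (fun i => ∑ j, A i j • (Pi.single j (1 : ℂ) : Fin n → ℂ)) :=
    η.apply_congr (e.left_inv hx) _ _ hAe
  have h4 : η x v = η x (fun i => ∑ j, B i j • (Pi.single j (1 : ℂ) : Fin n → ℂ)) :=
    η.apply_congr rfl _ _ hv
  have hA' : (‖A.det‖ : ℂ) ≠ 0 := by
    exact_mod_cast norm_ne_zero_iff.2 hA
  rw [h4, h3]
  refine h2.trans ?_
  refine Eq.trans ?_ (congrArg _ h1.symm)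
  push_cast
  field_simp

/-- The coefficient of a double form as a function of `(z, w̄)`. -/
noncomputable def DoubleForm.polarCoeff (K : DoubleForm n Y)
    (e e' : OpenPartialHomeomorph Y (Fin n → ℂ)) (p : (Fin n → ℂ) × (Fin n → ℂ)) : ℂ :=
  K.coeff e e' (p.1, star p.2)

/-- The domain of `DoubleForm.polarCoeff`. -/
def polarDomain (e e' : OpenPartialHomeomorph Y (Fin n → ℂ)) : Set ((Fin n → ℂ) × (Fin n → ℂ)) :=
  {p | p.1 ∈ e.target ∧ star p.2 ∈ e'.target}

omit [ChartedSpace (Fin n → ℂ) Y] in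
theorem isOpen_polarDomain (e e' : OpenPartialHomeomorph Y (Fin n → ℂ)) :
    IsOpen (polarDomain e e') :=
  (e.open_target.preimage continuous_fst).inter
    (e'.open_target.preimage (continuous_star.comp continuous_snd))

/-- The ball of radius `2r` lies in the domain of the inverse chart, and `ψ` is injective there. -/
structure InjectiveBall (ψ : Y → X) (e : OpenPartialHomeomorph Y (Fin n → ℂ)) (a : Fin n → ℂ)
    (r : ℝ) : Prop where
  pos : 0 < r
  subset : Metric.ball a (2 * r) ⊆ e.target
  injOn : Set.InjOn ψ (e.symm '' Metric.ball a (2 * r))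

omit [ChartedSpace (Fin n → ℂ) Y] [ChartedSpace (Fin n → ℂ) X] [TopologicalSpace X] in
theorem InjectiveBall.anti {ψ : Y → X} {e : OpenPartialHomeomorph Y (Fin n → ℂ)} {a : Fin n → ℂ}
    {r r' : ℝ} (h : InjectiveBall ψ e a r) (hr' : 0 < r') (hr : r' ≤ r) :
    InjectiveBall ψ e a r' := by
  have hb : Metric.ball a (2 * r') ⊆ Metric.ball a (2 * r) := Metric.ball_subset_ball (by linarith)
  exact ⟨hr', hb.trans h.subset, h.injOn.mono (Set.image_mono hb)⟩

-- This is what makes the estimates uniform in `j`: a ball chosen for the covering of `X` works for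
-- every intermediate covering.
omit [ChartedSpace (Fin n → ℂ) Y] [ChartedSpace (Fin n → ℂ) X] [TopologicalSpace X] in
theorem InjectiveBall.of_comp {Z : Type*} {χ : X → Z} {ψ : Y → X}
    {e : OpenPartialHomeomorph Y (Fin n → ℂ)} {a : Fin n → ℂ} {r : ℝ}
    (h : InjectiveBall (χ ∘ ψ) e a r) : InjectiveBall ψ e a r :=
  ⟨h.pos, h.subset, fun _ hx _ hy hxy => h.injOn hx hy (congrArg χ hxy)⟩

theorem exists_injectiveBall {ψ : Y → X}
    (hψ : IsLocalDiffeomorph 𝓘(ℂ, Fin n → ℂ) 𝓘(ℂ, Fin n → ℂ) ω ψ)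
    {e : OpenPartialHomeomorph Y (Fin n → ℂ)} {a : Fin n → ℂ} (ha : a ∈ e.target) :
    ∃ r, InjectiveBall ψ e a r := by
  obtain ⟨U, hU, haU, hinj⟩ := hψ.isLocalHomeomorph.isLocallyInjective (e.symm a)
  have hn : e.target ∩ e.symm ⁻¹' U ∈ 𝓝 a := inter_mem (e.open_target.mem_nhds ha)
    ((e.symm.continuousAt ha).preimage_mem_nhds (hU.mem_nhds haU))
  obtain ⟨ρ, hρ, hsub⟩ := Metric.mem_nhds_iff.1 hn
  have h2 : 2 * (ρ / 2) = ρ := by ring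
  refine ⟨ρ / 2, half_pos hρ, by rw [h2]; exact hsub.trans Set.inter_subset_left, ?_⟩
  rw [h2]
  refine hinj.mono ?_
  rintro _ ⟨b, hb, rfl⟩
  exact (hsub hb).2

theorem exists_injectiveBall_prod {ψ : Y → X}
    (hψ : IsLocalDiffeomorph 𝓘(ℂ, Fin n → ℂ) 𝓘(ℂ, Fin n → ℂ) ω ψ)
    {e e' : OpenPartialHomeomorph Y (Fin n → ℂ)} {p : (Fin n → ℂ) × (Fin n → ℂ)}
    (hp : p ∈ polarDomain e e') :
    ∃ r, 0 < r ∧ InjectiveBall ψ e p.1 r ∧ InjectiveBall ψ e' (star p.2) r := by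
  obtain ⟨r₁, h₁⟩ := exists_injectiveBall hψ hp.1
  obtain ⟨r₂, h₂⟩ := exists_injectiveBall hψ hp.2
  have h0 : 0 < min r₁ r₂ := lt_min h₁.pos h₂.pos
  exact ⟨_, h0, h₁.anti h0 (min_le_left _ _), h₂.anti h0 (min_le_right _ _)⟩

/-- The bound for coefficients of Bergman kernels on balls of radius `r`. -/
noncomputable def kernelBound (n : ℕ) (r : ℝ) : ℝ :=
  (volume (Metric.ball (0 : Fin n → ℂ) (r / 2))).toReal⁻¹

variable [MeasurableSpace X] [BorelSpace X] [IsManifold 𝓘(ℂ, Fin n → ℂ) ω X]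
  [SecondCountableTopology X]

theorem isCovariant_diag_bergmanKernel : (bergmanKernel n X).diag.IsCovariant := by
  intro x A v
  have h1 := hasSum_bergmanKernel (n := n) x x v v
  have h2 := hasSum_bergmanKernel (n := n) x x (fun i => ∑ j, A i j • v j)
    (fun i => ∑ j, A i j • v j)
  refine h2.unique ((h1.mul_left _).congr_fun ?_)
  exact fun s => wedgeConj_isCovariant s.1 s.1 x A v

/-- From `|ab| ≤ (|a|² + |b|²) / 2` term by term. Bounding every finite partial sum, not just the
kernel, is what later shows that the series converges locally uniformly. -/
theorem sum_norm_mul_norm_le (z w : X) (v : Fin n → TangentSpace 𝓘(ℂ, Fin n → ℂ) z)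
    (u : Fin n → TangentSpace 𝓘(ℂ, Fin n → ℂ) w) (F : Finset (bergmanBasis n X)) :
    ∑ s ∈ F, ‖s.1 z v * (starRingEnd ℂ) (s.1 w u)‖
      ≤ ((bergmanKernel n X z z v v).re + (bergmanKernel n X w w u u).re) / 2 := by
  obtain ⟨κ, -, hκ, hκF⟩ := exists_bergmanKernel_self (n := n) z v
  obtain ⟨μ, -, hμ, hμF⟩ := exists_bergmanKernel_self (n := n) w u
  rw [hκ, hμ, Complex.ofReal_re, Complex.ofReal_re]
  calc ∑ s ∈ F, ‖s.1 z v * (starRingEnd ℂ) (s.1 w u)‖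
      ≤ ∑ s ∈ F, (‖s.1 z v‖ ^ 2 + ‖s.1 w u‖ ^ 2) / 2 := by
        refine Finset.sum_le_sum fun s _ => ?_
        rw [norm_mul, RCLike.norm_conj]
        nlinarith [sq_nonneg (‖s.1 z v‖ - ‖s.1 w u‖)]
    _ = (∑ s ∈ F, ‖s.1 z v‖ ^ 2 + ∑ s ∈ F, ‖s.1 w u‖ ^ 2) / 2 := by
        rw [← Finset.sum_div, Finset.sum_add_distrib]
    _ ≤ _ := by gcongr <;> [exact hκF F; exact hμF F]

theorem hasSum_polarCoeff (ψ : Y → X) (e e' : OpenPartialHomeomorph Y (Fin n → ℂ))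
    (q : (Fin n → ℂ) × (Fin n → ℂ)) :
    HasSum (fun s : bergmanBasis n X => (s.1.pullback ψ).coeff e q.1 *
      (starRingEnd ℂ) ((s.1.pullback ψ).coeff e' (star q.2)))
      (((bergmanKernel n X).pullback ψ).polarCoeff e e' q) :=
  hasSum_bergmanKernel _ _ _ _

variable [MeasurableSpace Y] [BorelSpace Y] [IsManifold 𝓘(ℂ, Fin n → ℂ) ω Y]
  [SecondCountableTopology Y]

/-- Let `κ` be the kernel value at `w = ψ(e.symm b)`. The section `K(·, w)` has square norm `κ`, and
its pull-back has coefficient `κ` at `b`. As `ψ` is injective on the ball, no mass is counted twice,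
and the mean value inequality reads `V κ² ≤ κ`. The resulting bound `1 / V` does not depend on `X`.
-/
theorem pullback_diag_coeff_re_le {ψ : Y → X}
    (hψ : IsLocalDiffeomorph 𝓘(ℂ, Fin n → ℂ) 𝓘(ℂ, Fin n → ℂ) ω ψ)
    {e : OpenPartialHomeomorph Y (Fin n → ℂ)} (he : e ∈ holCharts n Y) {a b : Fin n → ℂ} {r : ℝ}
    (h : InjectiveBall ψ e a r) (hb : b ∈ Metric.ball a r) :
    (((bergmanKernel n X).diag.pullback ψ).coeff e b).re ≤ kernelBound n r := by
  set w := ψ (e.symm b) with hw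
  set u := fun i => mfderiv 𝓘(ℂ, Fin n → ℂ) 𝓘(ℂ, Fin n → ℂ) ψ (e.symm b) (coordFrame e b i) with hu
  change (bergmanKernel n X w w u u).re ≤ _
  obtain ⟨s, hs, hsK, hsn⟩ := exists_bergmanKernel_section (n := n) w u
  obtain ⟨κ, hκ0, hκ, -⟩ := exists_bergmanKernel_self (n := n) w u
  have h1 := volume_mul_enorm_coeff_sq_le (hs.1.pullback (hψ.mdifferentiable (by simp))) he h.pos
    h.subset hb
  have hopen : IsOpen (e.symm '' Metric.ball a (2 * r)) :=
    e.symm.isOpen_image_of_subset_source Metric.isOpen_ball h.subset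
  rw [← wedgeConj_pullback, absMeasure_pullback hψ (wedgeConj_isCovariant s s)
    hopen.measurableSet h.injOn] at h1
  have h2 : (s.pullback ψ).coeff e b = κ := (hsK w u).trans hκ
  have h3 := h1.trans (measure_mono (Set.subset_univ _))
  rw [hsn, h2, hκ, Complex.ofReal_re] at h3
  have h4 := ENNReal.toReal_mono ENNReal.ofReal_ne_top h3
  rw [ENNReal.toReal_ofReal hκ0, ENNReal.toReal_mul, ENNReal.toReal_pow, toReal_enorm,
    Complex.norm_real, Real.norm_of_nonneg hκ0] at h4
  rw [hκ, Complex.ofReal_re, kernelBound]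
  have hV : 0 < (volume (Metric.ball (0 : Fin n → ℂ) (r / 2))).toReal :=
    ENNReal.toReal_pos (Metric.measure_ball_pos _ _ (half_pos h.pos)).ne'
      Metric.isBounded_ball.measure_lt_top.ne
  set V := (volume (Metric.ball (0 : Fin n → ℂ) (r / 2))).toReal
  rcases hκ0.eq_or_lt with h0 | h0
  · rw [← h0]; positivity
  · rw [← one_div, le_div_iff₀ hV]
    by_contra hlt
    push Not at hlt
    nlinarith

theorem sum_norm_coeff_le {ψ : Y → X}
    (hψ : IsLocalDiffeomorph 𝓘(ℂ, Fin n → ℂ) 𝓘(ℂ, Fin n → ℂ) ω ψ)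
    {e e' : OpenPartialHomeomorph Y (Fin n → ℂ)} (he : e ∈ holCharts n Y)
    (he' : e' ∈ holCharts n Y) {p q : (Fin n → ℂ) × (Fin n → ℂ)} {r : ℝ}
    (h : InjectiveBall ψ e p.1 r) (h' : InjectiveBall ψ e' (star p.2) r)
    (hq : q ∈ Metric.ball p r) (F : Finset (bergmanBasis n X)) :
    ∑ s ∈ F, ‖(s.1.pullback ψ).coeff e q.1 *
      (starRingEnd ℂ) ((s.1.pullback ψ).coeff e' (star q.2))‖ ≤ kernelBound n r := by
  have hq1 : q.1 ∈ Metric.ball p.1 r := by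
    rw [← ball_prod_same] at hq; exact hq.1
  have hq2 : star q.2 ∈ Metric.ball (star p.2) r := by
    rw [← ball_prod_same] at hq
    have := hq.2
    rw [Metric.mem_ball, dist_eq_norm] at this ⊢
    rwa [← star_sub, norm_star]
  have h1 := sum_norm_mul_norm_le (n := n) (ψ (e.symm q.1)) (ψ (e'.symm (star q.2)))
    (fun i => mfderiv 𝓘(ℂ, Fin n → ℂ) 𝓘(ℂ, Fin n → ℂ) ψ (e.symm q.1) (coordFrame e q.1 i))
    (fun i => mfderiv 𝓘(ℂ, Fin n → ℂ) 𝓘(ℂ, Fin n → ℂ) ψ (e'.symm (star q.2))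
      (coordFrame e' (star q.2) i)) F
  have h2 := pullback_diag_coeff_re_le hψ he h hq1
  have h3 := pullback_diag_coeff_re_le hψ he' h' hq2
  refine h1.trans ?_
  exact (div_le_div_of_nonneg_right (add_le_add h2 h3) zero_le_two).trans (add_self_div_two _).le

theorem norm_polarCoeff_le {ψ : Y → X}
    (hψ : IsLocalDiffeomorph 𝓘(ℂ, Fin n → ℂ) 𝓘(ℂ, Fin n → ℂ) ω ψ)
    {e e' : OpenPartialHomeomorph Y (Fin n → ℂ)} (he : e ∈ holCharts n Y)
    (he' : e' ∈ holCharts n Y) {p q : (Fin n → ℂ) × (Fin n → ℂ)} {r : ℝ}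
    (h : InjectiveBall ψ e p.1 r) (h' : InjectiveBall ψ e' (star p.2) r)
    (hq : q ∈ Metric.ball p r) :
    ‖((bergmanKernel n X).pullback ψ).polarCoeff e e' q‖ ≤ kernelBound n r :=
  le_of_tendsto (hasSum_polarCoeff ψ e e' q).norm (Eventually.of_forall fun F =>
    (norm_sum_le _ _).trans (sum_norm_coeff_le hψ he he' h h' hq F))

/-- The Bergman kernel is holomorphic in the first and antiholomorphic in the second variable. -/
theorem differentiableOn_polarCoeff {ψ : Y → X}
    (hψ : IsLocalDiffeomorph 𝓘(ℂ, Fin n → ℂ) 𝓘(ℂ, Fin n → ℂ) ω ψ)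
    {e e' : OpenPartialHomeomorph Y (Fin n → ℂ)} (he : e ∈ holCharts n Y)
    (he' : e' ∈ holCharts n Y) :
    DifferentiableOn ℂ (((bergmanKernel n X).pullback ψ).polarCoeff e e') (polarDomain e e') := by
  have hterm : ∀ s : bergmanBasis n X, DifferentiableOn ℂ
      (fun q : (Fin n → ℂ) × (Fin n → ℂ) => (s.1.pullback ψ).coeff e q.1 *
        (starRingEnd ℂ) ((s.1.pullback ψ).coeff e' (star q.2))) (polarDomain e e') := by
    intro s q hq
    have : Nonempty X := ⟨ψ (e.symm 0)⟩
    have hs : (s.1.pullback ψ).IsHolomorphic :=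
      (isOrthonormalBasis_bergmanBasis.subset s.2).1.pullback (hψ.mdifferentiable (by simp))
    have h1 : DifferentiableAt ℂ ((s.1.pullback ψ).coeff e) q.1 :=
      (hs e he).differentiableAt (e.open_target.mem_nhds hq.1)
    have h2 : DifferentiableAt ℂ ((s.1.pullback ψ).coeff e') (star q.2) :=
      (hs e' he').differentiableAt (e'.open_target.mem_nhds hq.2)
    -- Conjugating both the argument and the value of a holomorphic function gives a holomorphic
    -- function; this is the reason for the variable `w̄`.
    have h3 := h2.star_star
    rw [star_star] at h3
    exact ((h1.comp q differentiableAt_fst).mul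
      (h3.comp q differentiableAt_snd)).differentiableWithinAt
  have hsum : ∀ F : Finset (bergmanBasis n X), DifferentiableOn ℂ
      (fun q : (Fin n → ℂ) × (Fin n → ℂ) => ∑ s ∈ F, (s.1.pullback ψ).coeff e q.1 *
        (starRingEnd ℂ) ((s.1.pullback ψ).coeff e' (star q.2))) (polarDomain e e') := fun F =>
    DifferentiableOn.fun_sum fun s _ => hterm s
  have hU := isOpen_polarDomain e e'
  have hball : ∀ p ∈ polarDomain e e', ∃ ρ > 0, Metric.ball p ρ ⊆ polarDomain e e' := fun p hp =>
    Metric.isOpen_iff.1 hU p hp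
  -- The finite partial sums are holomorphic and locally bounded, so the pointwise convergent series
  -- converges locally uniformly.
  refine (differentiableOn_and_tendsto_fderiv (l := (atTop : Filter (Finset (bergmanBasis n X))))
    hU (fun p hp => (hball p hp).imp fun ρ hρ =>
      ⟨hρ.1, Eventually.of_forall fun F => (hsum F).mono hρ.2⟩)
    (tendstoLocallyUniformlyOn_of_locallyBounded ?_ hU fun q _ => hasSum_polarCoeff ψ e e' q)).1
  intro p hp
  obtain ⟨r, hr, h, h'⟩ := exists_injectiveBall_prod hψ hp
  obtain ⟨ρ, hρ, hρs⟩ := hball p hp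
  refine ⟨kernelBound n r, min r ρ, lt_min hr hρ, Eventually.of_forall fun F => ⟨(hsum F).mono
    ((Metric.ball_subset_ball (min_le_right _ _)).trans hρs), fun q hq => ?_⟩⟩
  exact (norm_sum_le _ _).trans (sum_norm_coeff_le hψ he he' h h'
    (Metric.ball_subset_ball (min_le_left _ _) hq) F)

end KernelBounds

/-! ### Limits of Bergman kernels -/

section KernelLimits

variable {n : ℕ} {X : Type*} [TopologicalSpace X] [ChartedSpace (Fin n → ℂ) X]
  [IsManifold 𝓘(ℂ, Fin n → ℂ) ω X] [MeasurableSpace X] [BorelSpace X] [SecondCountableTopology X]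

/-- The section `K(·, w)` is the only square integrable form whose square norm is at most `K(w, w)`
and whose value at `w` is `K(w, w)`. -/
theorem eq_bergmanKernel_of_absMeasure_le {g : TopForm n X} (hg : g ∈ bergmanSpace n X) {w : X}
    {u : Fin n → TangentSpace 𝓘(ℂ, Fin n → ℂ) w}
    (hle : (wedgeConj g g).absMeasure Set.univ ≤ ENNReal.ofReal (bergmanKernel n X w w u u).re)
    (hw : g w u = bergmanKernel n X w w u u) (z : X)
    (v : Fin n → TangentSpace 𝓘(ℂ, Fin n → ℂ) z) : g z v = bergmanKernel n X z w v u := by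
  have : Nonempty X := ⟨w⟩
  obtain ⟨D⟩ := nonempty_chartPartition (n := n) (X := X)
  obtain ⟨r, hr, hr'⟩ := exists_bergmanKernel_representer D w u
  obtain ⟨κ, hκ0, hκ, -⟩ := exists_bergmanKernel_self (n := n) w u
  let g' : D.bergmanSubmodule := ⟨g, hg⟩
  have h1 := hr' r
  have h2 := hr' g'
  rw [hr, hκ] at h1
  have h2' : inner ℂ (D.toL2 r) (D.toL2 g') = (κ : ℂ) := h2.trans (hw.trans hκ)
  rw [hκ, Complex.ofReal_re] at hle
  have h3 : ‖D.toL2 r‖ ^ 2 = κ := by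
    rw [← inner_self_eq_norm_sq (𝕜 := ℂ), h1]
    rfl
  have h4 : ‖D.toL2 g'‖ ^ 2 ≤ κ := by
    have h5 := ENNReal.toReal_mono ENNReal.ofReal_ne_top ((D.enorm_toL2_sq g').trans_le hle)
    rwa [ENNReal.toReal_ofReal hκ0, ENNReal.toReal_pow, toReal_enorm] at h5
  -- The square expands to `κ - 2κ + ‖g‖²`, and `‖g‖² ≤ κ`.
  have h6 : ‖D.toL2 r - D.toL2 g'‖ ^ 2 ≤ 0 := by
    rw [norm_sub_sq (𝕜 := ℂ), h2', h3]
    have : RCLike.re (κ : ℂ) = κ := Complex.ofReal_re κ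
    rw [this]
    linarith
  have h7 : D.toL2 r = D.toL2 g' := by
    rw [← sub_eq_zero, ← norm_eq_zero]
    nlinarith [norm_nonneg (D.toL2 r - D.toL2 g')]
  have h8 : r = g' := D.toL2_injective h7
  rw [← hr z v, h8]

variable {ι : Type*} {l : Filter ι} [l.NeBot] {Xs : ι → Type*} [∀ j, TopologicalSpace (Xs j)]
  [∀ j, ChartedSpace (Fin n → ℂ) (Xs j)] [∀ j, IsManifold 𝓘(ℂ, Fin n → ℂ) ω (Xs j)]
  [∀ j, MeasurableSpace (Xs j)] [∀ j, BorelSpace (Xs j)] [∀ j, SecondCountableTopology (Xs j)]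
  {ψ : ∀ j, X → Xs j} {L : DoubleForm n X}

/-- A pointwise limit of pull-backs of Bergman kernels is a locally uniform limit. -/
theorem tendstoLocallyUniformlyOn_polarCoeff {Z : Type*} [TopologicalSpace Z]
    [ChartedSpace (Fin n → ℂ) Z] {χ : X → Z}
    (hχ : IsLocalDiffeomorph 𝓘(ℂ, Fin n → ℂ) 𝓘(ℂ, Fin n → ℂ) ω χ)
    (hψ : ∀ j, IsLocalDiffeomorph 𝓘(ℂ, Fin n → ℂ) 𝓘(ℂ, Fin n → ℂ) ω (ψ j))
    {φ : ∀ j, Xs j → Z} (hcomp : ∀ j, χ = φ j ∘ ψ j)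
    (hL : ∀ z w v u, Tendsto (fun j => (bergmanKernel n (Xs j)).pullback (ψ j) z w v u) l
      (𝓝 (L z w v u)))
    {e e' : OpenPartialHomeomorph X (Fin n → ℂ)} (he : e ∈ holCharts n X)
    (he' : e' ∈ holCharts n X) :
    TendstoLocallyUniformlyOn
      (fun j => ((bergmanKernel n (Xs j)).pullback (ψ j)).polarCoeff e e') (L.polarCoeff e e') l
      (polarDomain e e') := by
  have hU := isOpen_polarDomain e e'
  refine tendstoLocallyUniformlyOn_of_locallyBounded ?_ hU fun q _ => hL _ _ _ _
  intro p hp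
  obtain ⟨r, hr, h, h'⟩ := exists_injectiveBall_prod hχ hp
  obtain ⟨ρ, hρ, hρs⟩ := Metric.isOpen_iff.1 hU p hp
  refine ⟨kernelBound n r, min r ρ, lt_min hr hρ, Eventually.of_forall fun j =>
    ⟨(differentiableOn_polarCoeff (hψ j) he he').mono
      ((Metric.ball_subset_ball (min_le_right _ _)).trans hρs), fun q hq => ?_⟩⟩
  rw [hcomp j] at h h'
  exact norm_polarCoeff_le (hψ j) he he' h.of_comp h'.of_comp
    (Metric.ball_subset_ball (min_le_left _ _) hq)

theorem differentiableOn_polarCoeff_of_tendsto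
    (hψ : ∀ j, IsLocalDiffeomorph 𝓘(ℂ, Fin n → ℂ) 𝓘(ℂ, Fin n → ℂ) ω (ψ j))
    {e e' : OpenPartialHomeomorph X (Fin n → ℂ)} (he : e ∈ holCharts n X)
    (he' : e' ∈ holCharts n X) (h : TendstoLocallyUniformlyOn
      (fun j => ((bergmanKernel n (Xs j)).pullback (ψ j)).polarCoeff e e') (L.polarCoeff e e') l
      (polarDomain e e')) : DifferentiableOn ℂ (L.polarCoeff e e') (polarDomain e e') := by
  have hU := isOpen_polarDomain e e'
  exact (differentiableOn_and_tendsto_fderiv hU (fun p hp => (Metric.isOpen_iff.1 hU p hp).imp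
    fun ρ hρ => ⟨hρ.1, Eventually.of_forall fun j =>
      (differentiableOn_polarCoeff (hψ j) he he').mono hρ.2⟩) h).1

/-- A pointwise limit of pull-backs of Bergman kernels under maps which are eventually injective on
compact sets has square integrable sections. -/
theorem exists_section_of_tendsto
    (hψ : ∀ j, IsLocalDiffeomorph 𝓘(ℂ, Fin n → ℂ) 𝓘(ℂ, Fin n → ℂ) ω (ψ j)) [T2Space X]
    (hinj : ∀ Q, IsCompact Q → ∀ᶠ j in l, Set.InjOn (ψ j) Q)
    (hL : ∀ z w v u, Tendsto (fun j => (bergmanKernel n (Xs j)).pullback (ψ j) z w v u) l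
      (𝓝 (L z w v u))) (w : X) (u : Fin n → TangentSpace 𝓘(ℂ, Fin n → ℂ) w) :
    ∃ g ∈ bergmanSpace n X, (∀ z v, g z v = L z w v u) ∧ ∃ c : ℝ, 0 ≤ c ∧ L w w u u = c ∧
      (wedgeConj g g).absMeasure Set.univ ≤ ENNReal.ofReal c := by
  let u' : ∀ j, Fin n → TangentSpace 𝓘(ℂ, Fin n → ℂ) (ψ j w) := fun j i =>
    mfderiv 𝓘(ℂ, Fin n → ℂ) 𝓘(ℂ, Fin n → ℂ) (ψ j) w (u i)
  have hs := fun j => exists_bergmanKernel_section (n := n) (ψ j w) (u' j)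
  have hk := fun j => exists_bergmanKernel_self (n := n) (ψ j w) (u' j)
  choose s hs hsK hsn using hs
  choose κ hκ0 hκ _ using hk
  have hf : ∀ j z v, (s j).pullback (ψ j) z v = (bergmanKernel n (Xs j)).pullback (ψ j) z w v u :=
    fun j z v => hsK j _ _
  obtain ⟨g, hg⟩ := exists_tendsto_topForm (l := l) (f := fun j => (s j).pullback (ψ j))
    fun z v => ⟨L z w v u, (hL z w v u).congr fun j => (hf j z v).symm⟩
  have hgL : ∀ z v, g z v = L z w v u := fun z v =>
    tendsto_nhds_unique (hg z v) ((hL z w v u).congr fun j => (hf j z v).symm)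
  have hκL : Tendsto (fun j => (κ j : ℂ)) l (𝓝 (L w w u u)) :=
    (hL w w u u).congr fun j => hκ j
  have hκr : Tendsto κ l (𝓝 (L w w u u).re) :=
    (Complex.continuous_re.tendsto _).comp hκL
  have hreal : L w w u u = ((L w w u u).re : ℂ) :=
    tendsto_nhds_unique hκL ((Complex.continuous_ofReal.tendsto _).comp hκr)
  have hc0 : 0 ≤ (L w w u u).re := ge_of_tendsto hκr (Eventually.of_forall hκ0)
  -- Once `ψ j` is injective on `Q`, the mass of the pulled back section over `Q` is at most the
  -- total mass `κ j` on `Xs j`. As `κ j` only tends to `L(w, w)`, a margin `ε` is needed and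
  -- removed afterwards.
  have hbound : ∀ ε > 0, g.IsHolomorphic ∧
      (wedgeConj g g).absMeasure Set.univ ≤ ENNReal.ofReal ((L w w u u).re + ε) := by
    intro ε hε
    refine isHolomorphic_and_absMeasure_le_of_tendsto (l := l) ENNReal.ofReal_ne_top
      (fun j => (hs j).1.pullback ((hψ j).mdifferentiable (by simp))) (fun Q hQ => ?_) hg
    filter_upwards [hinj Q hQ, hκr.eventually_le_const (lt_add_of_pos_right _ hε)] with j hj hjκ
    rw [← wedgeConj_pullback, absMeasure_pullback (hψ j) (wedgeConj_isCovariant _ _)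
      hQ.measurableSet hj]
    refine (measure_mono (Set.subset_univ _)).trans ?_
    rw [hsn, hκ, Complex.ofReal_re]
    exact ENNReal.ofReal_le_ofReal hjκ
  have hle : (wedgeConj g g).absMeasure Set.univ ≤ ENNReal.ofReal (L w w u u).re := by
    have hlim : Tendsto (fun ε : ℝ => ENNReal.ofReal ((L w w u u).re + ε)) (𝓝[>] 0)
        (𝓝 (ENNReal.ofReal ((L w w u u).re + 0))) :=
      ((ENNReal.continuous_ofReal.comp (continuous_const.add continuous_id)).tendsto 0).mono_left
        nhdsWithin_le_nhds
    rw [add_zero] at hlim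
    exact ge_of_tendsto hlim (eventually_nhdsWithin_of_forall fun ε hε => (hbound ε hε).2)
  exact ⟨g, ⟨(hbound 1 one_pos).1, hle.trans_lt ENNReal.ofReal_lt_top⟩, hgL, _, hc0, hreal, hle⟩

end KernelLimits

/-! ### The mass of an `(n,n)`-form -/

section Mass

variable {n : ℕ} {X : Type*} [TopologicalSpace X] [ChartedSpace (Fin n → ℂ) X]

/-- The values of an `(n,n)`-form are nonnegative real numbers. -/
def VolForm.IsNonneg (η : VolForm n X) : Prop :=
  ∀ x v, ∃ κ : ℝ, 0 ≤ κ ∧ η x v = κ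

theorem VolForm.exists_apply_eq_pullback {Y : Type*} [TopologicalSpace Y]
    [ChartedSpace (Fin n → ℂ) Y] {φ : Y → X} (hs : Function.Surjective φ)
    (hφ : IsLocalDiffeomorph 𝓘(ℂ, Fin n → ℂ) 𝓘(ℂ, Fin n → ℂ) ω φ) (x : X)
    (v : Fin n → TangentSpace 𝓘(ℂ, Fin n → ℂ) x) :
    ∃ y u, ∀ ξ : VolForm n X, ξ.pullback φ y u = ξ x v := by
  obtain ⟨y, rfl⟩ := hs x
  let L := hφ.mfderivToContinuousLinearEquiv (by simp) y
  exact ⟨y, fun i => L.symm (v i), fun ξ =>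
    congrArg (ξ (φ y)) (funext fun i => L.apply_symm_apply (v i))⟩

theorem VolForm.isNonneg_of_pullback {Y : Type*} [TopologicalSpace Y] [ChartedSpace (Fin n → ℂ) Y]
    {φ : Y → X} (hs : Function.Surjective φ)
    (hφ : IsLocalDiffeomorph 𝓘(ℂ, Fin n → ℂ) 𝓘(ℂ, Fin n → ℂ) ω φ) {ξ : VolForm n X}
    (h : (ξ.pullback φ).IsNonneg) : ξ.IsNonneg := by
  intro x v
  obtain ⟨y, u, hyu⟩ := VolForm.exists_apply_eq_pullback hs hφ x v
  rw [← hyu ξ]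
  exact h y u

/-- Pointwise convergence of pull-backs under a surjective local biholomorphism descends. -/
theorem VolForm.exists_tendsto_of_pullback {Y : Type*} [TopologicalSpace Y]
    [ChartedSpace (Fin n → ℂ) Y] {φ : Y → X} (hs : Function.Surjective φ)
    (hφ : IsLocalDiffeomorph 𝓘(ℂ, Fin n → ℂ) 𝓘(ℂ, Fin n → ℂ) ω φ) {ι : Type*} {l : Filter ι}
    [l.NeBot] {ξ : ι → VolForm n X} {ρ : VolForm n Y}
    (h : ∀ y v, Tendsto (fun i => (ξ i).pullback φ y v) l (𝓝 (ρ y v))) :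
    ∃ η : VolForm n X, η.pullback φ = ρ := by
  have hex : ∀ x (v : Fin n → TangentSpace 𝓘(ℂ, Fin n → ℂ) x), ∃ c : ℂ,
      Tendsto (fun i => ξ i x v) l (𝓝 c) := by
    intro x v
    obtain ⟨y, u, hyu⟩ := VolForm.exists_apply_eq_pullback hs hφ x v
    exact ⟨_, (h y u).congr fun i => hyu (ξ i)⟩
  choose η hη using hex
  refine ⟨η, ?_⟩
  funext y v
  exact tendsto_nhds_unique (hη _ _) (h y v)

/-- A chart of the base of a local biholomorphism which is covered by a chart of the total space. -/
theorem exists_chart_pair {Y : Type*} [TopologicalSpace Y] [ChartedSpace (Fin n → ℂ) Y]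
    [IsManifold 𝓘(ℂ, Fin n → ℂ) ω Y] [IsManifold 𝓘(ℂ, Fin n → ℂ) ω X] {φ : Y → X}
    (hφ : IsLocalDiffeomorph 𝓘(ℂ, Fin n → ℂ) 𝓘(ℂ, Fin n → ℂ) ω φ) (y : Y) :
    ∃ e ∈ holCharts n X, ∃ c ∈ holCharts n Y, φ y ∈ e.source ∧ e.target ⊆ c.target ∧
      ∀ η : VolForm n X, Set.EqOn ((η.pullback φ).coeff c) (η.coeff e) e.target := by
  set e₀ := chartAt (Fin n → ℂ) (φ y) with he₀
  have he₀m : e₀ ∈ holCharts n X := IsManifold.chart_mem_maximalAtlas _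
  obtain ⟨c, hc, hyc, hce⟩ := exists_chart_comp hφ he₀m (mem_chart_source (Fin n → ℂ) (φ y))
  have hop : IsOpen (φ '' c.source) := hφ.isLocalHomeomorph.isOpenMap _ c.open_source
  have hes : (e₀.restr (φ '' c.source)).source = e₀.source ∩ φ '' c.source := by
    rw [e₀.restr_source, hop.interior_eq]
  have hsub : (e₀.restr (φ '' c.source)).target ⊆ c.target := by
    intro a ha
    have h1 := (e₀.restr (φ '' c.source)).map_target ha
    have h2 : e₀ ((e₀.restr (φ '' c.source)).symm a) = a :=
      (e₀.restr (φ '' c.source)).right_inv ha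
    rw [hes] at h1
    obtain ⟨-, x, hx, hxa⟩ := h1
    rw [← hxa, ← (hce x hx).2] at h2
    rw [← h2]
    exact c.map_source hx
  refine ⟨e₀.restr (φ '' c.source), ?_, c, hc, ?_, hsub, fun η a ha => ?_⟩
  · exact restr_mem_maximalAtlas _ he₀m hop
  · rw [hes]
    exact ⟨mem_chart_source (Fin n → ℂ) (φ y), y, hyc, rfl⟩
  · refine η.pullback_coeff_of_chart (hφ.mdifferentiable (by simp)) hc (fun x hx => ?_) (hsub ha)
    rw [hes]
    exact ⟨⟨(hce x hx).1, x, hx, rfl⟩, (hce x hx).2⟩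

variable [MeasurableSpace X] [BorelSpace X] [IsManifold 𝓘(ℂ, Fin n → ℂ) ω X]
  {e : X → OpenPartialHomeomorph X (Fin n → ℂ)}

section SecondCountable

variable [SecondCountableTopology X]

-- Without cancellation the integral is a fixed nonzero constant times the mass, so the hypothesis
-- on integrals can be read as one on measures.
omit [IsManifold 𝓘(ℂ, Fin n → ℂ) ω X] in
theorem VolForm.IsNonneg.integral_eq {η : VolForm n X} (h0 : η.IsNonneg) (hη : η.IsCovariant)
    (he : ∀ x, e x ∈ holCharts n X) (hxe : ∀ x, x ∈ (e x).source)
    (hc : ∀ x, ContinuousOn (η.coeff (e x)) (e x).target) :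
    η.integral = (2 : ℂ) ^ n * (Complex.I⁻¹) ^ (n ^ 2) * (η.absMeasure Set.univ).toReal := by
  rcases isEmpty_or_nonempty X with hX | hX
  · simp [VolForm.integral, Set.eq_empty_of_isEmpty (Set.univ : Set X),
      Measure.eq_zero_of_isEmpty]
  obtain ⟨D, -, hD⟩ := exists_chartPartition e he hxe (fun _ => Set.univ) (fun _ => univ_mem)
  have hm : Measurable fun x => η x (D.frame x) := D.measurable_volForm_frame fun k => by
    obtain ⟨x, hx, -⟩ := hD k
    rw [hx]
    exact hc x
  have hre : ∀ x, η x (D.frame x) = ((η x (D.frame x)).re : ℂ) ∧ 0 ≤ (η x (D.frame x)).re := by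
    intro x
    obtain ⟨κ, hκ0, hκ⟩ := h0 x (D.frame x)
    rw [hκ, Complex.ofReal_re]
    exact ⟨rfl, hκ0⟩
  rw [VolForm.integral, D.integral_phase hη hm, D.absMeasure_eq_withDensity hη hm,
    withDensity_apply _ MeasurableSet.univ, Measure.restrict_univ]
  congr 1
  rw [integral_congr_ae (Eventually.of_forall fun x => (hre x).1), integral_complex_ofReal,
    integral_eq_lintegral_of_nonneg_ae (Eventually.of_forall fun x => (hre x).2)
      (Complex.measurable_re.comp hm).aestronglyMeasurable]
  congr 2
  refine lintegral_congr fun x => ?_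
  conv_rhs => rw [(hre x).1]
  rw [← ofReal_norm, Complex.norm_real, Real.norm_of_nonneg (hre x).2]

omit [IsManifold 𝓘(ℂ, Fin n → ℂ) ω X] in
theorem VolForm.IsCovariant.absMeasure_mono {η ξ : VolForm n X} (hη : η.IsCovariant)
    (hξ : ξ.IsCovariant) (he : ∀ x, e x ∈ holCharts n X) (hxe : ∀ x, x ∈ (e x).source)
    (hηc : ∀ x, ContinuousOn (η.coeff (e x)) (e x).target)
    (hξc : ∀ x, ContinuousOn (ξ.coeff (e x)) (e x).target) (hle : ∀ x v, ‖η x v‖ ≤ ‖ξ x v‖) :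
    η.absMeasure ≤ ξ.absMeasure := by
  rcases isEmpty_or_nonempty X with hX | hX
  · rw [Measure.eq_zero_of_isEmpty η.absMeasure]
    exact Measure.zero_le _
  obtain ⟨D, -, hD⟩ := exists_chartPartition e he hxe (fun _ => Set.univ) (fun _ => univ_mem)
  have hm : ∀ ρ : VolForm n X, (∀ x, ContinuousOn (ρ.coeff (e x)) (e x).target) →
      Measurable fun x => ρ x (D.frame x) := fun ρ hρ => D.measurable_volForm_frame fun k => by
    obtain ⟨x, hx, -⟩ := hD k
    rw [hx]
    exact hρ x
  rw [D.absMeasure_eq_withDensity hη (hm η hηc), D.absMeasure_eq_withDensity hξ (hm ξ hξc)]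
  exact withDensity_mono (Eventually.of_forall fun x => enorm_le_iff_norm_le.2 (hle _ _))

/-- Two comparable continuous forms with the same finite mass are equal. -/
theorem VolForm.eq_of_le_of_absMeasure_eq {η ξ : VolForm n X} (hη : η.IsCovariant)
    (hξ : ξ.IsCovariant) (he : ∀ x, e x ∈ holCharts n X) (hxe : ∀ x, x ∈ (e x).source)
    (hηc : ∀ x, ContinuousOn (η.coeff (e x)) (e x).target)
    (hξc : ∀ x, ContinuousOn (ξ.coeff (e x)) (e x).target) (hη0 : η.IsNonneg) (hξ0 : ξ.IsNonneg)
    (hle : ∀ x v, ‖η x v‖ ≤ ‖ξ x v‖) (hfin : η.absMeasure Set.univ ≠ ⊤)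
    (heq : ξ.absMeasure Set.univ ≤ η.absMeasure Set.univ) : η = ξ := by
  have hmono := hη.absMeasure_mono hξ he hxe hηc hξc hle
  have hset : ∀ A : Set X, MeasurableSet A → ξ.absMeasure A ≤ η.absMeasure A := by
    intro A hA
    -- Since `η` is the smaller form, a deficit on `A` could not be made up on the complement.
    have h1 : ξ.absMeasure A + ξ.absMeasure Aᶜ ≤ η.absMeasure A + ξ.absMeasure Aᶜ := by
      rw [measure_add_measure_compl hA]
      refine heq.trans ?_
      rw [← measure_add_measure_compl hA]
      gcongr
    refine (ENNReal.add_le_add_iff_right ?_).1 h1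
    exact ((measure_mono (Set.subset_univ _)).trans heq |>.trans_lt hfin.lt_top).ne
  have hcoeff : ∀ x, Set.EqOn (fun a => ‖η.coeff (e x) a‖) (fun a => ‖ξ.coeff (e x) a‖)
      (e x).target := by
    intro x
    have hsrc := (e x).open_source.measurableSet
    have h1 := hset _ hsrc
    have h2 : η.absMeasure (e x).source ≠ ⊤ :=
      ((measure_mono (Set.subset_univ _)).trans_lt hfin.lt_top).ne
    rw [hη.absMeasure_eq_lintegral (he x) hsrc subset_rfl] at h1 h2
    rw [hξ.absMeasure_eq_lintegral (he x) hsrc subset_rfl] at h1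
    have h3 : (e x).target ∩ (e x).symm ⁻¹' (e x).source = (e x).target :=
      Set.inter_eq_left.2 fun a ha => (e x).map_target ha
    rw [h3] at h1 h2
    -- Comparable densities with equal finite integrals agree almost everywhere, and by continuity
    -- everywhere on the target.
    have h4 := ae_eq_of_ae_le_of_lintegral_le (Eventually.of_forall fun a =>
      enorm_le_iff_norm_le.2 (hle _ _)) h2
      ((hξc x).aestronglyMeasurable (e x).open_target.measurableSet).enorm h1
    refine Measure.eqOn_open_of_ae_eq (μ := volume) ?_ (e x).open_target (hηc x).norm (hξc x).norm
    filter_upwards [h4] with a ha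
    rw [← toReal_enorm, ← toReal_enorm]
    exact congrArg ENNReal.toReal ha
  funext x v
  obtain ⟨c, -, hc⟩ := VolForm.IsCovariant.exists_apply_eq_mul_coeff (he x) (hxe x) v
  rw [hc η hη, hc ξ hξ]
  obtain ⟨s, hs0, hs⟩ := hη0 _ (coordFrame (e x) (e x x))
  obtain ⟨t, ht0, ht⟩ := hξ0 _ (coordFrame (e x) (e x x))
  have h := hcoeff x ((e x).map_source (hxe x))
  change η.coeff _ _ = _ at hs
  change ξ.coeff _ _ = _ at ht
  dsimp only at h
  rw [hs, ht, Complex.norm_real, Complex.norm_real, Real.norm_of_nonneg hs0,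
    Real.norm_of_nonneg ht0] at h
  rw [hs, ht, h]

end SecondCountable

/-- On a compact manifold the mass is continuous under locally uniform convergence. -/
theorem tendsto_absMeasure_univ [CompactSpace X] [SecondCountableTopology X] {ι : Type*}
    {l : Filter ι} {η : ι → VolForm n X}
    {ξ : VolForm n X} (hη : ∀ i, (η i).IsCovariant) (hξ : ξ.IsCovariant)
    (he : ∀ x, e x ∈ holCharts n X) (hxe : ∀ x, x ∈ (e x).source)
    (h : ∀ x, TendstoLocallyUniformlyOn (fun i => (η i).coeff (e x)) (ξ.coeff (e x)) l (e x).target)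
    (hc : ∀ x, ContinuousOn (ξ.coeff (e x)) (e x).target) :
    Tendsto (fun i => (η i).absMeasure Set.univ) l (𝓝 (ξ.absMeasure Set.univ)) ∧
      ξ.absMeasure Set.univ ≠ ⊤ := by
  rcases isEmpty_or_nonempty X with hX | hX
  · simp [Set.eq_empty_of_isEmpty (Set.univ : Set X), tendsto_const_nhds]
  obtain ⟨D, hDo, hD⟩ := exists_chartPartition_isCompact e he hxe
  obtain ⟨N, hN⟩ := D.exists_biUnion_range_eq_univ hDo
  have hsum : ∀ ρ : VolForm n X, ρ.absMeasure Set.univ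
      = ∑ k ∈ Finset.range N, ρ.absMeasure (D.piece k) := by
    intro ρ
    rw [← hN]
    exact measure_biUnion_finset (fun j _ k _ hjk => D.disjoint hjk)
      fun k _ => D.measurableSet_piece k
  have hk : ∀ k, Tendsto (fun i => (η i).absMeasure (D.piece k)) l
      (𝓝 (ξ.absMeasure (D.piece k))) ∧ ξ.absMeasure (D.piece k) ≠ ⊤ := by
    intro k
    obtain ⟨x, hx, K, hK, hKt, hKp⟩ := hD k
    refine volForm_absMeasure_tendsto hη hξ (D.chart_mem k) ?_ ?_ (D.measurableSet_piece k) hK hKt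
      hKp
    · rw [hx]; exact h x
    · rw [hx]; exact hc x
  simp only [hsum]
  exact ⟨tendsto_finsetSum _ fun k _ => (hk k).1, ENNReal.sum_ne_top.2 fun k _ => (hk k).2⟩

end Mass

/-! ### Towers -/

section Tower

variable {n : ℕ}

theorem norm_bergmanKernel_le {X : Type*} [TopologicalSpace X] [ChartedSpace (Fin n → ℂ) X]
    [IsManifold 𝓘(ℂ, Fin n → ℂ) ω X] [MeasurableSpace X] [BorelSpace X]
    [SecondCountableTopology X] (z w : X) (v : Fin n → TangentSpace 𝓘(ℂ, Fin n → ℂ) z)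
    (u : Fin n → TangentSpace 𝓘(ℂ, Fin n → ℂ) w) : ‖bergmanKernel n X z w v u‖
      ≤ ((bergmanKernel n X z z v v).re + (bergmanKernel n X w w u u).re) / 2 :=
  le_of_tendsto (hasSum_bergmanKernel z w v u).norm (Eventually.of_forall fun F =>
    (norm_sum_le _ _).trans (sum_norm_mul_norm_le z w v u F))

theorem isNonneg_diag_bergmanKernel {X : Type*} [TopologicalSpace X] [ChartedSpace (Fin n → ℂ) X]
    [IsManifold 𝓘(ℂ, Fin n → ℂ) ω X] [MeasurableSpace X] [BorelSpace X]
    [SecondCountableTopology X] : (bergmanKernel n X).diag.IsNonneg := fun x v =>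
  let ⟨κ, h0, hκ, _⟩ := exists_bergmanKernel_self (n := n) x v
  ⟨κ, h0, hκ⟩

theorem DoubleForm.pullback_id {X : Type*} [TopologicalSpace X] [ChartedSpace (Fin n → ℂ) X]
    (K : DoubleForm n X) : K.pullback id = K := by
  funext z w v u
  have h : ∀ x : X, ∀ v : Fin n → TangentSpace 𝓘(ℂ, Fin n → ℂ) x, (fun i =>
      mfderiv 𝓘(ℂ, Fin n → ℂ) 𝓘(ℂ, Fin n → ℂ) (id : X → X) x (v i)) = v := fun x v =>
    funext fun i => DFunLike.congr_fun mfderiv_id (v i)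
  exact (congrArg (fun t => K z w t _) (h z v)).trans (congrArg (K z w v) (h w u))

/-! ### Restriction to the diagonal in polarised coordinates -/

section Diagonal

variable {X : Type*} [TopologicalSpace X] [ChartedSpace (Fin n → ℂ) X] {L : DoubleForm n X}
  {c : OpenPartialHomeomorph X (Fin n → ℂ)}

omit [ChartedSpace (Fin n → ℂ) X] in
theorem continuous_diagonal : Continuous fun a : Fin n → ℂ => (a, star a) :=
  continuous_id.prodMk continuous_star

omit [ChartedSpace (Fin n → ℂ) X] in
theorem mapsTo_diagonal :
    Set.MapsTo (fun a : Fin n → ℂ => (a, star a)) c.target (polarDomain c c) := fun a ha =>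
  ⟨ha, by rw [star_star]; exact ha⟩

theorem diag_coeff_eq (L : DoubleForm n X) (c : OpenPartialHomeomorph X (Fin n → ℂ)) :
    L.diag.coeff c = L.polarCoeff c c ∘ fun a => (a, star a) := by
  funext a
  change L.coeff c c (a, a) = L.coeff c c (a, star (star a))
  rw [star_star]

theorem continuousOn_diag_coeff (h : DifferentiableOn ℂ (L.polarCoeff c c) (polarDomain c c)) :
    ContinuousOn (L.diag.coeff c) c.target := by
  rw [diag_coeff_eq]
  exact h.continuousOn.comp continuous_diagonal.continuousOn mapsTo_diagonal

theorem tendstoLocallyUniformlyOn_diag_coeff {ι : Type*} {l : Filter ι} {K : ι → DoubleForm n X}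
    (h : TendstoLocallyUniformlyOn (fun j => (K j).polarCoeff c c) (L.polarCoeff c c) l
      (polarDomain c c)) :
    TendstoLocallyUniformlyOn (fun j => (K j).diag.coeff c) (L.diag.coeff c) l c.target := by
  simp only [diag_coeff_eq]
  exact h.comp _ mapsTo_diagonal continuous_diagonal.continuousOn

end Diagonal

/-! ### From `(z, w̄)` back to `(z, w)` -/

section Polarization

/-- Complex conjugation of the second variable. -/
noncomputable def conjSnd (n : ℕ) :
    ((Fin n → ℂ) × (Fin n → ℂ)) ≃L[ℝ] ((Fin n → ℂ) × (Fin n → ℂ)) :=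
  (ContinuousLinearEquiv.refl ℝ (Fin n → ℂ)).prodCongr (starL' ℝ)

theorem conjSnd_apply (p : (Fin n → ℂ) × (Fin n → ℂ)) : conjSnd n p = (p.1, star p.2) := rfl

variable {X : Type*} [TopologicalSpace X] [ChartedSpace (Fin n → ℂ) X]
  {e e' : OpenPartialHomeomorph X (Fin n → ℂ)}

omit [ChartedSpace (Fin n → ℂ) X] in
theorem mapsTo_conjSnd :
    Set.MapsTo (conjSnd n) (e.target ×ˢ e'.target) (polarDomain e e') := fun p hp =>
  ⟨hp.1, by rw [conjSnd_apply, star_star]; exact hp.2⟩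

theorem coeff_eq_polarCoeff_comp (K : DoubleForm n X)
    (e e' : OpenPartialHomeomorph X (Fin n → ℂ)) :
    K.coeff e e' = K.polarCoeff e e' ∘ conjSnd n := by
  funext p
  change K.coeff e e' p = K.coeff e e' (p.1, star (star p.2))
  rw [star_star]

theorem contDiffOn_coeff {K : DoubleForm n X}
    (h : DifferentiableOn ℂ (K.polarCoeff e e') (polarDomain e e')) :
    ContDiffOn ℝ ∞ (K.coeff e e') (e.target ×ˢ e'.target) := by
  rw [coeff_eq_polarCoeff_comp]
  exact (contDiffOn_of_differentiableOn (isOpen_polarDomain e e') h).comp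
    (conjSnd n).contDiff.contDiffOn mapsTo_conjSnd

/-- Conjugation of the second variable is a real linear equivalence, so it acts on `m`-th
derivatives by one fixed continuous linear map, which preserves locally uniform convergence. -/
theorem iteratedFDeriv_coeff (K : DoubleForm n X) (m : ℕ) :
    iteratedFDeriv ℝ m (K.coeff e e') = fun p =>
      ContinuousMultilinearMap.compContinuousLinearMapL (fun _ =>
        (conjSnd n : (Fin n → ℂ) × (Fin n → ℂ) →L[ℝ] (Fin n → ℂ) × (Fin n → ℂ)))
        (iteratedFDeriv ℝ m (K.polarCoeff e e') (conjSnd n p)) := by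
  funext p
  have h := (conjSnd n).iteratedFDerivWithin_comp_right (K.polarCoeff e e') uniqueDiffOn_univ
    (x := p) (Set.mem_univ _) m
  rw [Set.preimage_univ, iteratedFDerivWithin_univ, iteratedFDerivWithin_univ] at h
  rw [coeff_eq_polarCoeff_comp]
  exact h

theorem tendstoLocallyUniformlyOn_iteratedFDeriv_coeff {ι : Type*} {l : Filter ι} [l.NeBot]
    {K : ι → DoubleForm n X} {L : DoubleForm n X}
    (hK : ∀ j, DifferentiableOn ℂ ((K j).polarCoeff e e') (polarDomain e e'))
    (h : TendstoLocallyUniformlyOn (fun j => (K j).polarCoeff e e') (L.polarCoeff e e') l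
      (polarDomain e e')) (m : ℕ) :
    TendstoLocallyUniformlyOn (fun j => iteratedFDeriv ℝ m ((K j).coeff e e'))
      (iteratedFDeriv ℝ m (L.coeff e e')) l (e.target ×ˢ e'.target) := by
  have h1 := (tendstoLocallyUniformlyOn_iteratedFDeriv (isOpen_polarDomain e e') hK h m).comp
    (conjSnd n) mapsTo_conjSnd (conjSnd n).continuous.continuousOn
  simp only [iteratedFDeriv_coeff]
  exact (ContinuousLinearMap.uniformContinuous (ContinuousMultilinearMap.compContinuousLinearMapL
    (F := ℂ) (fun _ : Fin m => (conjSnd n :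
      (Fin n → ℂ) × (Fin n → ℂ) →L[ℝ] (Fin n → ℂ) × (Fin n → ℂ))))).comp_tendstoLocallyUniformlyOn
        h1

end Polarization

variable {X : Type*} [TopologicalSpace X] [ChartedSpace (Fin n → ℂ) X]
  [IsManifold 𝓘(ℂ, Fin n → ℂ) ω X] [CompactSpace X] [ConnectedSpace X]
  [MeasurableSpace X] [BorelSpace X]
  {Xs : ℕ → Type*} [∀ j, TopologicalSpace (Xs j)] [∀ j, ChartedSpace (Fin n → ℂ) (Xs j)]
  [∀ j, IsManifold 𝓘(ℂ, Fin n → ℂ) ω (Xs j)] [∀ j, T2Space (Xs j)]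
  [∀ j, SecondCountableTopology (Xs j)]
  [∀ j, MeasurableSpace (Xs j)] [∀ j, BorelSpace (Xs j)]
  {Xt : Type*} [TopologicalSpace Xt] [ChartedSpace (Fin n → ℂ) Xt]
  [IsManifold 𝓘(ℂ, Fin n → ℂ) ω Xt] [T2Space Xt] [SecondCountableTopology Xt]
  [ConnectedSpace Xt] [MeasurableSpace Xt] [BorelSpace Xt]
  {φ : ∀ j, C(Xs j, X)} {φt : C(Xt, X)} {ψ : ∀ j, C(Xt, Xs j)}

/-- A limit point of the pulled back Bergman kernels of the tower is the Bergman kernel of the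
limit, if the integrals over the base converge. -/
theorem eq_bergmanKernel_of_tendsto (hφ : IsTower n φ) (hconv : TowerConvergesTo n φ φt)
    (hψ : ∀ j, IsHolomorphicCovering n (ψ j)) (hcomp : ∀ j, φt = (φ j).comp (ψ j))
    (hint : Tendsto (fun j => ((bergmanKernel n (Xs j)).diag.pushforward (φ j)).integral) atTop
      (𝓝 ((bergmanKernel n Xt).diag.pushforward φt).integral))
    {l : Filter ℕ} [l.NeBot] (hl : l ≤ atTop) {L : DoubleForm n Xt}
    (hL : ∀ z w v u, Tendsto (fun j => (bergmanKernel n (Xs j)).pullback (ψ j) z w v u) l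
      (𝓝 (L z w v u))) : L = bergmanKernel n Xt := by
  have : LocallyPathConnectedSpace Xt := ChartedSpace.locallyPathConnectedSpace (Fin n → ℂ) Xt
  have : PathConnectedSpace Xt := pathConnectedSpace_iff_connectedSpace.2 inferInstance
  have : SecondCountableTopology X := ChartedSpace.secondCountable_of_sigmaCompact (Fin n → ℂ) X
  have hχ := hconv.galois.isLocalBiholomorphism
  have hs : Function.Surjective φt := surjective_of_isCoveringMap hconv.galois.isCoveringMap
  have hψ' := fun j => (hψ j).isLocalBiholomorphism
  have hcomp' : ∀ j, (φt : Xt → X) = φ j ∘ ψ j := fun j => by rw [hcomp j]; rfl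
  have hsec := exists_section_of_tendsto hψ'
    (fun Q hQ => hl (eventually_injOn_of_isCompact hφ hconv hψ hcomp hQ)) hL
  -- The extremal property of the kernel, applied to the section `L(·, w)` of square norm at most
  -- `c`, gives `c² ≤ c κ`.
  have hLd : ∀ w u, ∃ c : ℝ, 0 ≤ c ∧ L w w u u = c ∧ c ≤ (bergmanKernel n Xt w w u u).re := by
    intro w u
    obtain ⟨g, hg, hgL, c, hc0, hc, hgc⟩ := hsec w u
    refine ⟨c, hc0, hc, ?_⟩
    have h1 := norm_apply_sq_le_absMeasure_mul hg w u
    have h2 := ENNReal.toReal_mono ENNReal.ofReal_ne_top hgc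
    rw [ENNReal.toReal_ofReal hc0] at h2
    rw [hgL, hc, Complex.norm_real, Real.norm_of_nonneg hc0] at h1
    obtain ⟨κ, hκ0, hκ, -⟩ := exists_bergmanKernel_self (n := n) w u
    rw [hκ, Complex.ofReal_re] at h1 ⊢
    by_contra hlt
    push Not at hlt
    nlinarith
  set ξ := fun j => (bergmanKernel n (Xs j)).diag.pushforward (φ j) with hξdef
  set ξt := (bergmanKernel n Xt).diag.pushforward φt with hξtdef
  have hξ : ∀ j, (ξ j).pullback φt = ((bergmanKernel n (Xs j)).pullback (ψ j)).diag := fun j => by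
    rw [hcomp' j, VolForm.pullback_comp
      ((hφ.galois j).isLocalBiholomorphism.mdifferentiable (by simp))
      ((hψ' j).mdifferentiable (by simp)), pullback_pushforward_bergmanKernel (hφ.galois j)]
    rfl
  have hξt : ξt.pullback φt = (bergmanKernel n Xt).diag :=
    pullback_pushforward_bergmanKernel hconv.galois
  -- The limit on the diagonal descends as well, being a limit of forms which come from `X`.
  obtain ⟨ξL, hξL⟩ := VolForm.exists_tendsto_of_pullback hs hχ (l := l) (ξ := ξ) (ρ := L.diag)
    fun y v => by simp only [hξ]; exact hL y y v v
  have hcov : ∀ j, (ξ j).IsCovariant := fun j => VolForm.isCovariant_of_pullback hs hχ (by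
    rw [hξ]; exact isCovariant_diag_bergmanKernel.pullback (ψ j))
  have hcovt : ξt.IsCovariant := VolForm.isCovariant_of_pullback hs hχ (by
    rw [hξt]; exact isCovariant_diag_bergmanKernel)
  have hcovL : ξL.IsCovariant := VolForm.isCovariant_of_pullback hs hχ (by
    rw [hξL]
    intro x A v
    refine tendsto_nhds_unique (hL x x _ _) (((hL x x v v).const_mul _).congr fun j => ?_)
    exact (isCovariant_diag_bergmanKernel.pullback (ψ j) x A v).symm)
  have hnn : ∀ j, (ξ j).IsNonneg := fun j => VolForm.isNonneg_of_pullback hs hχ (by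
    rw [hξ]; exact fun _ _ => isNonneg_diag_bergmanKernel _ _)
  have hnnt : ξt.IsNonneg := VolForm.isNonneg_of_pullback hs hχ (by
    rw [hξt]; exact isNonneg_diag_bergmanKernel)
  have hnnL : ξL.IsNonneg := VolForm.isNonneg_of_pullback hs hχ (by
    rw [hξL]
    exact fun x v => (hLd x v).imp fun c hc => ⟨hc.1, hc.2.1⟩)
  choose y hy using hs
  -- In these charts a form on `X` and its pull-back to `Xt` have the same coefficient, so
  -- continuity and convergence transfer from `Xt` to `X`.
  choose e he c hc hye hec heq using fun x => exists_chart_pair hχ (y x)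
  have hxe : ∀ x, x ∈ (e x).source := fun x => by
    have := hye x
    rwa [hy] at this
  have hLun := fun x => tendstoLocallyUniformlyOn_polarCoeff hχ hψ' hcomp' hL (hc x) (hc x)
  have hcont : ∀ {ρ : VolForm n X} {K : DoubleForm n Xt}, ρ.pullback φt = K.diag → ∀ x,
      DifferentiableOn ℂ (K.polarCoeff (c x) (c x)) (polarDomain (c x) (c x)) →
      ContinuousOn (ρ.coeff (e x)) (e x).target := fun {ρ K} hρ x hK => by
    refine ((continuousOn_diag_coeff hK).mono (hec x)).congr ?_
    rw [← hρ]
    exact (heq x ρ).symm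
  have hξc : ∀ j x, ContinuousOn ((ξ j).coeff (e x)) (e x).target := fun j x =>
    hcont (hξ j) x (differentiableOn_polarCoeff (hψ' j) (hc x) (hc x))
  have hξtc : ∀ x, ContinuousOn (ξt.coeff (e x)) (e x).target := fun x => by
    have h := differentiableOn_polarCoeff (n := n) (X := Xt) (ψ := id)
      (Diffeomorph.refl 𝓘(ℂ, Fin n → ℂ) Xt ω).isLocalDiffeomorph (hc x) (hc x)
    rw [DoubleForm.pullback_id] at h
    exact hcont hξt x h
  have hξLc : ∀ x, ContinuousOn (ξL.coeff (e x)) (e x).target := fun x =>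
    hcont hξL x (differentiableOn_polarCoeff_of_tendsto hψ' (hc x) (hc x) (hLun x))
  have hun : ∀ x, TendstoLocallyUniformlyOn (fun j => (ξ j).coeff (e x)) (ξL.coeff (e x)) l
      (e x).target := fun x => by
    have h := (tendstoLocallyUniformlyOn_diag_coeff (hLun x)).mono (hec x)
    refine (h.congr fun j => ?_).congr_right ?_
    · rw [← hξ]; exact heq x (ξ j)
    · rw [← hξL]; exact heq x ξL
  obtain ⟨hmass, hfin⟩ := tendsto_absMeasure_univ hcov hcovL he hxe hun hξLc
  -- A constant family along a trivial filter: only the finiteness of the mass of a continuous form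
  -- on compact `X` is extracted.
  have hfint : ξt.absMeasure Set.univ ≠ ⊤ := (tendsto_absMeasure_univ (l := (pure 0 : Filter ℕ))
    (η := fun _ => ξt) (fun _ => hcovt) hcovt he hxe
    (fun x s hs y _ => ⟨Set.univ, univ_mem, Eventually.of_forall fun _ _ _ =>
      refl_mem_uniformity hs⟩) hξtc).2
  have hmasst : (ξt.absMeasure Set.univ).toReal = (ξL.absMeasure Set.univ).toReal := by
    have h1 := hint.mono_left hl
    change Tendsto (fun j => (ξ j).integral) l (𝓝 ξt.integral) at h1
    rw [hnnt.integral_eq hcovt he hxe hξtc] at h1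
    have h2 : ∀ j, (ξ j).integral = _ := fun j => (hnn j).integral_eq (hcov j) he hxe (hξc j)
    simp only [h2] at h1
    have h3 := ((Complex.continuous_ofReal.tendsto _).comp
      ((ENNReal.tendsto_toReal hfin).comp hmass)).const_mul
        ((2 : ℂ) ^ n * (Complex.I⁻¹) ^ (n ^ 2))
    have h4 := tendsto_nhds_unique h1 h3
    have hne : (2 : ℂ) ^ n * (Complex.I⁻¹) ^ (n ^ 2) ≠ 0 := by simp
    exact Complex.ofReal_injective (mul_left_cancel₀ hne h4)
  have hxi : ξL = ξt := by
    refine VolForm.eq_of_le_of_absMeasure_eq hcovL hcovt he hxe hξLc hξtc hnnL hnnt ?_ hfin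
      ((ENNReal.toReal_eq_toReal_iff' hfint hfin).1 hmasst).le
    intro x v
    obtain ⟨y, u, hyu⟩ := VolForm.exists_apply_eq_pullback
      (surjective_of_isCoveringMap hconv.galois.isCoveringMap) hχ x v
    rw [← hyu ξL, ← hyu ξt, hξL, hξt]
    obtain ⟨c, hc0, hc, hcle⟩ := hLd y u
    change ‖L y y u u‖ ≤ ‖bergmanKernel n Xt y y u u‖
    rw [hc, Complex.norm_real, Real.norm_of_nonneg hc0]
    exact hcle.trans (Complex.re_le_norm _)
  have hdiag : L.diag = (bergmanKernel n Xt).diag := by rw [← hξL, hxi, hξt]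
  funext z w v u
  obtain ⟨g, hg, hgL, c, hc0, hc, hgc⟩ := hsec w u
  have h1 : L w w u u = bergmanKernel n Xt w w u u := congrFun (congrFun hdiag w) u
  rw [← hgL]
  refine eq_bergmanKernel_of_absMeasure_le hg ?_ ((hgL w u).trans h1) z v
  rwa [← h1, hc, Complex.ofReal_re]

/-- The values are bounded uniformly in `j`, so along each ultrafilter finer than `atTop` they
converge at all points and frames simultaneously, with no diagonal subsequence. The limit is always
the kernel of `Xt`. -/
theorem tendsto_pullback_bergmanKernel (hφ : IsTower n φ) (hconv : TowerConvergesTo n φ φt)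
    (hψ : ∀ j, IsHolomorphicCovering n (ψ j)) (hcomp : ∀ j, φt = (φ j).comp (ψ j))
    (hint : Tendsto (fun j => ((bergmanKernel n (Xs j)).diag.pushforward (φ j)).integral) atTop
      (𝓝 ((bergmanKernel n Xt).diag.pushforward φt).integral)) (z w : Xt)
    (v : Fin n → TangentSpace 𝓘(ℂ, Fin n → ℂ) z) (u : Fin n → TangentSpace 𝓘(ℂ, Fin n → ℂ) w) :
    Tendsto (fun j => (bergmanKernel n (Xs j)).pullback (ψ j) z w v u) atTop
      (𝓝 (bergmanKernel n Xt z w v u)) := by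
  have hψ' := fun j => (hψ j).isLocalBiholomorphism
  have hcomp' : ∀ j, (φt : Xt → X) = φ j ∘ ψ j := fun j => by rw [hcomp j]; rfl
  have hd : ∀ z (v : Fin n → TangentSpace 𝓘(ℂ, Fin n → ℂ) z), ∃ C : ℝ, ∀ j,
      ((bergmanKernel n (Xs j)).pullback (ψ j) z z v v).re ≤ C := by
    intro z v
    set c := chartAt (Fin n → ℂ) z
    have hcm : c ∈ holCharts n Xt := IsManifold.chart_mem_maximalAtlas _
    have hzc : z ∈ c.source := mem_chart_source _ z
    obtain ⟨r, hr⟩ := exists_injectiveBall hconv.galois.isLocalBiholomorphism (c.map_source hzc)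
    obtain ⟨t, ht0, ht⟩ := VolForm.IsCovariant.exists_apply_eq_mul_coeff hcm hzc v
    refine ⟨t * kernelBound n r, fun j => ?_⟩
    have h1 := ht _ (isCovariant_diag_bergmanKernel.pullback (ψ j))
    rw [hcomp' j] at hr
    have h2 := pullback_diag_coeff_re_le (hψ' j) hcm hr.of_comp (Metric.mem_ball_self hr.pos)
    refine (congrArg Complex.re h1).trans_le ?_
    rw [Complex.re_ofReal_mul]
    gcongr
  have hbd : ∀ z w (v : Fin n → TangentSpace 𝓘(ℂ, Fin n → ℂ) z)
      (u : Fin n → TangentSpace 𝓘(ℂ, Fin n → ℂ) w), ∃ C : ℝ, ∀ j,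
      ‖(bergmanKernel n (Xs j)).pullback (ψ j) z w v u‖ ≤ C := by
    intro z w v u
    obtain ⟨C, hC⟩ := hd z v
    obtain ⟨C', hC'⟩ := hd w u
    exact ⟨(C + C') / 2, fun j => (norm_bergmanKernel_le _ _ _ _).trans
      (div_le_div_of_nonneg_right (add_le_add (hC j) (hC' j)) zero_le_two)⟩
  rw [tendsto_iff_ultrafilter]
  intro U hU
  have hlim : ∀ z w (v : Fin n → TangentSpace 𝓘(ℂ, Fin n → ℂ) z)
      (u : Fin n → TangentSpace 𝓘(ℂ, Fin n → ℂ) w), ∃ c : ℂ,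
      Tendsto (fun j => (bergmanKernel n (Xs j)).pullback (ψ j) z w v u) U (𝓝 c) := by
    intro z w v u
    obtain ⟨C, hC⟩ := hbd z w v u
    obtain ⟨c, -, hc⟩ := (isCompact_closedBall (0 : ℂ) C).ultrafilter_le_nhds
      (U.map fun j => (bergmanKernel n (Xs j)).pullback (ψ j) z w v u)
      (tendsto_principal.2 (Eventually.of_forall fun j => mem_closedBall_zero_iff.2 (hC j)))
    exact ⟨c, hc⟩
  choose L hL using hlim
  have h := eq_bergmanKernel_of_tendsto hφ hconv hψ hcomp hint hU hL
  rw [← h]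
  exact hL z w v u

end Tower

end BergmanTower

theorem proposition5p3 (n : ℕ)
    (X : Type*) [TopologicalSpace X] [ChartedSpace (Fin n → ℂ) X]
    [IsManifold 𝓘(ℂ, Fin n → ℂ) ω X] [T2Space X] [CompactSpace X] [ConnectedSpace X]
    [MeasurableSpace X] [BorelSpace X]
    (Xs : ℕ → Type*) [∀ j, TopologicalSpace (Xs j)] [∀ j, ChartedSpace (Fin n → ℂ) (Xs j)]
    [∀ j, IsManifold 𝓘(ℂ, Fin n → ℂ) ω (Xs j)] [∀ j, T2Space (Xs j)]
    [∀ j, SecondCountableTopology (Xs j)] [∀ j, ConnectedSpace (Xs j)]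
    [∀ j, MeasurableSpace (Xs j)] [∀ j, BorelSpace (Xs j)]
    (Xt : Type*) [TopologicalSpace Xt] [ChartedSpace (Fin n → ℂ) Xt]
    [IsManifold 𝓘(ℂ, Fin n → ℂ) ω Xt] [T2Space Xt] [SecondCountableTopology Xt]
    [ConnectedSpace Xt] [MeasurableSpace Xt] [BorelSpace Xt]
    (φ : ∀ j, C(Xs j, X)) (φt : C(Xt, X))
    (hφ : BergmanTower.IsTower n φ) (hconv : BergmanTower.TowerConvergesTo n φ φt)
    (ψ : ∀ j, C(Xt, Xs j)) (hψ : ∀ j, BergmanTower.IsHolomorphicCovering n (ψ j))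
    (hcomp : ∀ j, φt = (φ j).comp (ψ j))
    (hint : Tendsto
      (fun j => ((BergmanTower.bergmanKernel n (Xs j)).diag.pushforward (φ j)).integral) atTop
      (𝓝 ((BergmanTower.bergmanKernel n Xt).diag.pushforward φt).integral)) :
    BergmanTower.TendstoLocallySmoothly
      (fun j => (BergmanTower.bergmanKernel n (Xs j)).pullback (ψ j))
      (BergmanTower.bergmanKernel n Xt) := by
  intro e he e' he'
  have hψ' := fun j => (hψ j).isLocalBiholomorphism
  have hcomp' : ∀ j, (φt : Xt → X) = φ j ∘ ψ j := fun j => by rw [hcomp j]; rfl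
  have hd := fun j => BergmanTower.differentiableOn_polarCoeff (hψ' j) he he'
  -- Pointwise convergence is upgraded to locally uniform convergence of functions holomorphic in
  -- `(z, w̄)`, and hence of all their derivatives.
  have hu := BergmanTower.tendstoLocallyUniformlyOn_polarCoeff
    hconv.galois.isLocalBiholomorphism hψ' hcomp'
    (BergmanTower.tendsto_pullback_bergmanKernel hφ hconv hψ hcomp hint) he he'
  exact ⟨fun j => BergmanTower.contDiffOn_coeff (hd j), BergmanTower.contDiffOn_coeff
    (BergmanTower.differentiableOn_polarCoeff_of_tendsto hψ' he he' hu),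
    fun m => BergmanTower.tendstoLocallyUniformlyOn_iteratedFDeriv_coeff hd hu m⟩
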